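/- **Theorem 1.18.** Let $(X,\mathcal B,\mu)$ be a $\sigma$-finite measure space without atoms, i.e. every $E\in\mathcal B$ with $\mu(E)>0$ can be partitioned into two measurable subsets of positive measure. Let $1\le p\le\infty$ and $\varphi\in L^\infty(X\times X,\mathcal B\otimes\mathcal B,\mu\otimes\mu)$ (complex valued). Then $$\|\varphi\|_{MS^p(L^2(X))}=\|\varphi\|_{cbMS^p(L^2(X))}\quad\text{in }[0,\infty].$$ Here, for a complex Hilbert space $H$, $S^p(H)$ is the Schatten class: for $p<\infty$, the bounded operators $A$ on $H$ with $\|A\|_p=\operatorname{Tr}(|A|^p)^{1/p}<\infty$; for $p=\infty$, the compact operators with the operator norm. The space $S^2(L^2(X))$ is identified with $L^2(X\times X,\mu\otimes\mu)$ by letting $k$ correspond to the operator $(A_kf)(x)=\int k(x,y)f(y)\,d\mu(y)$. The Schur multiplier with symbol $\varphi$ is the map $M_\varphi:A_k\mapsto A_{\varphi k}$ on $S^2(L^2(X))$. The norm $\|\varphi\|_{MS^p(L^2(X))}$ is the norm of the bounded linear map $S^p(L^2(X))\to S^p(L^2(X))$ that extends the restriction of $M_\varphi$ to $S^2\cap S^p$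 (this extension is unique and is still denoted $M_\varphi$), and it is $\infty$ if there is no such extension. The completely bounded norm $\|\varphi\|_{cbMS^p(L^2(X))}$ is the supremum over all complex Hilbert spaces $K$ of the norm of the bounded linear extension of $M_\varphi\otimes\mathrm{id}$ from $S^p(L^2(X))\otimes S^p(K)$ to $S^p(L^2(X)\otimes_2K)$, and it is $\infty$ if $M_\varphi$, or $M_\varphi\otimes\mathrm{id}$ for some $K$, has no such extension. -/

import Mathlib

open MeasureTheory TensorProduct UniformSpace
open scoped ENNReal NNReal

universe u v

noncomputable section

namespace SchurMultiplier

section Schatten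

variable {H : Type*} [NormedAddCommGroup H] [InnerProductSpace ℂ H] [CompleteSpace H]

/-- An orthonormal basis of the Hilbert space `H`, chosen once and for all. -/
def stdBasisIndex (H : Type*) [NormedAddCommGroup H] [InnerProductSpace ℂ H] [CompleteSpace H] :
    Set H :=
  (exists_hilbertBasis ℂ H).choose

/-- The chosen orthonormal basis, indexed by the set of its vectors. -/
def stdBasis (H : Type*) [NormedAddCommGroup H] [InnerProductSpace ℂ H] [CompleteSpace H] :
    HilbertBasis (stdBasisIndex H) ℂ H :=
  (exists_hilbertBasis ℂ H).choose_spec.choose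

/-- The trace `∑ᵢ ⟨eᵢ, a eᵢ⟩ ∈ [0, ∞]` of a positive operator `a`
(it does not depend on the orthonormal basis `(eᵢ)`). -/
def posTrace (a : H →L[ℂ] H) : ℝ≥0∞ :=
  ∑' i, ENNReal.ofReal (inner ℂ (stdBasis H i) (a (stdBasis H i))).re

/-- `A` belongs to the Schatten class `S^p(H)`: `A` is compact if `p = ∞`, and
`Tr(|A|^p) < ∞` if `p < ∞`, where `|A| = (A* A)^{1/2}`. -/
def MemSchatten (p : ℝ≥0∞) (A : H →L[ℂ] H) : Prop :=
  if p = ∞ then IsCompactOperator A else posTrace (CFC.abs A ^ p.toReal) < ∞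

/-- The norm of `S^p(H)`: the operator norm if `p = ∞`, and `Tr(|A|^p)^{1/p}` if `p < ∞`. -/
def schattenNorm (p : ℝ≥0∞) (A : H →L[ℂ] H) : ℝ≥0∞ :=
  if p = ∞ then ‖A‖ₑ else posTrace (CFC.abs A ^ p.toReal) ^ (1 / p.toReal)

/-- `T` restricts to a bounded linear map `S^p(H) → S^p(H)` of norm at most `C`.
(The values of `T` outside `S^p(H)` play no role.) -/
structure IsBoundedOnSchatten (p : ℝ≥0∞) (C : ℝ≥0) (T : (H →L[ℂ] H) → (H →L[ℂ] H)) : Prop where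
  mapsTo : ∀ A, MemSchatten p A → MemSchatten p (T A)
  map_add : ∀ A B, MemSchatten p A → MemSchatten p B → T (A + B) = T A + T B
  map_smul : ∀ (c : ℂ) A, MemSchatten p A → T (c • A) = c • T A
  bound : ∀ A, MemSchatten p A → schattenNorm p (T A) ≤ C * schattenNorm p A

/-- The Hilbert space tensor product `H ⊗₂ K`. -/
abbrev HilbertTensor (H K : Type*) [NormedAddCommGroup H] [InnerProductSpace ℂ H]
    [NormedAddCommGroup K] [InnerProductSpace ℂ K] :=
  Completion (H ⊗[ℂ] K)

/-- The operator `A ⊗ B` on `H ⊗₂ K`, with `(A ⊗ B)(x ⊗ y) = A x ⊗ B y`. -/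
def tensorOp {K : Type*} [NormedAddCommGroup K] [InnerProductSpace ℂ K]
    (A : H →L[ℂ] H) (B : K →L[ℂ] K) : HilbertTensor H K →L[ℂ] HilbertTensor H K :=
  (TensorProduct.mapL A B).completion

/-- The map `T^{(K)} = T ⊗ id` on `S^p(H) ⊗ S^p(K) ⊆ S^p(H ⊗₂ K)` extends to a bounded linear map
on `S^p(H ⊗₂ K)` of norm at most `C`. -/
def AmplificationBounded (p : ℝ≥0∞) (C : ℝ≥0) (T : (H →L[ℂ] H) → (H →L[ℂ] H))
    (K : Type*) [NormedAddCommGroup K] [InnerProductSpace ℂ K] [CompleteSpace K] : Prop :=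
  ∃ S : (HilbertTensor H K →L[ℂ] HilbertTensor H K) → (HilbertTensor H K →L[ℂ] HilbertTensor H K),
    IsBoundedOnSchatten p C S ∧
      ∀ (A : H →L[ℂ] H) (B : K →L[ℂ] K), MemSchatten p A → MemSchatten p B →
        S (tensorOp A B) = tensorOp (T A) B

end Schatten

section Multiplier

variable {X : Type u} [MeasurableSpace X]

/-- The measure `μ` has no atom: every measurable set of positive measure is the union of two
disjoint measurable subsets of positive measure. -/
def Atomless (μ : Measure X) : Prop :=
  ∀ s, MeasurableSet s → μ s ≠ 0 → ∃ t ⊆ s, MeasurableSet t ∧ μ t ≠ 0 ∧ μ (s \ t) ≠ 0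

/-- Under the identification `S²(L²(X, μ)) = L²(X × X, μ ⊗ μ)`, the operator `A` corresponds to
the function `k`: `(A f)(x) = ∫ k(x, y) f(y) dμ(y)` for all `f ∈ L²(X, μ)`. -/
def HasKernel (μ : Measure X) (A : Lp ℂ 2 μ →L[ℂ] Lp ℂ 2 μ) (k : X × X → ℂ) : Prop :=
  MemLp k 2 (μ.prod μ) ∧ ∀ f : Lp ℂ 2 μ, A f =ᵐ[μ] fun x => ∫ y, k (x, y) * f y ∂μ

/-- `T` extends to `S^p(L²(X, μ))` the Schur multiplier with symbol `φ`: whenever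
`A ∈ S² ∩ S^p` has kernel `k` and `B ∈ S²` has kernel `φ k`, then `T A = B`. -/
def ExtendsSchur (μ : Measure X) (p : ℝ≥0∞) (φ : X × X → ℂ)
    (T : (Lp ℂ 2 μ →L[ℂ] Lp ℂ 2 μ) → (Lp ℂ 2 μ →L[ℂ] Lp ℂ 2 μ)) : Prop :=
  ∀ (A B : Lp ℂ 2 μ →L[ℂ] Lp ℂ 2 μ) (k : X × X → ℂ),
    MemSchatten 2 A → MemSchatten p A → HasKernel μ A k → HasKernel μ B (fun z => φ z * k z) →
      T A = B

/-- The norm `‖φ‖_{MS^p(L²(X, μ))} ∈ [0, ∞]` of the Schur multiplier with symbol `φ`, equal to `∞`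
if the multiplier does not extend to a bounded linear map on `S^p`. -/
def schurNorm (μ : Measure X) (p : ℝ≥0∞) (φ : X × X → ℂ) : ℝ≥0∞ :=
  ⨅ (C : ℝ≥0) (_ : ∃ T, ExtendsSchur μ p φ T ∧ IsBoundedOnSchatten p C T), (C : ℝ≥0∞)

/-- The completely bounded norm `‖φ‖_{cbMS^p(L²(X, μ))} ∈ [0, ∞]` of the Schur multiplier with
symbol `φ`: the supremum over all Hilbert spaces `K` (in an arbitrary universe) of the norm of
`M_φ ⊗ id` on `S^p(L²(X, μ) ⊗₂ K)`, equal to `∞` if the multiplier does not extend to a completely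
bounded map on `S^p`. -/
def schurCbNorm (μ : Measure X) (p : ℝ≥0∞) (φ : X × X → ℂ) : ℝ≥0∞ :=
  ⨅ (C : ℝ≥0)
    (_ : ∃ T, ExtendsSchur μ p φ T ∧ (∃ C' : ℝ≥0, IsBoundedOnSchatten p C' T) ∧
      ∀ (K : Type v) [NormedAddCommGroup K] [InnerProductSpace ℂ K] [CompleteSpace K],
        AmplificationBounded p C T K), (C : ℝ≥0∞)

end Multiplier

end SchurMultiplier

end

/-! Both norms are infima over constants `C`, and the same extension `T` serves for both, so the
point is that a bound `C` for `T` on `S^p(H)`, with `H = L²(X, μ)`, is also a bound for every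
amplification. The converse follows by restricting to a one-dimensional `K`.

Multiplying a kernel by `s(x) s'(y)`, with `s` and `s'` functions with values `±1`, commutes with
multiplying it by `φ`. Hence `T (R A R') = R (T A) R'` for all multiplication operators `R`, `R'` by
sign functions (`ExtendsSchur.map_signMul_rankOne` in rank one, then
`IsBoundedOnSchatten.map_conj_of_rankOne` by density). An orthonormal basis of `K` cuts `H ⊗₂ K`
into orthogonal copies `ι i` of `H`. For finitely many indices put `V = ∑ R i (ι i)*`, an operator
from `H ⊗₂ K` to `H`. Then `T (V Z V*) = V (T applied to each block of Z) V*`, by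
`OrthogonalCopies.map_signedSum_conj`.

If `V` were isometric, the block map would inherit the bound `C` at once. Atomlessness makes this
almost true: an integrable function can be made to have integral close to zero by a suitable change
of signs, because each level set of a simple function can be halved. So the `R i` can be chosen with
`⟨R i f, R j g⟩` as small as desired for `i ≠ j` and finitely many `f`, `g`
(`Atomless.exists_signMul_family`), and `V` becomes nearly isometric on any given finite dimensional
subspace (`CommutesWithSigns.exists_nearly_isometric`). Since `Z` and its image are close in `S^p`
to their compressions to such subspaces, the bound `C` holds for finitely many blocks
(`OrthogonalCopies.schattenReal_blockMap_le`), and then for all blocks by a limit.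

The facts needed about `S^p` come from one variational description, `schattenNorm_le_ofReal_iff`:
for `1 ≤ p < ∞`, `‖A‖_p ≤ c` means `∑ |⟨f i, A (e i)⟩|^p ≤ c^p` for all finite Bessel families. The
triangle inequality, the ideal property and lower semicontinuity are then immediate. -/

noncomputable section

namespace SchurMultiplier

open Filter Topology InnerProductSpace
open ContinuousLinearMap (adjoint)

/-! ### Finite Bessel families. -/

section Bessel

variable {H : Type*} [NormedAddCommGroup H] [InnerProductSpace ℂ H]
variable {H' : Type*} [NormedAddCommGroup H'] [InnerProductSpace ℂ H']

/-- A finite family satisfying Bessel's inequality with constant `1`. -/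
def IsBessel {ι : Type*} [Fintype ι] (e : ι → H) : Prop :=
  ∀ x : H, ∑ i, ‖inner ℂ (e i) x‖ ^ 2 ≤ ‖x‖ ^ 2

variable {ι : Type*} [Fintype ι]

lemma _root_.Orthonormal.isBessel {e : ι → H} (he : Orthonormal ℂ e) : IsBessel e :=
  fun x => he.sum_inner_products_le x

lemma IsBessel.norm_le_one {e : ι → H} (he : IsBessel e) (i : ι) : ‖e i‖ ≤ 1 := by
  have h : ‖inner ℂ (e i) (e i)‖ ^ 2 ≤ ‖e i‖ ^ 2 :=
    (Finset.single_le_sum (f := fun j => ‖inner ℂ (e j) (e i)‖ ^ 2)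
      (fun _ _ => sq_nonneg _) (Finset.mem_univ i)).trans (he (e i))
  rw [inner_self_eq_norm_sq_to_K] at h
  have h' : ‖e i‖ ^ 4 ≤ ‖e i‖ ^ 2 := by
    have : ‖((‖e i‖ : ℂ)) ^ 2‖ = ‖e i‖ ^ 2 := by simp
    calc ‖e i‖ ^ 4 = (‖e i‖ ^ 2) ^ 2 := by ring
      _ = _ := by rw [← this]; rfl
      _ ≤ _ := h
  by_contra hlt
  push Not at hlt
  have : ‖e i‖ ^ 2 < ‖e i‖ ^ 4 := pow_lt_pow_right₀ hlt (by norm_num)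
  linarith

/-- Orthonormal families are not stable under contractions. This stability is the reason for testing
on Bessel families. -/
lemma IsBessel.map [CompleteSpace H] [CompleteSpace H'] {e : ι → H} (he : IsBessel e)
    {V : H →L[ℂ] H'} (hV : ‖V‖ ≤ 1) : IsBessel (fun i => V (e i)) := by
  intro x
  simp_rw [← ContinuousLinearMap.adjoint_inner_right]
  refine (he _).trans ?_
  gcongr
  refine (ContinuousLinearMap.le_opNorm _ _).trans ?_
  rw [LinearIsometryEquiv.norm_map]
  exact mul_le_of_le_one_left (norm_nonneg _) hV

lemma IsBessel.reindex {ι' : Type*} [Fintype ι'] (φ : ι' ≃ ι) {e : ι → H} (he : IsBessel e) :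
    IsBessel (fun i => e (φ i)) := fun x =>
  (φ.sum_comp fun i => ‖inner ℂ (e i) x‖ ^ 2).trans_le (he x)

lemma ofReal_norm_sq_eq_tsum {κ : Type*} (f : HilbertBasis κ ℂ H) (x : H) :
    ENNReal.ofReal (‖x‖ ^ 2) = ∑' j, ENNReal.ofReal (‖inner ℂ (f j) x‖ ^ 2) := by
  have h := f.hasSum_inner_mul_inner x x
  have h2 : HasSum (fun j => ‖inner ℂ (f j) x‖ ^ 2) (‖x‖ ^ 2) := by
    have := Complex.hasSum_re h
    convert this using 1
    · ext j
      rw [← inner_conj_symm x, RCLike.conj_mul]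
      norm_cast
    · rw [inner_self_eq_norm_sq_to_K]
      norm_cast
  rw [← h2.tsum_eq, ENNReal.ofReal_tsum_of_nonneg (fun _ => sq_nonneg _) h2.summable]

/-- The Hilbert–Schmidt sum over a Bessel family is at most the one over a Hilbert basis. -/
lemma IsBessel.sum_norm_sq_le_tsum [CompleteSpace H] {κ : Type*} (f : HilbertBasis κ ℂ H)
    {e : ι → H} (he : IsBessel e) {b : H →L[ℂ] H} (hb : IsSelfAdjoint b) :
    ∑ i, ENNReal.ofReal (‖b (e i)‖ ^ 2) ≤ ∑' j, ENNReal.ofReal (‖b (f j)‖ ^ 2) := by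
  -- Expand each `b (e i)` along `f`, exchange the sums, and move `b` onto `f j`; the inner sum over
  -- `i` is then bounded by the Bessel inequality at `b (f j)`.
  simp_rw [ofReal_norm_sq_eq_tsum f (b (e _))]
  rw [← Summable.tsum_finsetSum fun _ _ => ENNReal.summable]
  refine ENNReal.tsum_le_tsum fun j => ?_
  rw [← ENNReal.ofReal_sum_of_nonneg fun _ _ => sq_nonneg _]
  refine ENNReal.ofReal_le_ofReal ?_
  refine le_trans (le_of_eq ?_) (he (b (f j)))
  refine Finset.sum_congr rfl fun i _ => ?_
  rw [← ContinuousLinearMap.adjoint_inner_left,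
    ContinuousLinearMap.isSelfAdjoint_iff'.mp hb, norm_inner_symm]

end Bessel

/-! ### Spectral inequalities for powers of a positive operator. -/

section FunctionalCalculus

variable {H : Type*} [NormedAddCommGroup H] [InnerProductSpace ℂ H] [CompleteSpace H]

lemma re_inner_cfc_mono {a : H →L[ℂ] H} {f g : ℝ → ℝ}
    (h : ∀ t ∈ spectrum ℝ a, f t ≤ g t) (x : H)
    (hf : Continuous f) (hg : Continuous g) :
    (inner ℂ x (cfc f a x)).re ≤ (inner ℂ x (cfc g a x)).re := by
  have := cfc_mono (a := a) h hf.continuousOn hg.continuousOn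
  rw [ContinuousLinearMap.le_def] at this
  have h2 := this.re_inner_nonneg_right x
  rw [sub_apply, inner_sub_right, map_sub] at h2
  exact sub_nonneg.mp h2

lemma inner_cfc_cfc {a : H →L[ℂ] H} {f g : ℝ → ℝ} (x y : H)
    (hf : Continuous f) (hg : Continuous g) :
    inner ℂ (cfc f a x) (cfc g a y) = inner ℂ x (cfc (fun t => f t * g t) a y) := by
  rw [cfc_mul f g a hf.continuousOn hg.continuousOn, mul_apply_eq_comp,
    ← ContinuousLinearMap.adjoint_inner_right,
    ContinuousLinearMap.isSelfAdjoint_iff'.mp (IsSelfAdjoint.cfc (f := f) (a := a))]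

lemma norm_cfc_apply_sq {a : H →L[ℂ] H} {f : ℝ → ℝ} (x : H) (hf : Continuous f) :
    ‖cfc f a x‖ ^ 2 = (inner ℂ x (cfc (fun t => f t ^ 2) a x)).re := by
  simp_rw [pow_two (f _)]
  rw [← inner_cfc_cfc x x hf hf]
  exact norm_sq_eq_re_inner (𝕜 := ℂ) _

/-- The tangent line inequality for the convex function `t ↦ t ^ p`. -/
lemma tangent_le_rpow {p s t : ℝ} (hp : 1 ≤ p) (hs : 0 ≤ s) (ht : 0 ≤ t) :
    s ^ p + p * s ^ (p - 1) * (t - s) ≤ t ^ p := by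
  rcases hs.eq_or_lt with rfl | hs
  · rcases hp.eq_or_lt with rfl | hp
    · simp
    · rw [Real.zero_rpow (by linarith), Real.zero_rpow (by linarith)]
      simpa using Real.rpow_nonneg ht p
  · have h := one_add_mul_self_le_rpow_one_add (s := t / s - 1)
      (by have := div_nonneg ht hs.le; linarith) hp
    have h1 : (1 + (t / s - 1)) = t / s := by ring
    rw [h1, Real.div_rpow ht hs.le, le_div_iff₀ (Real.rpow_pos_of_pos hs p)] at h
    have h2 : s ^ p = s ^ (p - 1) * s := by
      rw [Real.rpow_sub hs, Real.rpow_one]; field_simp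
    calc s ^ p + p * s ^ (p - 1) * (t - s) = (1 + p * (t / s - 1)) * s ^ p := by
          rw [h2]; field_simp
      _ ≤ t ^ p := h

lemma continuous_rpow_half {p : ℝ} (hp : 1 ≤ p) : Continuous fun t : ℝ => t ^ (p / 2) :=
  Real.continuous_rpow_const (by linarith)

lemma rpow_half_sq {p t : ℝ} (ht : 0 ≤ t) : (t ^ (p / 2)) ^ 2 = t ^ p := by
  rw [← Real.rpow_natCast, ← Real.rpow_mul ht]; norm_num

lemma norm_cfc_rpow_half_sq {a : H →L[ℂ] H} (ha : 0 ≤ a) {p : ℝ} (hp : 1 ≤ p) (x : H) :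
    ‖cfc (fun t : ℝ => t ^ (p / 2)) a x‖ ^ 2 = (inner ℂ x (cfc (fun t : ℝ => t ^ p) a x)).re := by
  rw [norm_cfc_apply_sq x (continuous_rpow_half hp)]
  congr 3
  exact cfc_congr fun t ht => rpow_half_sq (spectrum_nonneg_of_nonneg ha ht)

lemma posTrace_rpow {a : H →L[ℂ] H} (ha : 0 ≤ a) {p : ℝ} (hp : 1 ≤ p) :
    posTrace (a ^ p) =
      ∑' i, ENNReal.ofReal (‖cfc (fun t : ℝ => t ^ (p / 2)) a (stdBasis H i)‖ ^ 2) := by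
  simp_rw [norm_cfc_rpow_half_sq ha hp, posTrace, CFC.rpow_eq_cfc_real (a := a) ha]

lemma re_inner_cfc_const_add_mul {a : H →L[ℂ] H} (ha : 0 ≤ a) (c d : ℝ) {f : ℝ → ℝ}
    (hf : Continuous f) (x : H) :
    (inner ℂ x (cfc (fun t : ℝ => c + d * f t) a x)).re =
      c * ‖x‖ ^ 2 + d * (inner ℂ x (cfc f a x)).re := by
  rw [cfc_const_add c (fun t : ℝ => d * f t) a (by fun_prop) (IsSelfAdjoint.of_nonneg ha),
    cfc_const_mul d f a (by fun_prop)]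
  rw [add_apply, inner_add_right, Complex.add_re,
    Algebra.algebraMap_eq_smul_one, smul_apply, smul_apply,
    one_apply_eq_self, inner_smul_right_eq_smul, inner_smul_right_eq_smul,
    Complex.smul_re, Complex.smul_re]
  rw [norm_sq_eq_re_inner (𝕜 := ℂ) x]
  simp

omit [CompleteSpace H] in
lemma re_inner_nonneg_of_nonneg {a : H →L[ℂ] H} (ha : 0 ≤ a) (x : H) :
    0 ≤ (inner ℂ x (a x)).re :=
  ((ContinuousLinearMap.nonneg_iff_isPositive a).mp ha).re_inner_nonneg_right x

/-- Jensen's inequality for the spectral measure of a positive operator at a vector of norm at most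
one. -/
lemma re_inner_rpow_le {a : H →L[ℂ] H} (ha : 0 ≤ a) {p : ℝ} (hp : 1 ≤ p) {x : H} (hx : ‖x‖ ≤ 1) :
    (inner ℂ x (a x)).re ^ p ≤ ‖cfc (fun t : ℝ => t ^ (p / 2)) a x‖ ^ 2 := by
  rw [norm_cfc_rpow_half_sq ha hp]
  set s := (inner ℂ x (a x)).re with hs
  have hs0 : 0 ≤ s := re_inner_nonneg_of_nonneg ha x
  -- The tangent to `t ^ p` at the mean `s` lies below the curve on the spectrum; evaluating it at
  -- `a` gives Jensen without a spectral measure.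
  have h := re_inner_cfc_mono (a := a) (x := x)
    (f := fun t => (s ^ p - p * s ^ (p - 1) * s) + p * s ^ (p - 1) * t) (g := fun t => t ^ p)
    (fun t ht => by
      have := tangent_le_rpow hp hs0 (spectrum_nonneg_of_nonneg ha ht)
      linarith) (by fun_prop) (Real.continuous_rpow_const (by linarith))
  rw [re_inner_cfc_const_add_mul ha _ _ continuous_id', cfc_id' ℝ a (IsSelfAdjoint.of_nonneg ha), ← hs]
    at h
  refine le_trans ?_ h
  have hsp : s ^ (p - 1) * s = s ^ p := by
    rcases hs0.eq_or_lt with h0 | h0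
    · rw [← h0, mul_zero, Real.zero_rpow (by linarith)]
    · rw [Real.rpow_sub h0, Real.rpow_one]; field_simp
  have hn : 0 ≤ 1 - ‖x‖ ^ 2 := by nlinarith [norm_nonneg x]
  -- The constant term of the tangent is `(1 - p) * s ^ p ≤ 0`, so a norm below one only helps.
  have : 0 ≤ (p - 1) * s ^ p * (1 - ‖x‖ ^ 2) :=
    mul_nonneg (mul_nonneg (by linarith) (Real.rpow_nonneg hs0 _)) hn
  rw [mul_assoc p, hsp]
  nlinarith

lemma IsBessel.sum_re_inner_rpow_le {ι : Type*} [Fintype ι] {a : H →L[ℂ] H} (ha : 0 ≤ a) {p : ℝ}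
    (hp : 1 ≤ p) {e : ι → H} (he : IsBessel e) :
    ∑ i, ENNReal.ofReal ((inner ℂ (e i) (a (e i))).re ^ p) ≤ posTrace (a ^ p) := by
  rw [posTrace_rpow ha hp]
  refine le_trans (Finset.sum_le_sum fun i _ => ENNReal.ofReal_le_ofReal
    (re_inner_rpow_le ha hp (he.norm_le_one i)))
    (he.sum_norm_sq_le_tsum (stdBasis H) IsSelfAdjoint.cfc)

end FunctionalCalculus

/-! ### Absolute value and polar decomposition. -/

section Polar

variable {H : Type*} [NormedAddCommGroup H] [InnerProductSpace ℂ H] [CompleteSpace H]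

lemma norm_abs_apply (A : H →L[ℂ] H) (x : H) : ‖CFC.abs A x‖ = ‖A x‖ := by
  have h1 : ‖CFC.abs A x‖ ^ 2 = ‖A x‖ ^ 2 := by
    rw [norm_sq_eq_re_inner (𝕜 := ℂ), norm_sq_eq_re_inner (𝕜 := ℂ),
      ← ContinuousLinearMap.adjoint_inner_right, ← ContinuousLinearMap.adjoint_inner_right,
      ← ContinuousLinearMap.star_eq_adjoint, ← ContinuousLinearMap.star_eq_adjoint,
      (IsSelfAdjoint.of_nonneg (CFC.abs_nonneg A)).star_eq]
    have := congrArg (fun B : H →L[ℂ] H => B x) (CFC.abs_mul_abs A)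
    simp only [mul_apply_eq_comp] at this
    rw [this]
  exact (pow_left_inj₀ (norm_nonneg _) (norm_nonneg _) two_ne_zero).mp h1

lemma norm_mul_eq_norm_abs_mul (A B : H →L[ℂ] H) : ‖A * B‖ = ‖CFC.abs A * B‖ := by
  apply le_antisymm
  · refine ContinuousLinearMap.opNorm_le_bound _ (norm_nonneg _) fun x => ?_
    rw [mul_apply_eq_comp, ← norm_abs_apply, ← mul_apply_eq_comp]
    exact ContinuousLinearMap.le_opNorm _ _
  · refine ContinuousLinearMap.opNorm_le_bound _ (norm_nonneg _) fun x => ?_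
    rw [mul_apply_eq_comp, norm_abs_apply, ← mul_apply_eq_comp]
    exact ContinuousLinearMap.le_opNorm _ _

/-- An approximate polar decomposition. -/
lemma exists_approx_polar (A : H →L[ℂ] H) {ε : ℝ} (hε : 0 < ε) :
    ∃ U : H →L[ℂ] H, ‖U‖ ≤ 1 ∧ ‖A - U * CFC.abs A‖ ≤ ε ∧ ‖CFC.abs A - star U * A‖ ≤ ε := by
  set a := CFC.abs A with ha_def
  have ha : 0 ≤ a := CFC.abs_nonneg A
  have hsa : IsSelfAdjoint a := IsSelfAdjoint.of_nonneg ha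
  have hpos : ∀ t : ℝ, 0 < max t 0 + ε := fun t => by positivity
  -- The partial isometry is replaced by `U = A (|A| + ε)⁻¹`; taking `max t 0` makes `g` continuous
  -- on the whole line.
  set g : ℝ → ℝ := fun t => (max t 0 + ε)⁻¹ with hg_def
  have hg : Continuous g :=
    Continuous.inv₀ (by fun_prop) fun t => (hpos t).ne'
  have hspec : ∀ t ∈ spectrum ℝ a, 0 ≤ t := fun t ht => spectrum_nonneg_of_nonneg ha ht
  have hag : a * cfc g a = cfc (fun t => t * g t) a := by
    rw [cfc_mul (fun t => t) g a (by fun_prop) hg.continuousOn, cfc_id' ℝ a]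
  have hga : cfc g a * a = cfc (fun t => t * g t) a := by
    simp_rw [mul_comm _ (g _)]
    rw [cfc_mul g (fun t => t) a hg.continuousOn (by fun_prop), cfc_id' ℝ a]
  have key : ‖a - a * (a * cfc g a)‖ ≤ ε := by
    have : a - a * (a * cfc g a) = cfc (fun t => t - t * (t * g t)) a := by
      rw [cfc_sub (fun t => t) (fun t => t * (t * g t)) a (by fun_prop)
        (by fun_prop), cfc_mul (fun t => t) (fun t => t * g t) a (by fun_prop)
        (by fun_prop), cfc_id' ℝ a, hag]
    rw [this]
    refine norm_cfc_le hε.le fun t ht => ?_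
    have ht0 := hspec t ht
    have : t - t * (t * g t) = t * ε / (t + ε) := by
      simp only [hg_def, max_eq_left ht0]
      field_simp
      ring
    rw [this, Real.norm_of_nonneg (by positivity), div_le_iff₀ (by positivity)]
    nlinarith
  refine ⟨A * cfc g a, ?_, ?_, ?_⟩
  · rw [norm_mul_eq_norm_abs_mul, ← ha_def, hag]
    refine norm_cfc_le zero_le_one fun t ht => ?_
    have ht0 := hspec t ht
    simp only [hg_def, max_eq_left ht0]
    rw [Real.norm_of_nonneg (by positivity), ← div_eq_mul_inv, div_le_one (by positivity)]
    linarith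
  · have : A - A * cfc g a * a = A * (1 - a * cfc g a) := by
      rw [mul_assoc, hga, ← hag, mul_sub, mul_one]
    rw [this, norm_mul_eq_norm_abs_mul, ← ha_def, mul_sub, mul_one]
    exact key
  · have : star (A * cfc g a) * A = a * (a * cfc g a) := by
      rw [star_mul, mul_assoc, ← CFC.abs_mul_abs A, ← ha_def,
        (IsSelfAdjoint.cfc (f := g) (a := a)).star_eq, ← mul_assoc, hga, hag]
      rw [← hag, mul_assoc, hga, hag]
    rw [this]
    exact key

end Polar

/-! ### The variational inequality and its stability properties. -/

section PBound

variable {H : Type*} [NormedAddCommGroup H] [InnerProductSpace ℂ H]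
variable {H' : Type*} [NormedAddCommGroup H'] [InnerProductSpace ℂ H']

/-- The variational form of the inequality `‖A‖_p ≤ c`, by testing on pairs of finite Bessel
families. -/
def PBound (p : ℝ) (A : H →L[ℂ] H) (c : ℝ) : Prop :=
  ∀ (n : ℕ) (e f : Fin n → H), IsBessel e → IsBessel f →
    ∑ i, ‖inner ℂ (f i) (A (e i))‖ ^ p ≤ c ^ p

lemma PBound.sum_le {p : ℝ} {A : H →L[ℂ] H} {c : ℝ} (h : PBound p A c) {ι : Type*} [Fintype ι]
    {e f : ι → H} (he : IsBessel e) (hf : IsBessel f) :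
    ∑ i, ‖inner ℂ (f i) (A (e i))‖ ^ p ≤ c ^ p := by
  have := h _ _ _ (he.reindex (Fintype.equivFin ι).symm) (hf.reindex (Fintype.equivFin ι).symm)
  rwa [Equiv.sum_comp (Fintype.equivFin ι).symm fun i => ‖inner ℂ (f i) (A (e i))‖ ^ p] at this

lemma PBound.add {p : ℝ} (hp : 1 ≤ p) {A B : H →L[ℂ] H} {c d : ℝ} (hc : 0 ≤ c) (hd : 0 ≤ d)
    (hA : PBound p A c) (hB : PBound p B d) : PBound p (A + B) (c + d) := by
  intro n e f he hf
  have hp0 : 0 < p := by linarith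
  have h := Real.Lp_add_le_of_nonneg (s := Finset.univ)
    (f := fun i => ‖inner ℂ (f i) (A (e i))‖) (g := fun i => ‖inner ℂ (f i) (B (e i))‖) hp
    (fun _ _ => norm_nonneg _) (fun _ _ => norm_nonneg _)
  have h1 : (∑ i, ‖inner ℂ (f i) (A (e i))‖ ^ p) ^ (1 / p) ≤ c := by
    rw [one_div, Real.rpow_inv_le_iff_of_pos (by positivity) hc hp0]
    exact hA n e f he hf
  have h2 : (∑ i, ‖inner ℂ (f i) (B (e i))‖ ^ p) ^ (1 / p) ≤ d := by
    rw [one_div, Real.rpow_inv_le_iff_of_pos (by positivity) hd hp0]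
    exact hB n e f he hf
  have h3 := h.trans (add_le_add h1 h2)
  rw [one_div, Real.rpow_inv_le_iff_of_pos (by positivity) (by positivity) hp0] at h3
  refine le_trans (Finset.sum_le_sum fun i _ => ?_) h3
  refine Real.rpow_le_rpow (norm_nonneg _) ?_ hp0.le
  rw [add_apply, inner_add_right]
  exact norm_add_le _ _

/-- Once `V` and `W` are divided by their norms, `W` and the adjoint of `V` carry Bessel families to
Bessel families, so the tests for the product are tests for `A`. -/
lemma PBound.conj [CompleteSpace H] [CompleteSpace H'] {p : ℝ} {A : H →L[ℂ] H} {c : ℝ}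
    (hc : 0 ≤ c) (hA : PBound p A c) (V : H →L[ℂ] H') (W : H' →L[ℂ] H) :
    PBound p (V ∘L A ∘L W) (‖V‖ * c * ‖W‖) := by
  intro n e f he hf
  have key : ∀ (W : H' →L[ℂ] H), ‖((‖W‖ : ℂ)⁻¹) • W‖ ≤ 1 ∧
      ∀ x, W x = (‖W‖ : ℂ) • (((‖W‖ : ℂ)⁻¹) • W) x := by
    intro W
    rcases eq_or_ne W 0 with rfl | hW
    · simp
    · have hW' : (‖W‖ : ℂ) ≠ 0 := by exact_mod_cast norm_ne_zero_iff.mpr hW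
      constructor
      · rw [norm_smul]
        simp [norm_ne_zero_iff.mpr hW]
      · intro x
        rw [smul_apply, smul_smul, mul_inv_cancel₀ hW', one_smul]
  obtain ⟨hW1, hW2⟩ := key W
  obtain ⟨hV1, hV2⟩ := key (ContinuousLinearMap.adjoint V)
  rw [LinearIsometryEquiv.norm_map] at hV1 hV2
  have h := hA n _ _ (he.map hW1) (hf.map hV1)
  have hrw : ∀ i, ‖inner ℂ (f i) ((V ∘L A ∘L W) (e i))‖ ^ p = (‖V‖ * ‖W‖) ^ p *
      ‖inner ℂ ((((‖V‖ : ℂ)⁻¹) • ContinuousLinearMap.adjoint V) (f i))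
        (A ((((‖W‖ : ℂ)⁻¹) • W) (e i)))‖ ^ p := by
    intro i
    rw [← Real.mul_rpow (by positivity) (norm_nonneg _)]
    congr 1
    rw [ContinuousLinearMap.comp_apply, ContinuousLinearMap.comp_apply,
      ← ContinuousLinearMap.adjoint_inner_left, hW2 (e i), hV2 (f i), map_smul, inner_smul_left,
      inner_smul_right, norm_mul, norm_mul, RCLike.norm_conj, Complex.norm_of_nonneg (norm_nonneg _),
      Complex.norm_of_nonneg (norm_nonneg _), mul_assoc]
  simp_rw [hrw]
  rw [← Finset.mul_sum]
  calc _ ≤ (‖V‖ * ‖W‖) ^ p * c ^ p := by gcongr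
    _ = _ := by rw [← Real.mul_rpow (by positivity) hc]; congr 1; ring

/-- Each test is a finite sum of matrix coefficients, so weak convergence suffices: this is lower
semicontinuity of the Schatten norm. -/
lemma PBound.of_tendsto {p : ℝ} (hp : 0 ≤ p) {α : Type*} {l : Filter α} [l.NeBot]
    {B : α → H →L[ℂ] H} {A : H →L[ℂ] H} {c : ℝ} (hB : ∀ᶠ k in l, PBound p (B k) c)
    (h : ∀ x y, Tendsto (fun k => inner ℂ x (B k y)) l (𝓝 (inner ℂ x (A y)))) :
    PBound p A c := by
  intro n e f he hf
  refine le_of_tendsto (tendsto_finsetSum _ fun i _ => ?_) (hB.mono fun k hk => hk n e f he hf)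
  exact ((h (f i) (e i)).norm).rpow_const (Or.inr hp)

lemma isBessel_singleton {x : H} (hx : ‖x‖ ≤ 1) : IsBessel (fun _ : Fin 1 => x) := by
  intro y
  simp only [Finset.univ_unique, Finset.sum_const, Finset.card_singleton, one_smul]
  gcongr
  exact (norm_inner_le_norm _ _).trans (mul_le_of_le_one_left (norm_nonneg _) hx)

lemma PBound.norm_le {p : ℝ} (hp : 0 < p) {A : H →L[ℂ] H} {c : ℝ} (hc : 0 ≤ c)
    (hA : PBound p A c) : ‖A‖ ≤ c := by
  refine ContinuousLinearMap.opNorm_le_bound _ hc fun x => ?_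
  rcases eq_or_ne x 0 with rfl | hx
  · simp
  rcases eq_or_ne (A x) 0 with hAx | hAx
  · rw [hAx, norm_zero]; positivity
  have hunit : ∀ y : H, y ≠ 0 → ‖((‖y‖ : ℂ)⁻¹) • y‖ ≤ 1 := fun y hy => by
    rw [norm_smul]; simp [norm_ne_zero_iff.mpr hy]
  have h := hA 1 _ _ (isBessel_singleton (hunit x hx)) (isBessel_singleton (hunit _ hAx))
  simp only [Finset.univ_unique, Finset.sum_const, Finset.card_singleton, one_smul] at h
  rw [Real.rpow_le_rpow_iff (norm_nonneg _) hc hp, map_smul, inner_smul_left, inner_smul_right,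
    inner_self_eq_norm_sq_to_K] at h
  have h' : ‖A x‖⁻¹ * (‖x‖⁻¹ * ‖A x‖ ^ 2) ≤ c := by simpa using h
  have h1 : 0 < ‖x‖ := norm_pos_iff.mpr hx
  have h2 : 0 < ‖A x‖ := norm_pos_iff.mpr hAx
  have h3 : ‖A x‖⁻¹ * (‖x‖⁻¹ * ‖A x‖ ^ 2) = ‖A x‖ / ‖x‖ := by field_simp
  rwa [h3, div_le_iff₀ h1] at h'

/-- Cauchy–Schwarz and Bessel bound the `ℓ¹` norm of the coefficients, and the `ℓ^p` norm is no
larger. -/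
lemma pBound_rankOne {p : ℝ} (hp : 1 ≤ p) (ξ η : H) : PBound p (rankOne ℂ ξ η) (‖ξ‖ * ‖η‖) := by
  intro n e f he hf
  have hp0 : 0 < p := by linarith
  have hrw : ∀ i, inner ℂ (f i) (rankOne ℂ ξ η (e i)) = inner ℂ η (e i) * inner ℂ (f i) ξ := by
    intro i; rw [rankOne_apply, inner_smul_right]
  simp_rw [hrw, norm_mul]
  set M := ‖ξ‖ * ‖η‖ with hM
  have hM0 : 0 ≤ M := by positivity
  set t : Fin n → ℝ := fun i => ‖inner ℂ η (e i)‖ * ‖inner ℂ (f i) ξ‖ with ht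
  have ht0 : ∀ i, 0 ≤ t i := fun i => by positivity
  have hsum : ∑ i, t i ≤ M := by
    refine (Real.sum_mul_le_sqrt_mul_sqrt _ _ _).trans ?_
    rw [hM, mul_comm]
    simp_rw [norm_inner_symm η]
    gcongr
    · rw [Real.sqrt_le_left (norm_nonneg _)]; exact hf ξ
    · rw [Real.sqrt_le_left (norm_nonneg _)]; exact he η
  have hle : ∀ i, t i ≤ M := fun i =>
    (Finset.single_le_sum (fun j _ => ht0 j) (Finset.mem_univ i)).trans hsum
  have hsplit : ∀ s : ℝ, 0 ≤ s → s ^ p = s ^ (p - 1) * s := fun s hs => by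
    rcases hs.eq_or_lt with h0 | h0
    · rw [← h0, mul_zero, Real.zero_rpow (by linarith)]
    · rw [Real.rpow_sub h0, Real.rpow_one]; field_simp
  calc ∑ i, t i ^ p = ∑ i, t i ^ (p - 1) * t i := Finset.sum_congr rfl fun i _ => hsplit _ (ht0 i)
    _ ≤ ∑ i, M ^ (p - 1) * t i := by
      refine Finset.sum_le_sum fun i _ => mul_le_mul_of_nonneg_right ?_ (ht0 i)
      exact Real.rpow_le_rpow (ht0 i) (hle i) (by linarith)
    _ = M ^ (p - 1) * ∑ i, t i := by rw [Finset.mul_sum]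
    _ ≤ M ^ (p - 1) * M := by gcongr
    _ = M ^ p := (hsplit M hM0).symm

end PBound

/-! ### Equivalence of the variational inequality with the trace formula: tools. -/

section SchattenVariational

variable {H : Type*} [NormedAddCommGroup H] [InnerProductSpace ℂ H] [CompleteSpace H]

/-- Cauchy–Schwarz for the form `⟨·, a ·⟩`, written with the square root of `a`, followed by the
arithmetic–geometric mean inequality. It reduces off-diagonal tests of `U a` to diagonal tests of
`a`. -/
lemma norm_inner_mul_rpow_le {a : H →L[ℂ] H} (ha : 0 ≤ a) (U : H →L[ℂ] H) {p : ℝ} (hp : 0 < p)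
    (x y : H) :
    ‖inner ℂ x ((U * a) y)‖ ^ p ≤
      ((inner ℂ (star U x) (a (star U x))).re ^ p + (inner ℂ y (a y)).re ^ p) / 2 := by
  set s := CFC.sqrt a
  have hs : IsSelfAdjoint s := IsSelfAdjoint.of_nonneg (CFC.sqrt_nonneg a)
  have hss : ∀ z w : H, inner ℂ (s z) (s w) = inner ℂ z (a w) := fun z w => by
    rw [← ContinuousLinearMap.adjoint_inner_right, ← ContinuousLinearMap.star_eq_adjoint,
      hs.star_eq, ← mul_apply_eq_comp, CFC.sqrt_mul_sqrt_self a ha]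
  have hn : ∀ z, ‖s z‖ ^ 2 = (inner ℂ z (a z)).re := fun z => by
    rw [← hss]; exact norm_sq_eq_re_inner (𝕜 := ℂ) _
  rw [mul_apply_eq_comp, ← ContinuousLinearMap.adjoint_inner_left,
    ← ContinuousLinearMap.star_eq_adjoint, ← hss, ← hn, ← hn]
  have h1 : ‖inner ℂ (s (star U x)) (s y)‖ ^ p ≤ ‖s (star U x)‖ ^ p * ‖s y‖ ^ p := by
    rw [← Real.mul_rpow (norm_nonneg _) (norm_nonneg _)]
    exact Real.rpow_le_rpow (norm_nonneg _) (norm_inner_le_norm _ _) hp.le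
  have h2 : ∀ r : ℝ, 0 ≤ r → (r ^ 2) ^ p = (r ^ p) ^ 2 := fun r hr => by
    rw [← Real.rpow_natCast, ← Real.rpow_natCast, ← Real.rpow_mul hr, ← Real.rpow_mul hr, mul_comm]
  rw [h2 _ (norm_nonneg _), h2 _ (norm_nonneg _)]
  nlinarith [sq_nonneg (‖s (star U x)‖ ^ p - ‖s y‖ ^ p)]

omit [CompleteSpace H] in
lemma PBound.of_norm_sub_le {p : ℝ} (hp : 0 ≤ p) {A : H →L[ℂ] H} {c : ℝ}
    (h : ∀ ε : ℝ, 0 < ε → ∃ B, ‖A - B‖ ≤ ε ∧ PBound p B c) : PBound p A c := by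
  choose B hB1 hB2 using fun n : ℕ => h (1 / ((n : ℝ) + 1)) Nat.one_div_pos_of_nat
  have hlim : Tendsto B atTop (𝓝 A) := by
    rw [tendsto_iff_norm_sub_tendsto_zero]
    refine squeeze_zero (fun _ => norm_nonneg _) (fun n => ?_)
      tendsto_one_div_add_atTop_nhds_zero_nat
    rw [norm_sub_rev]
    exact hB1 n
  have hB2' : ∀ n, PBound p (B n) c := fun n => hB2 n
  refine PBound.of_tendsto hp (l := atTop) (Eventually.of_forall hB2') fun x y => ?_
  exact ((continuous_const.inner ((ContinuousLinearMap.apply ℂ H y).continuous)).tendsto A).comp hlim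

/-- Up to a small error `A = U |A|` with `U` a contraction. Coefficients of `U |A|` are dominated by
averages of diagonal coefficients of `|A|` along `e` and along `star U` applied to `f`, both Bessel,
and Jensen compares these with the trace. -/
lemma pBound_of_posTrace_le {p : ℝ} (hp : 1 ≤ p) {A : H →L[ℂ] H} {c : ℝ} (hc : 0 ≤ c)
    (h : posTrace (CFC.abs A ^ p) ≤ ENNReal.ofReal (c ^ p)) : PBound p A c := by
  refine PBound.of_norm_sub_le (by linarith) fun ε hε => ?_
  obtain ⟨U, hU, hAU, -⟩ := exists_approx_polar A hε
  refine ⟨U * CFC.abs A, hAU, fun n e f he hf => ?_⟩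
  have ha := CFC.abs_nonneg A
  have hp0 : 0 < p := by linarith
  have key : ∀ g : Fin n → H, IsBessel g →
      ∑ i, (inner ℂ (g i) (CFC.abs A (g i))).re ^ p ≤ c ^ p := fun g hg => by
    have := (hg.sum_re_inner_rpow_le ha hp).trans h
    rwa [← ENNReal.ofReal_sum_of_nonneg fun i _ =>
      Real.rpow_nonneg (re_inner_nonneg_of_nonneg ha (g i)) p,
      ENNReal.ofReal_le_ofReal_iff (Real.rpow_nonneg hc p)] at this
  have h1 := key _ he
  have h2 := key _ (hf.map (V := star U) (by rwa [norm_star]))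
  calc _ ≤ _ := Finset.sum_le_sum fun i _ => norm_inner_mul_rpow_le ha U hp0 (f i) (e i)
    _ ≤ c ^ p := by
      rw [← Finset.sum_div, Finset.sum_add_distrib]
      linarith

lemma PBound.abs {p : ℝ} (hp : 0 ≤ p) {A : H →L[ℂ] H} {c : ℝ} (h : PBound p A c) :
    PBound p (CFC.abs A) c := by
  refine PBound.of_norm_sub_le hp fun ε hε => ?_
  obtain ⟨U, hU, -, hAU⟩ := exists_approx_polar A hε
  refine ⟨star U * A, hAU, fun n e f he hf => ?_⟩
  have := h n e _ he (hf.map (V := U) hU)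
  simp_rw [← ContinuousLinearMap.adjoint_inner_right, ← ContinuousLinearMap.star_eq_adjoint] at this
  exact this

/-- The cutoff `t ↦ (1 - ε / t)₊`. -/
def cutoff (ε t : ℝ) : ℝ := 1 - ε / max t ε

variable {ε : ℝ}

lemma continuous_cutoff (hε : 0 < ε) : Continuous (cutoff ε) := by
  unfold cutoff
  have : ∀ t, max t ε ≠ 0 := fun t => (lt_max_of_lt_right hε).ne'
  fun_prop (disch := assumption)

lemma cutoff_nonneg (hε : 0 < ε) (t : ℝ) : 0 ≤ cutoff ε t := by
  have h : 0 < max t ε := lt_max_of_lt_right hε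
  rw [cutoff, sub_nonneg, div_le_one h]
  exact le_max_right _ _

lemma cutoff_le_one (hε : 0 < ε) (t : ℝ) : cutoff ε t ≤ 1 := by
  have h : 0 < max t ε := lt_max_of_lt_right hε
  rw [cutoff, sub_le_self_iff]
  positivity

lemma sub_mul_cutoff (hε : 0 < ε) (t : ℝ) : t - t * cutoff ε t = min t ε := by
  rw [cutoff]
  rcases le_total t ε with h | h
  · rw [max_eq_right h, min_eq_left h, div_self hε.ne']; ring
  · have : 0 < t := hε.trans_le h
    rw [max_eq_left h, min_eq_right h]; field_simp; ring

lemma mul_cutoff_sq_le (hε : 0 < ε) (t : ℝ) : ε * cutoff ε t ^ 2 ≤ t * cutoff ε t ^ 2 := by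
  rcases le_total t ε with h | h
  · rw [cutoff, max_eq_right h, div_self hε.ne']; simp
  · gcongr

/-- The cutoff vanishes for `t ≤ ε`, so `a` is at least `ε` on the range of `cutoff ε` applied to
`a`. -/
lemma norm_sq_le_re_inner_cutoff {a : H →L[ℂ] H} (ha : 0 ≤ a) (hε : 0 < ε) (y : H) :
    ε * ‖cfc (cutoff ε) a y‖ ^ 2 ≤ (inner ℂ (cfc (cutoff ε) a y) (a (cfc (cutoff ε) a y))).re := by
  have hk := continuous_cutoff hε
  have h1 : a (cfc (cutoff ε) a y) = cfc (fun t => t * cutoff ε t) a y := by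
    rw [cfc_mul (fun t => t) (cutoff ε) a (by fun_prop) (by fun_prop),
      cfc_id' ℝ a (IsSelfAdjoint.of_nonneg ha)]; rfl
  rw [h1, inner_cfc_cfc y y hk (by fun_prop), norm_cfc_apply_sq y hk]
  have h2 := re_inner_cfc_const_add_mul ha 0 ε (f := fun t => cutoff ε t ^ 2) (by fun_prop) y
  rw [zero_mul, zero_add] at h2
  rw [← h2]
  refine re_inner_cfc_mono (fun t _ => ?_) y (by fun_prop) (by fun_prop)
  calc _ = ε * cutoff ε t ^ 2 := by ring
    _ ≤ _ := mul_cutoff_sq_le hε t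
    _ = _ := by ring

omit [CompleteSpace H] in
lemma finiteDimensional_of_orthonormal_bounded (W : Submodule ℂ H) (N : ℕ)
    (h : ∀ n (e : Fin n → W), Orthonormal ℂ e → n ≤ N) : FiniteDimensional ℂ W := by
  by_contra hfin
  let B := Module.Basis.ofVectorSpace ℂ W
  have hinf : Infinite (Module.Basis.ofVectorSpaceIndex ℂ W) := by
    rw [← not_finite_iff_infinite]
    intro hf
    exact hfin (Module.Finite.of_basis B)
  have hon := gramSchmidtNormed_orthonormal (𝕜 := ℂ)
    (B.linearIndependent.comp _ (Infinite.natEmbedding _).injective)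
  have := h (N + 1) _ (hon.comp (fun i : Fin (N + 1) => (i : ℕ)) Fin.val_injective)
  omega

/-- On this range the form of `a` is at least `ε`, so testing on `n` orthonormal vectors gives `n *
ε ^ p ≤ c ^ p`, which bounds the dimension. -/
lemma PBound.finiteDimensional_range_cutoff {p : ℝ} (hp : 0 < p) {a : H →L[ℂ] H} (ha : 0 ≤ a)
    {c : ℝ} (h : PBound p a c) (hε : 0 < ε) :
    FiniteDimensional ℂ (cfc (cutoff ε) a).range := by
  have hεp : 0 < ε ^ p := Real.rpow_pos_of_pos hε p
  obtain ⟨N, hN⟩ := exists_nat_ge (c ^ p / ε ^ p)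
  refine finiteDimensional_of_orthonormal_bounded _ N fun n e he => ?_
  have he' : Orthonormal ℂ fun i => (e i : H) := he.comp_linearIsometry (Submodule.subtypeₗᵢ _)
  have h1 := h n _ _ he'.isBessel he'.isBessel
  have h2 : ∀ i, ε ^ p ≤ ‖inner ℂ (e i : H) (a (e i))‖ ^ p := fun i => by
    refine Real.rpow_le_rpow hε.le ?_ hp.le
    obtain ⟨y, hy⟩ := (e i).2
    have := norm_sq_le_re_inner_cutoff ha hε y
    rw [show cfc (cutoff ε) a y = (e i : H) from hy, he'.1 i] at this
    calc ε = ε * 1 ^ 2 := by ring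
      _ ≤ _ := this
      _ ≤ _ := Complex.re_le_norm _
  have h3 : (n : ℝ) * ε ^ p ≤ c ^ p := by
    refine le_trans ?_ h1
    calc (n : ℝ) * ε ^ p = ∑ _i : Fin n, ε ^ p := by simp
      _ ≤ _ := Finset.sum_le_sum fun i _ => h2 i
  have h4 : (n : ℝ) ≤ N := ((le_div_iff₀ hεp).mpr h3).trans hN
  exact_mod_cast h4

lemma mem_spectrum_le_norm {a : H →L[ℂ] H} {t : ℝ} (ht : t ∈ spectrum ℝ a) : t ≤ ‖a‖ := by
  have : Nontrivial (H →L[ℂ] H) := by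
    by_contra hn
    rw [not_nontrivial_iff_subsingleton] at hn
    simp [spectrum.of_subsingleton] at ht
  exact (le_abs_self t).trans (spectrum.norm_le_norm_of_mem ht)

/-- On the spectrum `t ^ p` is at most `l ^ p`, plus a small constant, plus a large multiple of `(t
- l) ^ 2`; the last term vanishes at the eigenvector because `(a - l) x = 0`. -/
lemma re_inner_cfc_rpow_eigenvector_le {a : H →L[ℂ] H} (ha : 0 ≤ a) {p : ℝ} (hp : 1 ≤ p) {x : H}
    (hx : ‖x‖ = 1) {l : ℝ} (hl : 0 ≤ l) (hax : a x = (l : ℂ) • x) :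
    (inner ℂ x (cfc (fun t : ℝ => t ^ p) a x)).re ≤ l ^ p := by
  have hpc : Continuous fun t : ℝ => t ^ p := Real.continuous_rpow_const (by linarith)
  set M := p * ‖a‖ ^ (p - 1) with hM
  have hM0 : 0 ≤ M := by positivity
  refine le_of_forall_pos_le_add fun η hη => ?_
  set δ := η / (M + 1) with hδ
  have hδ0 : 0 < δ := by positivity
  have hMδ : M * δ ≤ η := by
    rw [hδ, mul_div_assoc', div_le_iff₀ (by positivity)]; nlinarith
  have h1 := re_inner_cfc_mono (a := a) (x := x) (f := fun t => t ^ p)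
    (g := fun t => (l ^ p + M * δ) + (M / δ) * (t - l) ^ 2) (fun t ht => ?_) hpc (by fun_prop)
  · rw [re_inner_cfc_const_add_mul ha _ _ (by fun_prop),
      ← norm_cfc_apply_sq x (f := fun t => t - l) (by fun_prop)] at h1
    have h2 : cfc (fun t => t - l) a x = 0 := by
      have hsa := IsSelfAdjoint.of_nonneg ha
      rw [cfc_sub (fun t => t) (fun _ => l) a, cfc_id' ℝ a hsa, cfc_const l a hsa, sub_apply, hax,
        Algebra.algebraMap_eq_smul_one, smul_apply, one_apply_eq_self]
      simp
    rw [h2, hx] at h1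
    simp only [norm_zero] at h1
    linarith
  · have ht0 : 0 ≤ t := spectrum_nonneg_of_nonneg ha ht
    have h3 := tangent_le_rpow hp ht0 hl
    have h4 : p * t ^ (p - 1) ≤ M := by
      rw [hM]
      have := Real.rpow_le_rpow ht0 (mem_spectrum_le_norm ht) (by linarith : (0 : ℝ) ≤ p - 1)
      gcongr
    have h5 : 0 ≤ p * t ^ (p - 1) := by positivity
    have h6 : p * t ^ (p - 1) * (t - l) ≤ M * |t - l| :=
      calc _ ≤ p * t ^ (p - 1) * |t - l| := by gcongr; exact le_abs_self _
        _ ≤ _ := by gcongr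
    have h7 : |t - l| ≤ δ + (t - l) ^ 2 / δ := by
      rw [← sq_abs, ← sub_nonneg]
      have : δ + |t - l| ^ 2 / δ - |t - l| = ((δ - |t - l|) ^ 2 + δ * |t - l|) / δ := by
        field_simp; ring
      rw [this]
      positivity
    have h8 : M * |t - l| ≤ M * δ + M / δ * (t - l) ^ 2 := by
      calc _ ≤ M * (δ + (t - l) ^ 2 / δ) := by gcongr
        _ = _ := by ring
    linarith

end SchattenVariational

/-! ### From the variational inequality to the trace. -/

section SchattenVariational

variable {H : Type*} [NormedAddCommGroup H] [InnerProductSpace ℂ H] [CompleteSpace H] {ε : ℝ}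

/-- The range `W` of the cutoff is finite dimensional and invariant under `a`, so `a` is
diagonalised there by eigenvectors `u i`. Testing on these gives `∑ (l i) ^ p ≤ c ^ p`, and the
Hilbert–Schmidt sum, whose operator has range in `W`, can be computed along the `u i`. -/
lemma PBound.tsum_cutoff_le {p : ℝ} (hp : 1 ≤ p) {a : H →L[ℂ] H} (ha : 0 ≤ a) {c : ℝ}
    (h : PBound p a c) (hε : 0 < ε) {κ : Type*} (f : HilbertBasis κ ℂ H) :
    ∑' j, ENNReal.ofReal (‖cfc (fun t : ℝ => t ^ (p / 2) * cutoff ε t) a (f j)‖ ^ 2) ≤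
      ENNReal.ofReal (c ^ p) := by
  have hp0 : 0 < p := by linarith
  have hk := continuous_cutoff hε
  have hsa := IsSelfAdjoint.of_nonneg ha
  have hph := continuous_rpow_half hp
  set W := (cfc (cutoff ε) a).range with hW
  have : FiniteDimensional ℂ W := h.finiteDimensional_range_cutoff hp0 ha hε
  have hcomm : ∀ g : ℝ → ℝ, Continuous g → ∀ x, cfc (fun t => g t * cutoff ε t) a x ∈ W := by
    intro g hg x
    simp_rw [mul_comm (g _)]
    rw [cfc_mul (cutoff ε) g a hk.continuousOn hg.continuousOn]
    exact ⟨_, rfl⟩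
  have hinv : ∀ x ∈ W, a x ∈ W := by
    rintro _ ⟨y, rfl⟩
    have := hcomm (fun t => t) continuous_id' y
    rwa [cfc_mul (fun t => t) (cutoff ε) a (by fun_prop) hk.continuousOn, cfc_id' ℝ a] at this
  have hsymm : (a : H →ₗ[ℂ] H).IsSymmetric :=
    ContinuousLinearMap.isSelfAdjoint_iff_isSymmetric.mp hsa
  have hT : ((a : H →ₗ[ℂ] H).restrict hinv).IsSymmetric := hsymm.restrict_invariant hinv
  set u := hT.eigenvectorBasis rfl
  set l := hT.eigenvalues rfl
  have hu : Orthonormal ℂ fun i => (u i : H) :=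
    u.orthonormal.comp_linearIsometry (Submodule.subtypeₗᵢ _)
  have hau : ∀ i, a (u i) = (l i : ℂ) • (u i : H) := fun i =>
    congrArg Subtype.val (hT.apply_eigenvectorBasis rfl i)
  have hinner : ∀ i, inner ℂ (u i : H) (a (u i)) = (l i : ℂ) := fun i => by
    rw [hau, inner_smul_right, inner_self_eq_norm_sq_to_K, hu.1 i]; simp
  have hl : ∀ i, 0 ≤ l i := fun i => by
    have := re_inner_nonneg_of_nonneg ha (u i : H)
    rwa [hinner, Complex.ofReal_re] at this
  set b := cfc (fun t : ℝ => t ^ (p / 2) * cutoff ε t) a with hb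
  have hbsa : IsSelfAdjoint b := IsSelfAdjoint.cfc
  have hbu : ∀ i, ‖b (u i)‖ ^ 2 ≤ l i ^ p := fun i => by
    refine le_trans ?_ (re_inner_cfc_rpow_eigenvector_le ha hp (hu.1 i) (hl i) (hau i))
    rw [hb, norm_cfc_apply_sq _ (by fun_prop)]
    refine re_inner_cfc_mono (fun t ht => ?_) _ (by fun_prop)
      (Real.continuous_rpow_const hp0.le)
    have ht0 := spectrum_nonneg_of_nonneg ha ht
    rw [mul_pow, rpow_half_sq ht0]
    exact mul_le_of_le_one_right (Real.rpow_nonneg ht0 p)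
      (pow_le_one₀ (cutoff_nonneg hε t) (cutoff_le_one hε t))
  have hexp : ∀ x, ENNReal.ofReal (‖b x‖ ^ 2) =
      ∑ i, ENNReal.ofReal (‖inner ℂ x (b (u i))‖ ^ 2) := fun x => by
    rw [← ENNReal.ofReal_sum_of_nonneg fun _ _ => sq_nonneg _]
    congr 1
    have := u.sum_sq_norm_inner_right ⟨b x, hcomm _ hph x⟩
    rw [Submodule.coe_norm] at this
    rw [← this]
    refine Finset.sum_congr rfl fun i _ => ?_
    rw [Submodule.coe_inner, ← ContinuousLinearMap.adjoint_inner_left,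
      ContinuousLinearMap.isSelfAdjoint_iff'.mp hbsa, norm_inner_symm]
  simp_rw [hexp]
  rw [Summable.tsum_finsetSum fun _ _ => ENNReal.summable]
  simp_rw [← ofReal_norm_sq_eq_tsum f]
  rw [← ENNReal.ofReal_sum_of_nonneg fun _ _ => sq_nonneg _]
  refine ENNReal.ofReal_le_ofReal ((Finset.sum_le_sum fun i _ => hbu i).trans ?_)
  refine le_trans (le_of_eq ?_) (h.sum_le hu.isBessel hu.isBessel)
  refine Finset.sum_congr rfl fun i _ => ?_
  rw [hinner, Complex.norm_of_nonneg (hl i)]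

lemma PBound.posTrace_rpow_le {p : ℝ} (hp : 1 ≤ p) {a : H →L[ℂ] H} (ha : 0 ≤ a) {c : ℝ}
    (hc : 0 ≤ c) (h : PBound p a c) : posTrace (a ^ p) ≤ ENNReal.ofReal (c ^ p) := by
  have hp0 : 0 < p := by linarith
  have hpc : Continuous fun t : ℝ => t ^ p := Real.continuous_rpow_const hp0.le
  have hph := continuous_rpow_half hp
  rw [posTrace_rpow ha hp, ENNReal.tsum_eq_iSup_sum]
  refine iSup_le fun s => ?_
  rw [← ENNReal.ofReal_sum_of_nonneg fun _ _ => sq_nonneg _]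
  refine ENNReal.ofReal_le_ofReal ?_
  -- With `k = cutoff ε`, one has `t ^ p * (1 - k ^ 2) = t ^ (p - 1) * (t - t * k) * (1 + k)`, where
  -- the factors are at most `‖a‖ ^ (p - 1)`, `ε` and `2`. So removing the cutoff costs at most `M *
  -- ε` per basis vector, which is harmless for the finite set `s`.
  set M := 2 * ‖a‖ ^ (p - 1) with hM
  have hM0 : 0 ≤ M := by positivity
  have key : ∀ ε : ℝ, 0 < ε →
      ∑ j ∈ s, ‖cfc (fun t : ℝ => t ^ (p / 2)) a (stdBasis H j)‖ ^ 2 ≤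
        c ^ p + s.card * (M * ε) := by
    intro ε hε
    have hk := continuous_cutoff hε
    have h1 := (ENNReal.sum_le_tsum s).trans (h.tsum_cutoff_le hp ha hε (stdBasis H))
    rw [← ENNReal.ofReal_sum_of_nonneg fun _ _ => sq_nonneg _,
      ENNReal.ofReal_le_ofReal_iff (by positivity)] at h1
    have h2 : ∀ j, ‖cfc (fun t : ℝ => t ^ (p / 2)) a (stdBasis H j)‖ ^ 2 ≤ M * ε +
        ‖cfc (fun t : ℝ => t ^ (p / 2) * cutoff ε t) a (stdBasis H j)‖ ^ 2 := by
      intro j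
      rw [norm_cfc_rpow_half_sq ha hp, norm_cfc_apply_sq _ (by fun_prop)]
      have h3 := re_inner_cfc_const_add_mul ha (M * ε) 1
        (f := fun t => (t ^ (p / 2) * cutoff ε t) ^ 2) (by fun_prop) (stdBasis H j)
      rw [(stdBasis H).orthonormal.1 j, one_pow, mul_one, one_mul] at h3
      rw [← h3]
      refine re_inner_cfc_mono (fun t ht => ?_) _ hpc (by fun_prop)
      have ht0 := spectrum_nonneg_of_nonneg ha ht
      have hmin := sub_mul_cutoff hε t
      have hmin' := min_le_right t ε
      have hk0 := cutoff_nonneg hε t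
      have hk1 := cutoff_le_one hε t
      have hpow := Real.rpow_le_rpow ht0 (mem_spectrum_le_norm ht) (by linarith : 0 ≤ p - 1)
      have hsplit : t ^ p = t ^ (p - 1) * t := by
        rcases ht0.eq_or_lt with h0 | h0
        · rw [← h0, mul_zero, Real.zero_rpow (by linarith)]
        · rw [Real.rpow_sub h0, Real.rpow_one]; field_simp
      have hq0 : 0 ≤ t ^ (p - 1) := Real.rpow_nonneg ht0 _
      rw [mul_pow, rpow_half_sq ht0, one_mul, hsplit, hM]
      have e1 : t ^ (p - 1) * t - t ^ (p - 1) * t * cutoff ε t ^ 2 =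
          t ^ (p - 1) * ((t - t * cutoff ε t) * (1 + cutoff ε t)) := by ring
      have e2 : (t - t * cutoff ε t) * (1 + cutoff ε t) ≤ ε * 2 := by
        refine mul_le_mul (by linarith) (by linarith) (by linarith) hε.le
      have e3 : t ^ (p - 1) * ((t - t * cutoff ε t) * (1 + cutoff ε t)) ≤
          ‖a‖ ^ (p - 1) * (ε * 2) := by
        refine mul_le_mul hpow e2 (mul_nonneg ?_ (by linarith)) (by positivity)
        rw [hmin]; exact le_min ht0 hε.le
      linarith
    calc _ ≤ ∑ j ∈ s, (M * ε +
        ‖cfc (fun t : ℝ => t ^ (p / 2) * cutoff ε t) a (stdBasis H j)‖ ^ 2) :=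
          Finset.sum_le_sum fun j _ => h2 j
      _ ≤ _ := by
        rw [Finset.sum_add_distrib, Finset.sum_const, nsmul_eq_mul]
        linarith
  refine le_of_forall_pos_le_add fun η hη => ?_
  set K := s.card * M with hK
  have hK0 : 0 ≤ K := by positivity
  refine (key (η / (K + 1)) (by positivity)).trans ?_
  have : s.card * (M * (η / (K + 1))) = K * η / (K + 1) := by rw [hK]; ring
  rw [this]
  have : K * η / (K + 1) ≤ η := by
    rw [div_le_iff₀ (by positivity)]; nlinarith
  linarith

/-- The Schatten norm in terms of Bessel families. -/
lemma schattenNorm_le_ofReal_iff {p : ℝ≥0∞} (hp : 1 ≤ p) (hp' : p ≠ ∞) {A : H →L[ℂ] H} {c : ℝ}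
    (hc : 0 ≤ c) : schattenNorm p A ≤ ENNReal.ofReal c ↔ PBound p.toReal A c := by
  have h1 : 1 ≤ p.toReal := by
    rw [← ENNReal.toReal_one]; exact ENNReal.toReal_mono hp' hp
  have h0 : 0 < p.toReal := by linarith
  rw [schattenNorm, if_neg hp', one_div, ENNReal.rpow_inv_le_iff h0,
    ENNReal.ofReal_rpow_of_nonneg hc h0.le]
  exact ⟨pBound_of_posTrace_le h1 hc,
    fun h => (h.abs h0.le).posTrace_rpow_le h1 (CFC.abs_nonneg A) hc⟩

end SchattenVariational

/-! ### Schatten classes as normed ideals, including `p = ∞`. -/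

section SchattenClass

variable {H : Type*} [NormedAddCommGroup H] [InnerProductSpace ℂ H]
variable {H' : Type*} [NormedAddCommGroup H'] [InnerProductSpace ℂ H']
variable {p : ℝ≥0∞}

/-- The inequality `‖A‖_p ≤ c`, in variational form. -/
def SchattenBound (p : ℝ≥0∞) (A : H →L[ℂ] H) (c : ℝ) : Prop :=
  if p = ∞ then ‖A‖ ≤ c else PBound p.toReal A c

lemma one_le_toReal (hp : 1 ≤ p) (hp' : p ≠ ∞) : 1 ≤ p.toReal := by
  rw [← ENNReal.toReal_one]; exact ENNReal.toReal_mono hp' hp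

lemma SchattenBound.add (hp : 1 ≤ p) {A B : H →L[ℂ] H} {c d : ℝ} (hc : 0 ≤ c) (hd : 0 ≤ d)
    (hA : SchattenBound p A c) (hB : SchattenBound p B d) : SchattenBound p (A + B) (c + d) := by
  unfold SchattenBound at *
  split_ifs with h
  · rw [if_pos h] at hA hB
    exact (norm_add_le _ _).trans (add_le_add hA hB)
  · rw [if_neg h] at hA hB
    exact hA.add (one_le_toReal hp h) hc hd hB

lemma SchattenBound.conj [CompleteSpace H] [CompleteSpace H'] {A : H →L[ℂ] H} {c : ℝ}
    (hc : 0 ≤ c) (hA : SchattenBound p A c) (V : H →L[ℂ] H') (W : H' →L[ℂ] H) :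
    SchattenBound p (V ∘L A ∘L W) (‖V‖ * c * ‖W‖) := by
  unfold SchattenBound at *
  split_ifs with h
  · rw [if_pos h] at hA
    refine (ContinuousLinearMap.opNorm_comp_le _ _).trans ?_
    rw [mul_assoc]
    gcongr
    refine (ContinuousLinearMap.opNorm_comp_le _ _).trans ?_
    gcongr
  · rw [if_neg h] at hA
    exact hA.conj hc V W

lemma SchattenBound.norm_le (hp : 1 ≤ p) {A : H →L[ℂ] H} {c : ℝ} (hc : 0 ≤ c)
    (hA : SchattenBound p A c) : ‖A‖ ≤ c := by
  unfold SchattenBound at hA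
  split_ifs at hA with h
  · exact hA
  · exact hA.norm_le (by linarith [one_le_toReal hp h]) hc

lemma SchattenBound.of_tendsto {α : Type*} {l : Filter α} [l.NeBot]
    {B : α → H →L[ℂ] H} {A : H →L[ℂ] H} {c : ℝ} (hB : ∀ᶠ k in l, SchattenBound p (B k) c)
    (h : Tendsto B l (𝓝 A)) : SchattenBound p A c := by
  unfold SchattenBound at *
  split_ifs with hp
  · simp only [if_pos hp] at hB
    exact le_of_tendsto h.norm hB
  · simp only [if_neg hp] at hB
    exact PBound.of_tendsto ENNReal.toReal_nonneg hB fun x y =>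
      ((continuous_const.inner ((ContinuousLinearMap.apply ℂ H y).continuous)).tendsto A).comp h

lemma schattenBound_rankOne (hp : 1 ≤ p) (ξ η : H) :
    SchattenBound p (rankOne ℂ ξ η) (‖ξ‖ * ‖η‖) := by
  unfold SchattenBound
  split_ifs with h
  · exact (norm_rankOne ξ η).le
  · exact pBound_rankOne (one_le_toReal hp h) ξ η

variable [CompleteSpace H] [CompleteSpace H']

lemma schattenNorm_le_iff (hp : 1 ≤ p) {A : H →L[ℂ] H} {c : ℝ} (hc : 0 ≤ c) :
    schattenNorm p A ≤ ENNReal.ofReal c ↔ SchattenBound p A c := by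
  unfold SchattenBound
  split_ifs with h
  · rw [schattenNorm, if_pos h, ← ofReal_norm, ENNReal.ofReal_le_ofReal_iff hc]
  · exact schattenNorm_le_ofReal_iff hp h hc

lemma memSchatten_iff (hp : 1 ≤ p) (hp' : p ≠ ∞) {A : H →L[ℂ] H} :
    MemSchatten p A ↔ schattenNorm p A < ∞ := by
  have h0 : 0 < p.toReal := by linarith [one_le_toReal hp hp']
  rw [MemSchatten, schattenNorm, if_neg hp', if_neg hp', one_div,
    ENNReal.rpow_lt_top_iff_of_pos (by positivity)]

lemma SchattenBound.memSchatten (hp : 1 ≤ p) (hp' : p ≠ ∞) {A : H →L[ℂ] H} {c : ℝ} (hc : 0 ≤ c)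
    (h : SchattenBound p A c) : MemSchatten p A :=
  (memSchatten_iff hp hp').mpr (((schattenNorm_le_iff hp hc).mpr h).trans_lt ENNReal.ofReal_lt_top)

/-- The Schatten norm as a real number. -/
def schattenReal (p : ℝ≥0∞) (A : H →L[ℂ] H) : ℝ := (schattenNorm p A).toReal

lemma schattenReal_nonneg (A : H →L[ℂ] H) : 0 ≤ schattenReal p A := ENNReal.toReal_nonneg

lemma MemSchatten.schattenNorm_ne_top (hp : 1 ≤ p) {A : H →L[ℂ] H} (hA : MemSchatten p A) :
    schattenNorm p A ≠ ∞ := by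
  by_cases h : p = ∞
  · rw [schattenNorm, if_pos h]; exact enorm_ne_top
  · exact ((memSchatten_iff hp h).mp hA).ne

lemma MemSchatten.ofReal_schattenReal (hp : 1 ≤ p) {A : H →L[ℂ] H} (hA : MemSchatten p A) :
    ENNReal.ofReal (schattenReal p A) = schattenNorm p A :=
  ENNReal.ofReal_toReal (hA.schattenNorm_ne_top hp)

lemma SchattenBound.schattenReal_le (hp : 1 ≤ p) {A : H →L[ℂ] H} {c : ℝ} (hc : 0 ≤ c)
    (h : SchattenBound p A c) : schattenReal p A ≤ c :=
  ENNReal.toReal_le_of_le_ofReal hc ((schattenNorm_le_iff hp hc).mpr h)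

lemma MemSchatten.schattenBound (hp : 1 ≤ p) {A : H →L[ℂ] H} (hA : MemSchatten p A) :
    SchattenBound p A (schattenReal p A) :=
  (schattenNorm_le_iff hp (schattenReal_nonneg A)).mp (hA.ofReal_schattenReal hp).ge

lemma MemSchatten.norm_le (hp : 1 ≤ p) {A : H →L[ℂ] H} (hA : MemSchatten p A) :
    ‖A‖ ≤ schattenReal p A :=
  (hA.schattenBound hp).norm_le hp (schattenReal_nonneg A)

lemma MemSchatten.add (hp : 1 ≤ p) {A B : H →L[ℂ] H} (hA : MemSchatten p A)
    (hB : MemSchatten p B) : MemSchatten p (A + B) := by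
  by_cases h : p = ∞
  · rw [MemSchatten, if_pos h] at *
    exact IsCompactOperator.add hA hB
  · exact ((hA.schattenBound hp).add hp (schattenReal_nonneg A) (schattenReal_nonneg B)
      (hB.schattenBound hp)).memSchatten hp h
      (add_nonneg (schattenReal_nonneg A) (schattenReal_nonneg B))

lemma schattenReal_add_le (hp : 1 ≤ p) {A B : H →L[ℂ] H} (hA : MemSchatten p A)
    (hB : MemSchatten p B) : schattenReal p (A + B) ≤ schattenReal p A + schattenReal p B :=
  ((hA.schattenBound hp).add hp (schattenReal_nonneg A) (schattenReal_nonneg B)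
    (hB.schattenBound hp)).schattenReal_le hp
    (add_nonneg (schattenReal_nonneg A) (schattenReal_nonneg B))

lemma MemSchatten.conj (hp : 1 ≤ p) {A : H →L[ℂ] H} (hA : MemSchatten p A) (V : H →L[ℂ] H')
    (W : H' →L[ℂ] H) : MemSchatten p (V ∘L A ∘L W) := by
  by_cases h : p = ∞
  · rw [MemSchatten, if_pos h] at *
    exact (hA.comp_clm W).clm_comp V
  · have := schattenReal_nonneg (p := p) A
    exact ((hA.schattenBound hp).conj (schattenReal_nonneg A) V W).memSchatten hp h (by positivity)

lemma schattenReal_conj_le (hp : 1 ≤ p) {A : H →L[ℂ] H} (hA : MemSchatten p A) (V : H →L[ℂ] H')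
    (W : H' →L[ℂ] H) :
    schattenReal p (V ∘L A ∘L W) ≤ ‖V‖ * schattenReal p A * ‖W‖ := by
  have := schattenReal_nonneg (p := p) A
  exact ((hA.schattenBound hp).conj this V W).schattenReal_le hp (by positivity)

lemma schattenReal_conj_le_of_le (hp : 1 ≤ p) {A : H →L[ℂ] H} (hA : MemSchatten p A)
    {V : H →L[ℂ] H'} {W : H' →L[ℂ] H} {v w : ℝ} (hV : ‖V‖ ≤ v) (hW : ‖W‖ ≤ w) :
    schattenReal p (V ∘L A ∘L W) ≤ v * schattenReal p A * w := by
  have := schattenReal_nonneg (p := p) A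
  have := (norm_nonneg V).trans hV
  refine (schattenReal_conj_le hp hA V W).trans ?_
  gcongr

omit [CompleteSpace H] in
lemma smul_eq_conj (c : ℂ) (A : H →L[ℂ] H) :
    c • A = (c • ContinuousLinearMap.id ℂ H) ∘L A ∘L ContinuousLinearMap.id ℂ H := by
  ext; simp

omit [CompleteSpace H] in
lemma norm_id_le_one : ‖ContinuousLinearMap.id ℂ H‖ ≤ 1 := ContinuousLinearMap.norm_id_le

lemma norm_smul_id_le (c : ℂ) : ‖c • ContinuousLinearMap.id ℂ H‖ ≤ ‖c‖ := by
  rw [norm_smul]; exact mul_le_of_le_one_right (norm_nonneg c) norm_id_le_one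

lemma MemSchatten.smul (hp : 1 ≤ p) (c : ℂ) {A : H →L[ℂ] H} (hA : MemSchatten p A) :
    MemSchatten p (c • A) := by
  rw [smul_eq_conj]; exact hA.conj hp _ _

lemma schattenReal_smul_le (hp : 1 ≤ p) (c : ℂ) {A : H →L[ℂ] H} (hA : MemSchatten p A) :
    schattenReal p (c • A) ≤ ‖c‖ * schattenReal p A := by
  rw [smul_eq_conj]
  simpa using schattenReal_conj_le_of_le hp hA (norm_smul_id_le c) norm_id_le_one

lemma memSchatten_rankOne (hp : 1 ≤ p) (ξ η : H) : MemSchatten p (rankOne ℂ ξ η) := by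
  by_cases h : p = ∞
  · rw [MemSchatten, if_pos h, rankOne_def']
    exact ((isCompactOperator_id (E := ℂ)).comp_clm (innerSL ℂ η)).clm_comp
      (ContinuousLinearMap.toSpanSingleton ℂ ξ)
  · exact (schattenBound_rankOne hp ξ η).memSchatten hp h (by positivity)

lemma schattenReal_rankOne_le (hp : 1 ≤ p) (ξ η : H) :
    schattenReal p (rankOne ℂ ξ η) ≤ ‖ξ‖ * ‖η‖ :=
  (schattenBound_rankOne hp ξ η).schattenReal_le hp (by positivity)

lemma memSchatten_zero (hp : 1 ≤ p) : MemSchatten p (0 : H →L[ℂ] H) := by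
  simpa using memSchatten_rankOne hp (0 : H) 0

lemma MemSchatten.sub (hp : 1 ≤ p) {A B : H →L[ℂ] H} (hA : MemSchatten p A)
    (hB : MemSchatten p B) : MemSchatten p (A - B) := by
  have := hA.add hp (hB.smul hp (-1))
  rwa [neg_one_smul, ← sub_eq_add_neg] at this

lemma schattenReal_sub_le (hp : 1 ≤ p) {A B : H →L[ℂ] H} (hA : MemSchatten p A)
    (hB : MemSchatten p B) : schattenReal p (A - B) ≤ schattenReal p A + schattenReal p B := by
  have h1 := schattenReal_add_le hp hA (hB.smul hp (-1))
  have h2 := schattenReal_smul_le hp (-1) hB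
  rw [neg_one_smul, ← sub_eq_add_neg] at h1
  rw [norm_neg, norm_one, one_mul, neg_one_smul] at h2
  linarith

lemma MemSchatten.sum (hp : 1 ≤ p) {ι : Type*} (s : Finset ι) {A : ι → H →L[ℂ] H}
    (hA : ∀ i ∈ s, MemSchatten p (A i)) : MemSchatten p (∑ i ∈ s, A i) := by
  classical
  induction s using Finset.induction_on with
  | empty => simpa using memSchatten_zero hp
  | insert i s hi ih =>
    rw [Finset.sum_insert hi]
    exact (hA i (by simp)).add hp (ih fun j hj => hA j (by simp [hj]))

/-- Operator norm convergence is enough: the bound passes to the limit by semicontinuity, and for `p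
= ∞` compact operators are closed. -/
lemma MemSchatten.of_tendsto (hp : 1 ≤ p) {α : Type*} {l : Filter α} [l.NeBot]
    {B : α → H →L[ℂ] H} {A : H →L[ℂ] H} {c : ℝ} (hc : 0 ≤ c)
    (hB : ∀ᶠ k in l, MemSchatten p (B k) ∧ schattenReal p (B k) ≤ c)
    (h : Tendsto B l (𝓝 A)) : MemSchatten p A ∧ schattenReal p A ≤ c := by
  have hA : SchattenBound p A c := by
    refine SchattenBound.of_tendsto (hB.mono fun k hk => ?_) h
    rw [← schattenNorm_le_iff hp hc, ← hk.1.ofReal_schattenReal hp]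
    exact ENNReal.ofReal_le_ofReal hk.2
  refine ⟨?_, hA.schattenReal_le hp hc⟩
  by_cases hp' : p = ∞
  · rw [MemSchatten, if_pos hp']
    simp only [MemSchatten, if_pos hp'] at hB
    exact isCompactOperator_of_tendsto h (hB.mono fun k hk => hk.1)
  · exact hA.memSchatten hp hp' hc

/-- The finite rank operators. -/
def finiteRank (H : Type*) [NormedAddCommGroup H] [InnerProductSpace ℂ H] :
    Submodule ℂ (H →L[ℂ] H) :=
  Submodule.span ℂ (Set.range fun ξη : H × H => rankOne ℂ ξη.1 ξη.2)

omit [CompleteSpace H] in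
lemma rankOne_mem_finiteRank (ξ η : H) : rankOne ℂ ξ η ∈ finiteRank H :=
  Submodule.subset_span ⟨(ξ, η), rfl⟩

lemma mem_finiteRank_of_finiteDimensional {A : H →L[ℂ] H} (h : FiniteDimensional ℂ A.range) :
    A ∈ finiteRank H := by
  let u := stdOrthonormalBasis ℂ A.range
  have : A = ∑ i, rankOne ℂ (u i : H) (ContinuousLinearMap.adjoint A (u i)) := by
    ext x
    have hx := congrArg Subtype.val (u.sum_repr' ⟨A x, ⟨x, rfl⟩⟩)
    simp only [Submodule.coe_sum, Submodule.coe_smul, Submodule.coe_inner] at hx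
    simp only [sum_apply, rankOne_apply,
      ContinuousLinearMap.adjoint_inner_left]
    exact hx.symm
  rw [this]
  exact Submodule.sum_mem _ fun i _ => rankOne_mem_finiteRank _ _

lemma memSchatten_of_mem_finiteRank (hp : 1 ≤ p) {A : H →L[ℂ] H} (hA : A ∈ finiteRank H) :
    MemSchatten p A := by
  induction hA using Submodule.span_induction with
  | mem A h => obtain ⟨ξη, rfl⟩ := h; exact memSchatten_rankOne hp _ _
  | zero => exact memSchatten_zero hp
  | add A B _ _ hA hB => exact hA.add hp hB
  | smul c A _ hA => exact hA.smul hp c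

end SchattenClass

/-! ### Density of finite rank operators and convergence of compressions. -/

section Approximation

variable {H : Type*} [NormedAddCommGroup H] [InnerProductSpace ℂ H] [CompleteSpace H]
variable {p : ℝ≥0∞}

/-- Truncating the singular values: `|A - A k_ε(|A|)| = min(|A|, ε)`. -/
lemma abs_sub_mul_cutoff (A : H →L[ℂ] H) {ε : ℝ} (hε : 0 < ε) :
    CFC.abs (A - A * cfc (cutoff ε) (CFC.abs A)) = cfc (fun t => min t ε) (CFC.abs A) := by
  have ha : 0 ≤ CFC.abs A := CFC.abs_nonneg A
  have hsa := IsSelfAdjoint.of_nonneg ha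
  have hk := continuous_cutoff hε
  set a := CFC.abs A with ha_def
  have h1 : A - A * cfc (cutoff ε) a = A * cfc (fun t => 1 - cutoff ε t) a := by
    rw [cfc_sub (fun _ => 1) (cutoff ε) a (by fun_prop) (by fun_prop), cfc_const_one ℝ a, mul_sub,
      mul_one]
  have h2 : a * cfc (fun t => 1 - cutoff ε t) a = cfc (fun t => min t ε) a := by
    have : (fun t => min t ε) = fun t => t * (1 - cutoff ε t) := by
      ext t; rw [← sub_mul_cutoff hε]; ring
    rw [this, cfc_mul (fun t => t) (fun t => 1 - cutoff ε t) a (by fun_prop) (by fun_prop),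
      cfc_id' ℝ a]
  have hm : 0 ≤ cfc (fun t => min t ε) a :=
    cfc_nonneg fun t ht => le_min (spectrum_nonneg_of_nonneg ha ht) hε.le
  have hs := (IsSelfAdjoint.cfc (f := fun t => 1 - cutoff ε t) (a := a)).star_eq
  have h3 : star (A * cfc (fun t => 1 - cutoff ε t) a) * (A * cfc (fun t => 1 - cutoff ε t) a) =
      cfc (fun t => min t ε) a * cfc (fun t => min t ε) a := by
    have h4 : star (a * cfc (fun t => 1 - cutoff ε t) a) = star (cfc (fun t => min t ε) a) := by
      rw [h2]
    rw [star_mul, hs, hsa.star_eq, (IsSelfAdjoint.of_nonneg hm).star_eq] at h4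
    rw [star_mul, hs, mul_assoc, ← mul_assoc (star A), ← CFC.abs_mul_abs A, ← ha_def]
    calc _ = (cfc (fun t => 1 - cutoff ε t) a * a) * (a * cfc (fun t => 1 - cutoff ε t) a) := by
          simp only [mul_assoc]
      _ = _ := by rw [h4, h2]
  rw [h1, CFC.abs, h3, CFC.sqrt_mul_self _ hm]

lemma posTrace_cfc_min_rpow {a : H →L[ℂ] H} (ha : 0 ≤ a) {q : ℝ} (hq : 1 ≤ q) {ε : ℝ}
    (hε : 0 < ε) : posTrace (cfc (fun t => min t ε) a ^ q) = ∑' i, ENNReal.ofReal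
      (inner ℂ (stdBasis H i) (cfc (fun t : ℝ => min t ε ^ q) a (stdBasis H i))).re := by
  have hm : 0 ≤ cfc (fun t => min t ε) a :=
    cfc_nonneg fun t ht => le_min (spectrum_nonneg_of_nonneg ha ht) hε.le
  rw [posTrace, CFC.rpow_eq_cfc_real (a := cfc (fun t => min t ε) a) hm,
    ← cfc_comp' (fun t : ℝ => t ^ q) (fun t => min t ε) a
      (Real.continuous_rpow_const (by linarith)).continuousOn (by fun_prop)
      (IsSelfAdjoint.of_nonneg ha)]

/-- Dominated convergence along the basis: each diagonal coefficient is at most `ε ^ q` and at most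
that of `a ^ q`, which is summable. -/
lemma tendsto_posTrace_cfc_min_rpow {a : H →L[ℂ] H} (ha : 0 ≤ a) {q : ℝ} (hq : 1 ≤ q)
    (hfin : posTrace (a ^ q) < ∞) :
    Tendsto (fun ε : ℝ => posTrace (cfc (fun t => min t ε) a ^ q)) (𝓝[>] 0) (𝓝 0) := by
  have hq0 : 0 < q := by linarith
  have hqc : Continuous fun t : ℝ => t ^ q := Real.continuous_rpow_const hq0.le
  set F : ℝ → stdBasisIndex H → ℝ := fun ε i =>
    (inner ℂ (stdBasis H i) (cfc (fun t : ℝ => min t ε ^ q) a (stdBasis H i))).re with hF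
  set g : stdBasisIndex H → ℝ := fun i =>
    (inner ℂ (stdBasis H i) (cfc (fun t : ℝ => t ^ q) a (stdBasis H i))).re with hg
  have hg0 : ∀ i, 0 ≤ g i := fun i => by
    rw [hg]; simp only; rw [← norm_cfc_rpow_half_sq ha hq]; positivity
  have hgs : Summable g := by
    rw [posTrace, CFC.rpow_eq_cfc_real (a := a) ha] at hfin
    have := ENNReal.summable_toReal hfin.ne
    exact this.congr fun i => ENNReal.toReal_ofReal (hg0 i)
  have hcont : ∀ ε : ℝ, Continuous fun t : ℝ => min t ε ^ q := fun ε =>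
    hqc.comp (by fun_prop)
  have hF0 : ∀ ε, 0 < ε → ∀ i, 0 ≤ F ε i := fun ε hε i => by
    have hm : 0 ≤ cfc (fun t : ℝ => min t ε ^ q) a :=
      cfc_nonneg fun t ht => Real.rpow_nonneg
        (le_min (spectrum_nonneg_of_nonneg ha ht) hε.le) q
    exact re_inner_nonneg_of_nonneg hm _
  have hFg : ∀ ε, 0 < ε → ∀ i, F ε i ≤ g i := fun ε hε i =>
    re_inner_cfc_mono (fun t ht => Real.rpow_le_rpow
      (le_min (spectrum_nonneg_of_nonneg ha ht) hε.le) (min_le_left _ _) hq0.le) _ (hcont ε) hqc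
  have hFe : ∀ ε, 0 < ε → ∀ i, F ε i ≤ ε ^ q := fun ε hε i => by
    have h := re_inner_cfc_const_add_mul ha (ε ^ q) 0 continuous_id' (stdBasis H i)
    rw [(stdBasis H).orthonormal.1 i] at h
    rw [one_pow, mul_one, zero_mul, add_zero] at h
    rw [← h]
    refine re_inner_cfc_mono (fun t ht => ?_) _ (hcont ε) (by fun_prop)
    have := Real.rpow_le_rpow
      (le_min (spectrum_nonneg_of_nonneg ha ht) hε.le) (min_le_right t ε) hq0.le
    linarith
  have hlim : Tendsto (fun ε => ∑' i, F ε i) (𝓝[>] 0) (𝓝 (∑' _i : stdBasisIndex H, (0 : ℝ))) := by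
    refine tendsto_tsum_of_dominated_convergence hgs (fun i => ?_) ?_
    · have h0 : Tendsto (fun ε : ℝ => ε ^ q) (𝓝[>] 0) (𝓝 0) := by
        have := hqc.tendsto 0
        rw [Real.zero_rpow hq0.ne'] at this
        exact this.mono_left nhdsWithin_le_nhds
      refine tendsto_of_tendsto_of_tendsto_of_le_of_le' tendsto_const_nhds h0 ?_ ?_
      · filter_upwards [self_mem_nhdsWithin] with ε hε using hF0 ε hε i
      · filter_upwards [self_mem_nhdsWithin] with ε hε using hFe ε hε i
    · filter_upwards [self_mem_nhdsWithin] with ε hε i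
      rw [Real.norm_of_nonneg (hF0 ε hε i)]
      exact hFg ε hε i
  rw [tsum_zero] at hlim
  have := ENNReal.tendsto_ofReal hlim
  rw [ENNReal.ofReal_zero] at this
  refine this.congr' ?_
  filter_upwards [self_mem_nhdsWithin] with ε hε
  rw [posTrace_cfc_min_rpow ha hq hε, ENNReal.ofReal_tsum_of_nonneg (hF0 ε hε)
    (Summable.of_nonneg_of_le (hF0 ε hε) (hFg ε hε) hgs)]

/-- Project onto the span of a finite `δ`-net of the image of the unit ball; the complementary
projection kills the net. -/
lemma exists_finiteRank_norm_sub_le {A : H →L[ℂ] H} (hA : IsCompactOperator A) {δ : ℝ}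
    (hδ : 0 < δ) : ∃ B ∈ finiteRank H, ‖A - B‖ ≤ δ := by
  have htb := (IsCompactOperator.isCompact_closure_image_closedBall (𝕜₁ := ℂ) (𝕜₂ := ℂ)
    (f := (A : H →ₗ[ℂ] H)) hA 1).totallyBounded
  obtain ⟨t, htf, ht⟩ := Metric.totallyBounded_iff.mp htb δ hδ
  set P := Submodule.span ℂ t
  have : FiniteDimensional ℂ P := FiniteDimensional.span_of_finite ℂ htf
  refine ⟨P.starProjection ∘L A, mem_finiteRank_of_finiteDimensional ?_, ?_⟩
  · refine Submodule.finiteDimensional_of_le (S₂ := P) ?_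
    rintro _ ⟨x, rfl⟩
    exact Submodule.starProjection_apply_mem P _
  · refine ContinuousLinearMap.opNorm_le_of_unit_norm hδ.le fun x hx => ?_
    have hmem : A x ∈ closure ((A : H →ₗ[ℂ] H) '' Metric.closedBall 0 1) :=
      subset_closure ⟨x, by simp [hx], rfl⟩
    obtain ⟨y, hy, hxy⟩ := Set.mem_iUnion₂.mp (ht hmem)
    have hPy : P.starProjection y = y :=
      Submodule.starProjection_eq_self_iff.mpr (Submodule.subset_span hy)
    have h1 : (A - P.starProjection ∘L A) x = Pᗮ.starProjection (A x - y) := by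
      rw [Submodule.starProjection_orthogonal']
      simp [hPy]
    rw [h1]
    refine (Submodule.norm_starProjection_apply_le _ _).trans ?_
    rw [← dist_eq_norm]
    exact (Metric.mem_ball.mp hxy).le

/-- Finite rank operators are dense in the Schatten class. -/
lemma MemSchatten.exists_finiteRank (hp : 1 ≤ p) {A : H →L[ℂ] H} (hA : MemSchatten p A) {δ : ℝ}
    (hδ : 0 < δ) : ∃ B ∈ finiteRank H, schattenReal p (A - B) ≤ δ := by
  by_cases hp' : p = ∞
  · rw [MemSchatten, if_pos hp'] at hA
    obtain ⟨B, hB, hAB⟩ := exists_finiteRank_norm_sub_le hA hδ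
    refine ⟨B, hB, SchattenBound.schattenReal_le hp hδ.le ?_⟩
    rwa [SchattenBound, if_pos hp']
  · have h1 := one_le_toReal hp hp'
    have h0 : 0 < p.toReal := by linarith
    have hb := hA.schattenBound hp
    rw [SchattenBound, if_neg hp'] at hb
    have hfin : posTrace (CFC.abs A ^ p.toReal) < ∞ := by rwa [MemSchatten, if_neg hp'] at hA
    have hlim := tendsto_posTrace_cfc_min_rpow (CFC.abs_nonneg A) h1 hfin
    have hev := hlim.eventually_lt_const
      (ENNReal.ofReal_pos.mpr (Real.rpow_pos_of_pos hδ p.toReal))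
    obtain ⟨ε, hε, hεpos⟩ := (hev.and self_mem_nhdsWithin).exists
    rw [← abs_sub_mul_cutoff A hεpos] at hε
    refine ⟨A * cfc (cutoff ε) (CFC.abs A), mem_finiteRank_of_finiteDimensional ?_, ?_⟩
    · have := (hb.abs h0.le).finiteDimensional_range_cutoff h0 (CFC.abs_nonneg A) hεpos
      have hr : (A * cfc (cutoff ε) (CFC.abs A)).range =
          (cfc (cutoff ε) (CFC.abs A)).range.map (A : H →ₗ[ℂ] H) :=
        LinearMap.range_comp _ _
      rw [hr]
      infer_instance
    · refine SchattenBound.schattenReal_le hp hδ.le ?_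
      rw [SchattenBound, if_neg hp']
      exact pBound_of_posTrace_le h1 hδ.le hε.le

lemma tendsto_schattenReal_conj_sub_of_mem_finiteRank (hp : 1 ≤ p) {α : Type*} {l : Filter α}
    {P : α → H →L[ℂ] H} {Q : H →L[ℂ] H} (hP : ∀ k, IsSelfAdjoint (P k))
    (hQ : IsSelfAdjoint Q) (h : ∀ x, Tendsto (fun k => P k x) l (𝓝 (Q x)))
    {Z : H →L[ℂ] H} (hZ : Z ∈ finiteRank H) :
    Tendsto (fun k => schattenReal p (P k ∘L Z ∘L P k - Q ∘L Z ∘L Q)) l (𝓝 0) := by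
  have hmem : ∀ {Z : H →L[ℂ] H}, Z ∈ finiteRank H → ∀ k,
      MemSchatten p (P k ∘L Z ∘L P k - Q ∘L Z ∘L Q) := fun hZ k =>
    ((memSchatten_of_mem_finiteRank hp hZ).conj hp _ _).sub hp
      ((memSchatten_of_mem_finiteRank hp hZ).conj hp _ _)
  induction hZ using Submodule.span_induction with
  | mem Z h' =>
    obtain ⟨⟨ξ, η⟩, rfl⟩ := h'
    have hconj : ∀ {R : H →L[ℂ] H}, IsSelfAdjoint R →
        R ∘L rankOne ℂ ξ η ∘L R = rankOne ℂ (R ξ) (R η) := fun hR => by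
      ext x
      simp [← ContinuousLinearMap.adjoint_inner_left, ContinuousLinearMap.isSelfAdjoint_iff'.mp hR]
    have hb : ∀ k, schattenReal p (P k ∘L rankOne ℂ ξ η ∘L P k - Q ∘L rankOne ℂ ξ η ∘L Q) ≤
        ‖P k ξ - Q ξ‖ * ‖P k η‖ + ‖Q ξ‖ * ‖P k η - Q η‖ := fun k => by
      rw [hconj (hP k), hconj hQ]
      have : rankOne ℂ (P k ξ) (P k η) - rankOne ℂ (Q ξ) (Q η) =
          rankOne ℂ (P k ξ - Q ξ) (P k η) + rankOne ℂ (Q ξ) (P k η - Q η) := by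
        simp only [map_sub, sub_apply]; abel
      rw [this]
      refine (schattenReal_add_le hp (memSchatten_rankOne hp _ _)
        (memSchatten_rankOne hp _ _)).trans ?_
      exact add_le_add (schattenReal_rankOne_le hp _ _) (schattenReal_rankOne_le hp _ _)
    refine squeeze_zero (fun k => schattenReal_nonneg _) hb ?_
    have e1 : ∀ x, Tendsto (fun k => ‖P k x - Q x‖) l (𝓝 0) := fun x =>
      tendsto_iff_norm_sub_tendsto_zero.mp (h x)
    simpa using ((e1 ξ).mul (h η).norm).add ((e1 η).const_mul ‖Q ξ‖)
  | zero =>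
    refine squeeze_zero (fun k => schattenReal_nonneg _) (g := fun _ => 0) (fun k => ?_)
      tendsto_const_nhds
    simpa using schattenReal_rankOne_le hp (0 : H) (0 : H)
  | add Z W hZ hW ihZ ihW =>
    refine squeeze_zero (fun k => schattenReal_nonneg _) (fun k => ?_) (by simpa using ihZ.add ihW)
    have : P k ∘L (Z + W) ∘L P k - Q ∘L (Z + W) ∘L Q =
        (P k ∘L Z ∘L P k - Q ∘L Z ∘L Q) + (P k ∘L W ∘L P k - Q ∘L W ∘L Q) := by
      ext x; simp; abel
    rw [this]
    exact schattenReal_add_le hp (hmem hZ k) (hmem hW k)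
  | smul c Z hZ ihZ =>
    refine squeeze_zero (fun k => schattenReal_nonneg _) (fun k => ?_)
      (by simpa using ihZ.const_mul ‖c‖)
    have : P k ∘L (c • Z) ∘L P k - Q ∘L (c • Z) ∘L Q =
        c • (P k ∘L Z ∘L P k - Q ∘L Z ∘L Q) := by
      ext x; simp [smul_sub]
    rw [this]
    exact schattenReal_smul_le hp c (hmem hZ k)

/-- Strong convergence of self-adjoint contractions gives `S^p` convergence of the compressions of a
finite rank operator, by computation in rank one. Density and the uniform norm bound extend this to
`S^p`. -/
lemma MemSchatten.tendsto_schattenReal_conj_sub (hp : 1 ≤ p) {α : Type*} {l : Filter α}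
    {P : α → H →L[ℂ] H} {Q : H →L[ℂ] H} (hP : ∀ k, IsSelfAdjoint (P k))
    (hQ : IsSelfAdjoint Q) (hP1 : ∀ k, ‖P k‖ ≤ 1) (hQ1 : ‖Q‖ ≤ 1)
    (h : ∀ x, Tendsto (fun k => P k x) l (𝓝 (Q x))) {Z : H →L[ℂ] H} (hZ : MemSchatten p Z) :
    Tendsto (fun k => schattenReal p (P k ∘L Z ∘L P k - Q ∘L Z ∘L Q)) l (𝓝 0) := by
  rw [Metric.tendsto_nhds]
  intro ε hε
  obtain ⟨B, hB, hZB⟩ := hZ.exists_finiteRank hp (show 0 < ε / 4 by positivity)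
  have hBm := memSchatten_of_mem_finiteRank hp hB
  have hD := hZ.sub hp hBm
  have hlim := tendsto_schattenReal_conj_sub_of_mem_finiteRank hp hP hQ h hB
  filter_upwards [hlim.eventually_lt_const (show 0 < ε / 4 by positivity)] with k hk
  rw [Real.dist_0_eq_abs, abs_of_nonneg (schattenReal_nonneg _)]
  have : P k ∘L Z ∘L P k - Q ∘L Z ∘L Q =
      (P k ∘L (Z - B) ∘L P k - Q ∘L (Z - B) ∘L Q) + (P k ∘L B ∘L P k - Q ∘L B ∘L Q) := by
    ext x; simp; abel
  rw [this]
  have h1 := schattenReal_conj_le_of_le hp hD (hP1 k) (hP1 k)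
  have h2 := schattenReal_conj_le_of_le hp hD hQ1 hQ1
  have h3 := schattenReal_sub_le hp (hD.conj hp (P k) (P k)) (hD.conj hp Q Q)
  have h4 := schattenReal_add_le hp ((hD.conj hp (P k) (P k)).sub hp (hD.conj hp Q Q))
    ((hBm.conj hp (P k) (P k)).sub hp (hBm.conj hp Q Q))
  linarith

end Approximation

/-! ### Sign functions and atomless measures. -/

open Classical in
/-- The function equal to `1` on `D` and to `-1` off `D`. -/
def signFn {X : Type*} (D : Set X) (x : X) : ℂ := if x ∈ D then 1 else -1

lemma norm_signFn {X : Type*} (D : Set X) (x : X) : ‖signFn D x‖ = 1 := by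
  unfold signFn; split_ifs <;> simp

lemma signFn_mul_self {X : Type*} (D : Set X) (x : X) : signFn D x * signFn D x = 1 := by
  unfold signFn; split_ifs <;> simp

lemma conj_signFn {X : Type*} (D : Set X) (x : X) : (starRingEnd ℂ) (signFn D x) = signFn D x := by
  unfold signFn; split_ifs <;> simp

section Atomless

variable {X : Type*} [MeasurableSpace X] {μ : Measure X}

/-- Split repeatedly and keep the smaller piece: the measure is at least halved each time and never
vanishes. -/
lemma Atomless.exists_subset_measure_le (hμ : Atomless μ) {s : Set X} (hs : MeasurableSet s)
    (hs0 : μ s ≠ 0) (hsfin : μ s ≠ ∞) {ε : ℝ≥0∞} (hε : ε ≠ 0) :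
    ∃ t ⊆ s, MeasurableSet t ∧ μ t ≠ 0 ∧ μ t ≤ ε := by
  have key : ∀ n : ℕ, ∃ t ⊆ s, MeasurableSet t ∧ μ t ≠ 0 ∧ μ t ≤ (2⁻¹ : ℝ≥0∞) ^ n * μ s := by
    intro n
    induction n with
    | zero => exact ⟨s, subset_rfl, hs, hs0, by simp⟩
    | succ n ih =>
      obtain ⟨t, hts, ht, ht0, htle⟩ := ih
      obtain ⟨t', ht't, ht', h1, h2⟩ := hμ t ht ht0
      have hsum : μ t' + μ (t \ t') = μ t := by
        rw [← measure_inter_add_sdiff t ht', Set.inter_eq_self_of_subset_right ht't]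
      have hhalf : μ t' ≤ 2⁻¹ * μ t ∨ μ (t \ t') ≤ 2⁻¹ * μ t := by
        by_contra! hcon
        have := ENNReal.add_lt_add hcon.1 hcon.2
        rw [hsum, ← add_mul, ENNReal.inv_two_add_inv_two, one_mul] at this
        exact this.false
      have hstep : 2⁻¹ * μ t ≤ (2⁻¹ : ℝ≥0∞) ^ (n + 1) * μ s := by
        rw [pow_succ', mul_assoc]; gcongr
      rcases hhalf with h | h
      · exact ⟨t', ht't.trans hts, ht', h1, h.trans hstep⟩
      · exact ⟨t \ t', Set.sdiff_subset.trans hts, ht.diff ht', h2, h.trans hstep⟩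
  have hlim : Tendsto (fun n : ℕ => (2⁻¹ : ℝ≥0∞) ^ n * μ s) atTop (𝓝 0) := by
    have := ENNReal.Tendsto.mul_const (b := μ s)
      (ENNReal.tendsto_pow_atTop_nhds_zero_of_lt_one (r := 2⁻¹) (by simp)) (Or.inr hsfin)
    rwa [zero_mul] at this
  obtain ⟨n, hn⟩ := (hlim.eventually_lt_const (pos_iff_ne_zero.mpr hε)).exists
  obtain ⟨t, h1, h2, h3, h4⟩ := key n
  exact ⟨t, h1, h2, h3, h4.trans hn.le⟩

/-- **Sierpiński's theorem**: an atomless measure takes all intermediate values. -/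
lemma Atomless.exists_subset_measure_eq (hμ : Atomless μ) {s : Set X} (hs : MeasurableSet s)
    (hsfin : μ s ≠ ∞) {c : ℝ≥0∞} (hc : c ≤ μ s) : ∃ t ⊆ s, MeasurableSet t ∧ μ t = c := by
  have hcfin : c ≠ ∞ := (hc.trans_lt hsfin.lt_top).ne
  let P : Set X → Prop := fun D => D ⊆ s ∧ MeasurableSet D ∧ μ D ≤ c
  have hfin : ∀ {D}, P D → μ D ≠ ∞ := fun hD => (hD.2.2.trans_lt hcfin.lt_top).ne
  -- Greedy exhaustion: at stage `n` enlarge `D`, within measure `c`, to within `1 / (n + 1)` of the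
  -- supremum.
  have hnext : ∀ (n : ℕ) (D : {D // P D}), ∃ D' : {D // P D}, D.1 ⊆ D'.1 ∧
      ∀ D'', P D'' → D.1 ⊆ D'' → μ.real D'' ≤ μ.real D'.1 + 1 / ((n : ℝ) + 1) := by
    intro n D
    set M := {m : ℝ | ∃ D', P D' ∧ D.1 ⊆ D' ∧ m = μ.real D'} with hM
    have hne : M.Nonempty := ⟨_, D.1, D.2, subset_rfl, rfl⟩
    have hbdd : BddAbove M := by
      refine ⟨c.toReal, ?_⟩
      rintro _ ⟨D', hD', -, rfl⟩
      exact ENNReal.toReal_mono hcfin hD'.2.2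
    obtain ⟨_, ⟨D', hD', hDD', rfl⟩, hlt⟩ := exists_lt_of_lt_csSup hne
      (sub_lt_self (sSup M) (Nat.one_div_pos_of_nat (n := n) (α := ℝ)))
    refine ⟨⟨D', hD'⟩, hDD', fun D'' h1 h2 => ?_⟩
    have := le_csSup hbdd ⟨D'', h1, h2, rfl⟩
    linarith
  choose next hsub hmax using hnext
  let D : ℕ → {D // P D} := fun n =>
    Nat.rec ⟨∅, Set.empty_subset _, MeasurableSet.empty, by simp⟩ (fun n D => next n D) n
  have hDsucc : ∀ n, D (n + 1) = next n (D n) := fun n => rfl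
  have hmono : Monotone fun n => (D n).1 := monotone_nat_of_le_succ fun n => hsub n (D n)
  set U := ⋃ n, (D n).1 with hU
  have hPU : P U := by
    refine ⟨Set.iUnion_subset fun n => (D n).2.1, MeasurableSet.iUnion fun n => (D n).2.2.1, ?_⟩
    rw [hU, hmono.measure_iUnion]
    exact iSup_le fun n => (D n).2.2.2
  refine ⟨U, hPU.1, hPU.2.1, ?_⟩
  by_contra hne
  have hlt : μ U < c := lt_of_le_of_ne hPU.2.2 hne
  have hdiff : μ (s \ U) ≠ 0 := by
    rw [measure_sdiff hPU.1 hPU.2.1.nullMeasurableSet (hfin hPU)]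
    exact (tsub_pos_of_lt (hlt.trans_le hc)).ne'
  obtain ⟨E, hEs, hE, hE0, hEle⟩ := hμ.exists_subset_measure_le (hs.diff hPU.2.1) hdiff
    ((measure_mono Set.sdiff_subset).trans_lt hsfin.lt_top).ne (tsub_pos_of_lt hlt).ne'
  have hdisj : Disjoint U E := (Set.disjoint_sdiff_right).mono_right hEs
  have hmeas : μ (U ∪ E) = μ U + μ E := measure_union hdisj hE
  have hPUE : P (U ∪ E) := by
    refine ⟨Set.union_subset hPU.1 (hEs.trans Set.sdiff_subset), hPU.2.1.union hE, ?_⟩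
    rw [hmeas]
    calc _ ≤ μ U + (c - μ U) := by gcongr
      _ = c := add_tsub_cancel_of_le hlt.le
  have hEfin : μ E ≠ ∞ := ((measure_mono Set.subset_union_right).trans_lt (hfin hPUE).lt_top).ne
  have hreal : μ.real (U ∪ E) = μ.real U + μ.real E := by
    rw [measureReal_def, hmeas, ENNReal.toReal_add (hfin hPU) hEfin]; rfl
  have hEpos : 0 < μ.real E := ENNReal.toReal_pos hE0 hEfin
  obtain ⟨n, hn⟩ := exists_nat_one_div_lt hEpos
  -- `U ∪ E` is admissible at every stage, yet exceeds the chosen set by at least the measure of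
  -- `E`, larger than the allowed defect.
  have h1 := hmax n (D n) (U ∪ E) hPUE
    ((Set.subset_iUnion (fun n => (D n).1) n).trans Set.subset_union_left)
  have h2 : μ.real (next n (D n)).1 ≤ μ.real U :=
    measureReal_mono (Set.subset_iUnion (fun n => (D n).1) (n + 1)) (hfin hPU)
  linarith

lemma Atomless.exists_half (hμ : Atomless μ) {s : Set X} (hs : MeasurableSet s)
    (hsfin : μ s ≠ ∞) : ∃ t ⊆ s, MeasurableSet t ∧ μ.real t = μ.real (s \ t) := by
  obtain ⟨t, hts, ht, h⟩ := hμ.exists_subset_measure_eq hs hsfin (c := μ s / 2) ENNReal.half_le_self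
  refine ⟨t, hts, ht, ?_⟩
  rw [measureReal_sdiff hts ht hsfin, measureReal_def, measureReal_def, h, ENNReal.toReal_div]
  simp only [ENNReal.toReal_ofNat]
  ring

lemma measurable_signFn {D : Set X} (hD : MeasurableSet D) : Measurable (signFn D) := by
  unfold signFn
  exact Measurable.ite hD measurable_const measurable_const

variable {E : Type*} [NormedAddCommGroup E] [NormedSpace ℂ E]

/-- Halve every level set with nonzero value, giving opposite signs to the two halves; their
contributions cancel. -/
lemma Atomless.exists_signFn_integral_simpleFunc_eq_zero [CompleteSpace E] (hμ : Atomless μ)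
    (g : SimpleFunc X E) (hg : Integrable g μ) :
    ∃ D, MeasurableSet D ∧ ∫ x, signFn D x • g x ∂μ = 0 := by
  classical
  have hfin : ∀ c : E, c ≠ 0 → μ (g ⁻¹' {c}) ≠ ∞ := fun c hc =>
    (SimpleFunc.measure_preimage_lt_top_of_integrable g hg hc).ne
  have hmeas : ∀ c, MeasurableSet (g ⁻¹' {c}) := fun c => g.measurableSet_preimage _
  have hex : ∀ c : E, ∃ t ⊆ g ⁻¹' {c}, MeasurableSet t ∧
      (c ≠ 0 → μ.real t = μ.real (g ⁻¹' {c} \ t)) := fun c => by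
    by_cases hc : c = 0
    · exact ⟨∅, Set.empty_subset _, MeasurableSet.empty, fun h => absurd hc h⟩
    · obtain ⟨t, h1, h2, h3⟩ := hμ.exists_half (hmeas c) (hfin c hc)
      exact ⟨t, h1, h2, fun _ => h3⟩
  choose t hts ht hth using hex
  set F := g.range.filter (· ≠ 0) with hF
  have hF0 : ∀ c ∈ F, c ≠ 0 := fun c hc => (Finset.mem_filter.mp hc).2
  refine ⟨⋃ c ∈ F, t c, Finset.measurableSet_biUnion _ fun c _ => ht c, ?_⟩
  have hpt : ∀ x, signFn (⋃ c ∈ F, t c) x • g x =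
      ∑ c ∈ F, ((t c).indicator (fun _ => c) x - (g ⁻¹' {c} \ t c).indicator (fun _ => c) x) := by
    intro x
    have hzero : ∀ c ∈ F, c ≠ g x →
        (t c).indicator (fun _ => c) x - (g ⁻¹' {c} \ t c).indicator (fun _ => c) x = 0 := by
      intro c _ hcx
      have h1 : x ∉ g ⁻¹' {c} := fun h => hcx h.symm
      rw [Set.indicator_of_notMem (fun h => h1 (hts c h)),
        Set.indicator_of_notMem (fun h => h1 h.1), sub_zero]
    by_cases hx : g x = 0
    · rw [hx, smul_zero, Finset.sum_eq_zero]
      intro c hc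
      exact hzero c hc (by rw [hx]; exact hF0 c hc)
    · have hxF : g x ∈ F := Finset.mem_filter.mpr ⟨g.mem_range_self x, hx⟩
      rw [Finset.sum_eq_single_of_mem _ hxF hzero]
      have hiff : x ∈ (⋃ c ∈ F, t c) ↔ x ∈ t (g x) := by
        simp only [Set.mem_iUnion]
        constructor
        · rintro ⟨c, _, hc⟩
          have : g x = c := hts c hc
          rwa [this]
        · exact fun h => ⟨g x, hxF, h⟩
      by_cases hxt : x ∈ t (g x)
      · rw [Set.indicator_of_mem hxt, Set.indicator_of_notMem (fun h => h.2 hxt), signFn,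
          if_pos (hiff.mpr hxt), one_smul, sub_zero]
      · rw [Set.indicator_of_notMem hxt, Set.indicator_of_mem (show x ∈ g ⁻¹' {g x} \ t (g x) from
          ⟨rfl, hxt⟩), signFn, if_neg (fun h => hxt (hiff.mp h)), neg_one_smul, zero_sub]
  have hi1 : ∀ c ∈ F, Integrable ((t c).indicator fun _ => c) μ := fun c hc =>
    (integrable_indicator_iff (ht c)).mpr (integrableOn_const
      (((measure_mono (hts c)).trans_lt (hfin c (hF0 c hc)).lt_top).ne))
  have hi2 : ∀ c ∈ F, Integrable ((g ⁻¹' {c} \ t c).indicator fun _ => c) μ := fun c hc =>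
    (integrable_indicator_iff ((hmeas c).diff (ht c))).mpr (integrableOn_const
      (((measure_mono Set.sdiff_subset).trans_lt (hfin c (hF0 c hc)).lt_top).ne))
  simp_rw [hpt]
  rw [integral_finsetSum F (f := fun c x => (t c).indicator (fun _ => c) x -
    (g ⁻¹' {c} \ t c).indicator (fun _ => c) x) fun c hc => (hi1 c hc).sub (hi2 c hc)]
  refine Finset.sum_eq_zero fun c hc => ?_
  rw [integral_sub (hi1 c hc) (hi2 c hc), integral_indicator_const _ (ht c),
    integral_indicator_const _ ((hmeas c).diff (ht c)), hth c (hF0 c hc), sub_self]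

/-- Approximate by a simple function in `L¹`; signs do not change the error. Vector values allow one
choice of signs to treat several scalar functions simultaneously. -/
lemma Atomless.exists_signFn_norm_integral_lt [CompleteSpace E] (hμ : Atomless μ) {h : X → E}
    (hh : Integrable h μ) {ε : ℝ} (hε : 0 < ε) :
    ∃ D, MeasurableSet D ∧ ‖∫ x, signFn D x • h x ∂μ‖ < ε := by
  obtain ⟨g, hhg, hg⟩ := (memLp_one_iff_integrable.mpr hh).exists_simpleFunc_eLpNorm_sub_lt
    ENNReal.one_ne_top (ε := ENNReal.ofReal ε) (ENNReal.ofReal_pos.mpr hε).ne'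
  have hgi : Integrable g μ := memLp_one_iff_integrable.mp hg
  obtain ⟨D, hD, hint⟩ := hμ.exists_signFn_integral_simpleFunc_eq_zero g hgi
  refine ⟨D, hD, ?_⟩
  have hsign : ∀ {f : X → E}, Integrable f μ → Integrable (fun x => signFn D x • f x) μ :=
    fun hf => hf.bdd_smul 1 (measurable_signFn hD).aestronglyMeasurable
      (Eventually.of_forall fun x => (norm_signFn D x).le)
  have h1 : ∫ x, signFn D x • h x ∂μ = ∫ x, signFn D x • (h - g) x ∂μ := by
    simp_rw [Pi.sub_apply, smul_sub]
    rw [integral_sub (hsign hh) (hsign hgi), hint, sub_zero]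
  rw [h1]
  have h2 : ENNReal.ofReal ‖∫ x, signFn D x • (h - g) x ∂μ‖ < ENNReal.ofReal ε := by
    rw [ofReal_norm]
    refine (enorm_integral_le_lintegral_enorm _).trans_lt (lt_of_eq_of_lt ?_ hhg)
    rw [eLpNorm_one_eq_lintegral_enorm]
    refine lintegral_congr fun x => ?_
    rw [enorm_smul, ← ofReal_norm (signFn D x), norm_signFn]
    simp
  exact (ENNReal.ofReal_lt_ofReal_iff hε).mp h2

end Atomless

/-! ### Multiplication by signs on `L²`. -/

section Kernel

variable {X : Type*} [MeasurableSpace X] {μ : Measure X}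

lemma memLp_top_signFn {D : Set X} (hD : MeasurableSet D) : MemLp (signFn D) ∞ μ :=
  memLp_top_of_bound (measurable_signFn hD).aestronglyMeasurable 1
    (Eventually.of_forall fun x => (norm_signFn D x).le)

/-- Multiplication by `signFn D` on `L²`. -/
def signMul (μ : Measure X) {D : Set X} (hD : MeasurableSet D) : Lp ℂ 2 μ →L[ℂ] Lp ℂ 2 μ :=
  (ContinuousLinearMap.lsmul ℂ ℂ).holderL μ ∞ 2 2 (memLp_top_signFn hD).toLp

lemma coeFn_signMul {D : Set X} (hD : MeasurableSet D) (f : Lp ℂ 2 μ) :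
    signMul μ hD f =ᵐ[μ] fun x => signFn D x * f x := by
  refine (ContinuousLinearMap.coeFn_holder _ _ _).trans ?_
  filter_upwards [(memLp_top_signFn (μ := μ) hD).coeFn_toLp] with x hx
  simp [hx]

lemma norm_signMul_le {D : Set X} (hD : MeasurableSet D) : ‖signMul μ hD‖ ≤ 1 := by
  refine ContinuousLinearMap.opNorm_le_bound _ zero_le_one fun f => ?_
  rw [one_mul]
  refine Lp.norm_le_norm_of_ae_le ?_
  filter_upwards [coeFn_signMul hD f] with x hx
  rw [hx, norm_mul, norm_signFn, one_mul]

lemma signMul_signMul {D : Set X} (hD : MeasurableSet D) (f : Lp ℂ 2 μ) :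
    signMul μ hD (signMul μ hD f) = f := by
  refine Lp.ext ?_
  filter_upwards [coeFn_signMul hD f, coeFn_signMul hD (signMul μ hD f)] with x h1 h2
  rw [h2, h1, ← mul_assoc, signFn_mul_self, one_mul]

lemma inner_signMul_signMul {D D' : Set X} (hD : MeasurableSet D) (hD' : MeasurableSet D')
    (f g : Lp ℂ 2 μ) : inner ℂ (signMul μ hD f) (signMul μ hD' g) =
      ∫ x, signFn D x • (signFn D' x * inner ℂ (f x) (g x)) ∂μ := by
  rw [L2.inner_def]
  refine integral_congr_ae ?_
  filter_upwards [coeFn_signMul hD f, coeFn_signMul hD' g] with x h1 h2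
  rw [h1, h2, RCLike.inner_apply, RCLike.inner_apply, map_mul, conj_signFn, smul_eq_mul]
  ring

lemma isSelfAdjoint_signMul {D : Set X} (hD : MeasurableSet D) :
    IsSelfAdjoint (signMul μ hD) := by
  rw [ContinuousLinearMap.isSelfAdjoint_iff_isSymmetric]
  intro f g
  change inner ℂ (signMul μ hD f) g = inner ℂ f (signMul μ hD g)
  rw [L2.inner_def, L2.inner_def]
  refine integral_congr_ae ?_
  filter_upwards [coeFn_signMul hD f, coeFn_signMul hD g] with x h1 h2
  rw [h1, h2, RCLike.inner_apply, RCLike.inner_apply, map_mul, conj_signFn]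
  ring

/-- The sets are chosen one index at a time, each new sign being made nearly orthogonal to all the
earlier ones. -/
lemma Atomless.exists_signMul_family (hμ : Atomless μ) {I : Type*} (F : Finset I)
    (S : Finset (Lp ℂ 2 μ)) {ε : ℝ} (hε : 0 < ε) :
    ∃ (D : I → Set X) (hD : ∀ i, MeasurableSet (D i)), ∀ i ∈ F, ∀ j ∈ F, i ≠ j →
      ∀ f ∈ S, ∀ g ∈ S, ‖inner ℂ (signMul μ (hD i) f) (signMul μ (hD j) g)‖ < ε := by
  classical
  induction F using Finset.induction_on with
  | empty => exact ⟨fun _ => ∅, fun _ => MeasurableSet.empty, by simp⟩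
  | insert a F ha ih =>
    obtain ⟨D, hD, h⟩ := ih
    -- All conditions on the new sign, one for each earlier index and each pair of test vectors, are
    -- gathered into a single function with values in `K → ℂ`.
    let K := F × S × S
    have hint : ∀ k : K, Integrable
        (fun x => signFn (D k.1) x * inner ℂ ((k.2.1 : Lp ℂ 2 μ) x) ((k.2.2 : Lp ℂ 2 μ) x)) μ :=
      fun k => (L2.integrable_inner (𝕜 := ℂ) (k.2.1 : Lp ℂ 2 μ) (k.2.2 : Lp ℂ 2 μ)).bdd_mul
        (c := 1) (measurable_signFn (hD _)).aestronglyMeasurable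
        (Eventually.of_forall fun x => (norm_signFn _ x).le)
    have hint' : Integrable (fun x => fun k : K =>
        signFn (D k.1) x * inner ℂ ((k.2.1 : Lp ℂ 2 μ) x) ((k.2.2 : Lp ℂ 2 μ) x)) μ :=
      Integrable.of_eval hint
    obtain ⟨D', hD', hlt⟩ := hμ.exists_signFn_norm_integral_lt hint' hε
    have hsigned : Integrable (fun x => signFn D' x • fun k : K =>
        signFn (D k.1) x * inner ℂ ((k.2.1 : Lp ℂ 2 μ) x) ((k.2.2 : Lp ℂ 2 μ) x)) μ :=
      hint'.bdd_smul 1 (measurable_signFn hD').aestronglyMeasurable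
        (Eventually.of_forall fun x => (norm_signFn D' x).le)
    have hkey : ∀ j ∈ F, ∀ f ∈ S, ∀ g ∈ S,
        ‖inner ℂ (signMul μ hD' f) (signMul μ (hD j) g)‖ < ε := by
      intro j hj f hf g hg
      rw [inner_signMul_signMul]
      let k : K := ⟨⟨j, hj⟩, ⟨f, hf⟩, ⟨g, hg⟩⟩
      refine lt_of_le_of_lt ?_ hlt
      refine le_trans (le_of_eq ?_) (norm_le_pi_norm _ k)
      rw [eval_integral (fun k => Integrable.eval hsigned k)]
      rfl
    refine ⟨Function.update D a D', fun i => ?_, ?_⟩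
    · by_cases hi : i = a
      · subst hi; rw [Function.update_self]; exact hD'
      · rw [Function.update_of_ne hi]; exact hD i
    · have hne : ∀ i ∈ F, i ≠ a := fun i hi h => ha (h ▸ hi)
      intro i hi j hj hij f hf g hg
      rcases Finset.mem_insert.mp hi with rfl | hi' <;>
        rcases Finset.mem_insert.mp hj with rfl | hj'
      · exact absurd rfl hij
      · simp only [Function.update_self, Function.update_of_ne (hne j hj')]
        exact hkey j hj' f hf g hg
      · simp only [Function.update_self, Function.update_of_ne (hne i hi')]
        rw [norm_inner_symm]
        exact hkey i hi' g hg f hf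
      · simp only [Function.update_of_ne (hne i hi'), Function.update_of_ne (hne j hj')]
        exact h i hi' j hj' hij f hf g hg

end Kernel

/-! ### Operators with square integrable kernels. -/

section Kernel

variable {X : Type*} [MeasurableSpace X] {μ : Measure X}

lemma eLpNorm_two_sq {Y : Type*} [MeasurableSpace Y] {ν : Measure Y} (f : Y → ℂ) :
    eLpNorm f 2 ν ^ 2 = ∫⁻ y, ‖f y‖ₑ ^ 2 ∂ν := by
  have := eLpNorm_nnreal_pow_eq_lintegral (f := f) (μ := ν) (p := 2) two_ne_zero
  simpa using this

lemma enorm_integral_mul_le {g f : X → ℂ} (hg : AEStronglyMeasurable g μ)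
    (hf : AEStronglyMeasurable f μ) :
    ‖∫ y, g y * f y ∂μ‖ₑ ≤ eLpNorm g 2 μ * eLpNorm f 2 μ := by
  have h1 : ‖∫ y, g y * f y ∂μ‖ₑ ≤ eLpNorm (g • f) 1 μ := by
    rw [eLpNorm_one_eq_lintegral_enorm]
    exact enorm_integral_le_lintegral_enorm _
  exact h1.trans (eLpNorm_smul_le_mul_eLpNorm hf hg)

lemma HasKernel.signMul_conj {B : Lp ℂ 2 μ →L[ℂ] Lp ℂ 2 μ} {k : X × X → ℂ}
    (hB : HasKernel μ B k) {D D' : Set X} (hD : MeasurableSet D) (hD' : MeasurableSet D') :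
    HasKernel μ (signMul μ hD ∘L B ∘L signMul μ hD')
      (fun z => signFn D z.1 * signFn D' z.2 * k z) := by
  refine ⟨hB.1.of_le ?_ (Eventually.of_forall fun z => ?_), fun f => ?_⟩
  · exact ((((measurable_signFn hD).comp measurable_fst).mul
      ((measurable_signFn hD').comp measurable_snd)).aestronglyMeasurable).mul hB.1.1
  · rw [norm_mul, norm_mul, norm_signFn, norm_signFn, one_mul, one_mul]
  · filter_upwards [coeFn_signMul hD (B (signMul μ hD' f)), hB.2 (signMul μ hD' f)] with x h1 h2
    rw [ContinuousLinearMap.comp_apply, ContinuousLinearMap.comp_apply, h1, h2,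
      ← integral_const_mul]
    refine integral_congr_ae ?_
    filter_upwards [coeFn_signMul hD' f] with y hy
    rw [hy]
    ring

variable [SFinite μ]

lemma aestronglyMeasurable_slice {k : X × X → ℂ} (hk : MemLp k 2 (μ.prod μ)) :
    ∀ᵐ x ∂μ, AEStronglyMeasurable (fun y => k (x, y)) μ :=
  hk.1.prodMk_left

lemma memLp_slice {k : X × X → ℂ} (hk : MemLp k 2 (μ.prod μ)) :
    ∀ᵐ x ∂μ, MemLp (fun y => k (x, y)) 2 μ := by
  have h1 := (memLp_two_iff_integrable_sq_norm hk.1).mp hk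
  filter_upwards [aestronglyMeasurable_slice hk, h1.prod_right_ae] with x hx1 hx2
  exact (memLp_two_iff_integrable_sq_norm hx1).mpr hx2

lemma lintegral_slice {k : X × X → ℂ} (hk : MemLp k 2 (μ.prod μ)) :
    ∫⁻ x, eLpNorm (fun y => k (x, y)) 2 μ ^ 2 ∂μ = eLpNorm k 2 (μ.prod μ) ^ 2 := by
  simp_rw [eLpNorm_two_sq]
  exact (lintegral_prod _ (hk.1.enorm.pow_const 2)).symm

/-- Cauchy–Schwarz on almost every slice, then Tonelli. -/
lemma eLpNorm_integral_kernel_le {k : X × X → ℂ} (hk : MemLp k 2 (μ.prod μ)) {f : X → ℂ}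
    (hf : MemLp f 2 μ) : eLpNorm (fun x => ∫ y, k (x, y) * f y ∂μ) 2 μ ≤
      eLpNorm k 2 (μ.prod μ) * eLpNorm f 2 μ := by
  have h : eLpNorm (fun x => ∫ y, k (x, y) * f y ∂μ) 2 μ ^ 2 ≤
      (eLpNorm k 2 (μ.prod μ) * eLpNorm f 2 μ) ^ 2 := by
    rw [eLpNorm_two_sq, mul_pow, ← lintegral_slice hk,
      ← lintegral_mul_const' _ _ (ENNReal.pow_ne_top hf.2.ne)]
    refine lintegral_mono_ae ?_
    filter_upwards [aestronglyMeasurable_slice hk] with x hx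
    rw [← mul_pow]
    exact pow_le_pow_left' (enorm_integral_mul_le hx hf.1) 2
  exact (ENNReal.pow_le_pow_left_iff two_ne_zero).mp h

lemma memLp_integral_kernel {k : X × X → ℂ} (hk : MemLp k 2 (μ.prod μ)) {f : X → ℂ}
    (hf : MemLp f 2 μ) : MemLp (fun x => ∫ y, k (x, y) * f y ∂μ) 2 μ :=
  ⟨(hk.1.mul hf.1.comp_snd).integral_prod_right',
    (eLpNorm_integral_kernel_le hk hf).trans_lt (ENNReal.mul_lt_top hk.2 hf.2)⟩

/-- Every square integrable function is the kernel of a bounded operator. -/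
lemma exists_hasKernel {k : X × X → ℂ} (hk : MemLp k 2 (μ.prod μ)) :
    ∃ B : Lp ℂ 2 μ →L[ℂ] Lp ℂ 2 μ, HasKernel μ B k := by
  have hcoe : ∀ f : Lp ℂ 2 μ, (memLp_integral_kernel hk (Lp.memLp f)).toLp =ᵐ[μ]
      fun x => ∫ y, k (x, y) * f y ∂μ := fun f => MemLp.coeFn_toLp _
  let L : Lp ℂ 2 μ →ₗ[ℂ] Lp ℂ 2 μ :=
    { toFun := fun f => (memLp_integral_kernel hk (Lp.memLp f)).toLp
      map_add' := by
        intro f g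
        refine Lp.ext ?_
        filter_upwards [hcoe (f + g), hcoe f, hcoe g, Lp.coeFn_add
          ((memLp_integral_kernel hk (Lp.memLp f)).toLp)
          ((memLp_integral_kernel hk (Lp.memLp g)).toLp), memLp_slice hk] with x h1 h2 h3 h4 h5
        rw [h4, Pi.add_apply, h1, h2, h3,
          ← integral_add (f := fun y => k (x, y) * f y) (g := fun y => k (x, y) * g y)
            (h5.integrable_mul (Lp.memLp f)) (h5.integrable_mul (Lp.memLp g))]
        refine integral_congr_ae ?_
        filter_upwards [Lp.coeFn_add f g] with y hy
        rw [hy, Pi.add_apply, mul_add]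
      map_smul' := by
        intro c f
        refine Lp.ext ?_
        filter_upwards [hcoe (c • f), hcoe f, Lp.coeFn_smul c
          ((memLp_integral_kernel hk (Lp.memLp f)).toLp)] with x h1 h2 h3
        rw [RingHom.id_apply, h3, Pi.smul_apply, h1, h2, ← integral_smul]
        refine integral_congr_ae ?_
        filter_upwards [Lp.coeFn_smul c f] with y hy
        rw [hy, Pi.smul_apply, smul_eq_mul, smul_eq_mul]
        ring }
  refine ⟨L.mkContinuous (eLpNorm k 2 (μ.prod μ)).toReal fun f => ?_, hk, hcoe⟩
  change ‖(memLp_integral_kernel hk (Lp.memLp f)).toLp‖ ≤ _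
  rw [Lp.norm_toLp, Lp.norm_def, ← ENNReal.toReal_mul]
  exact ENNReal.toReal_mono (ENNReal.mul_ne_top hk.2.ne (Lp.memLp f).2.ne)
    (eLpNorm_integral_kernel_le hk (Lp.memLp f))

omit [SFinite μ] in
lemma hasKernel_rankOne (f g : Lp ℂ 2 μ) :
    HasKernel μ (rankOne ℂ f g) (fun z => f z.1 * (starRingEnd ℂ) (g z.2)) := by
  have hm : AEStronglyMeasurable (fun z : X × X => f z.1 * (starRingEnd ℂ) (g z.2))
      (μ.prod μ) :=
    (Lp.memLp f).1.comp_fst.mul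
      (Complex.continuous_conj.comp_aestronglyMeasurable (Lp.memLp g).1.comp_snd)
  refine ⟨?_, fun h => ?_⟩
  · rw [memLp_two_iff_integrable_sq_norm hm]
    have hf := (memLp_two_iff_integrable_sq_norm (Lp.memLp f).1).mp (Lp.memLp f)
    have hg := (memLp_two_iff_integrable_sq_norm (Lp.memLp g).1).mp (Lp.memLp g)
    refine (hf.mul_prod hg).congr (Eventually.of_forall fun z => ?_)
    simp only [norm_mul, RCLike.norm_conj, mul_pow]
  · rw [rankOne_apply]
    filter_upwards [Lp.coeFn_smul (inner ℂ g h) f] with x hx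
    rw [hx, Pi.smul_apply, L2.inner_def, smul_eq_mul, mul_comm, ← integral_const_mul]
    refine integral_congr_ae (Eventually.of_forall fun y => ?_)
    simp only [RCLike.inner_apply]
    ring

variable {p : ℝ≥0∞} {φ : X × X → ℂ} {C : ℝ≥0}
  {T : (Lp ℂ 2 μ →L[ℂ] Lp ℂ 2 μ) → (Lp ℂ 2 μ →L[ℂ] Lp ℂ 2 μ)}

/-- Conjugation by signs multiplies the kernel by `signFn D x * signFn D' y`, which commutes with
multiplication by `φ`. Rank one operators lie in `S² ∩ S^p`, so `T` is determined on them by the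
kernel. -/
lemma ExtendsSchur.map_signMul_rankOne (hT : ExtendsSchur μ p φ T) (hp : 1 ≤ p)
    (hφ : MemLp φ ∞ (μ.prod μ)) {D D' : Set X} (hD : MeasurableSet D) (hD' : MeasurableSet D')
    (f g : Lp ℂ 2 μ) :
    T (signMul μ hD ∘L rankOne ℂ f g ∘L signMul μ hD') =
      signMul μ hD ∘L T (rankOne ℂ f g) ∘L signMul μ hD' := by
  have hk := hasKernel_rankOne f g
  obtain ⟨B, hB⟩ := exists_hasKernel (hk.1.mul (r := 2) hφ)
  have h2 : (1 : ℝ≥0∞) ≤ 2 := by norm_num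
  rw [hT _ B _ (memSchatten_rankOne h2 f g) (memSchatten_rankOne hp f g) hk hB]
  refine hT _ _ _ ((memSchatten_rankOne h2 f g).conj h2 _ _)
    ((memSchatten_rankOne hp f g).conj hp _ _) (hk.signMul_conj hD hD') ?_
  convert hB.signMul_conj hD hD' using 2 with z
  simp only [Pi.mul_apply]
  ring

end Kernel

/-! ### Bounded linear maps on the Schatten class. -/

section Bounded

variable {H : Type*} [NormedAddCommGroup H] [InnerProductSpace ℂ H] [CompleteSpace H]
  {p : ℝ≥0∞} {C : ℝ≥0} {T : (H →L[ℂ] H) → (H →L[ℂ] H)}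

lemma IsBoundedOnSchatten.schattenReal_le (hT : IsBoundedOnSchatten p C T) (hp : 1 ≤ p)
    {A : H →L[ℂ] H} (hA : MemSchatten p A) :
    schattenReal p (T A) ≤ C * schattenReal p A := by
  have h := ENNReal.toReal_mono
    (ENNReal.mul_ne_top ENNReal.coe_ne_top (hA.schattenNorm_ne_top hp)) (hT.bound A hA)
  rwa [ENNReal.toReal_mul, ENNReal.coe_toReal] at h

lemma isBoundedOnSchatten_of_schattenReal (hp : 1 ≤ p)
    (h1 : ∀ A, MemSchatten p A → MemSchatten p (T A))
    (h2 : ∀ A B, MemSchatten p A → MemSchatten p B → T (A + B) = T A + T B)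
    (h3 : ∀ (c : ℂ) A, MemSchatten p A → T (c • A) = c • T A)
    (h4 : ∀ A, MemSchatten p A → schattenReal p (T A) ≤ C * schattenReal p A) :
    IsBoundedOnSchatten p C T where
  mapsTo := h1
  map_add := h2
  map_smul := h3
  bound A hA := by
    rw [← (h1 A hA).ofReal_schattenReal hp, ← hA.ofReal_schattenReal hp,
      ← ENNReal.ofReal_coe_nnreal, ← ENNReal.ofReal_mul C.coe_nonneg]
    exact ENNReal.ofReal_le_ofReal (h4 A hA)

lemma IsBoundedOnSchatten.map_sub (hT : IsBoundedOnSchatten p C T) (hp : 1 ≤ p)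
    {A B : H →L[ℂ] H} (hA : MemSchatten p A) (hB : MemSchatten p B) : T (A - B) = T A - T B := by
  have h1 := hT.map_smul (-1) B hB
  have h2 := hT.map_add A ((-1 : ℂ) • B) hA (hB.smul hp _)
  rwa [h1, neg_one_smul, neg_one_smul, ← sub_eq_add_neg, ← sub_eq_add_neg] at h2

lemma IsBoundedOnSchatten.map_zero (hT : IsBoundedOnSchatten p C T) (hp : 1 ≤ p) : T 0 = 0 := by
  have := hT.map_smul 0 0 (memSchatten_zero hp)
  simpa using this

lemma IsBoundedOnSchatten.map_sum (hT : IsBoundedOnSchatten p C T) (hp : 1 ≤ p) {ι : Type*}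
    (s : Finset ι) {A : ι → H →L[ℂ] H} (hA : ∀ i, MemSchatten p (A i)) :
    T (∑ i ∈ s, A i) = ∑ i ∈ s, T (A i) := by
  classical
  induction s using Finset.induction_on with
  | empty => simpa using hT.map_zero hp
  | insert i s hi ih =>
    rw [Finset.sum_insert hi, Finset.sum_insert hi, hT.map_add _ _ (hA i)
      (MemSchatten.sum hp s fun j _ => hA j), ih]

/-- A bounded map on the Schatten class commutes with two-sided multiplications by contractions as
soon as it does so on operators of rank one. -/
lemma IsBoundedOnSchatten.map_conj_of_rankOne (hT : IsBoundedOnSchatten p C T) (hp : 1 ≤ p)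
    {V W : H →L[ℂ] H} (hV : ‖V‖ ≤ 1) (hW : ‖W‖ ≤ 1)
    (h : ∀ ξ η, T (V ∘L rankOne ℂ ξ η ∘L W) = V ∘L T (rankOne ℂ ξ η) ∘L W)
    {A : H →L[ℂ] H} (hA : MemSchatten p A) : T (V ∘L A ∘L W) = V ∘L T A ∘L W := by
  have hfin : ∀ B ∈ finiteRank H, T (V ∘L B ∘L W) = V ∘L T B ∘L W := by
    intro B hB
    induction hB using Submodule.span_induction with
    | mem B hB => obtain ⟨ξη, rfl⟩ := hB; exact h _ _
    | zero => simp [hT.map_zero hp]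
    | add B D hB hD ihB ihD =>
      have hBm := memSchatten_of_mem_finiteRank hp hB
      have hDm := memSchatten_of_mem_finiteRank hp hD
      have e : V ∘L (B + D) ∘L W = V ∘L B ∘L W + V ∘L D ∘L W := by ext; simp
      rw [e, hT.map_add _ _ (hBm.conj hp V W) (hDm.conj hp V W), ihB, ihD, hT.map_add _ _ hBm hDm]
      ext; simp
    | smul c B hB ihB =>
      have hBm := memSchatten_of_mem_finiteRank hp hB
      have e : V ∘L (c • B) ∘L W = c • (V ∘L B ∘L W) := by ext; simp
      rw [e, hT.map_smul _ _ (hBm.conj hp V W), ihB, hT.map_smul _ _ hBm]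
      ext; simp
  rw [← sub_eq_zero, ← norm_eq_zero]
  refine le_antisymm (le_of_forall_pos_le_add fun ε hε => ?_) (norm_nonneg _)
  set δ := ε / (2 * (C + 1)) with hδ
  have hδ0 : 0 < δ := by positivity
  obtain ⟨B, hB, hAB⟩ := hA.exists_finiteRank hp hδ0
  have hBm := memSchatten_of_mem_finiteRank hp hB
  have hDm := hA.sub hp hBm
  have hCδ : C * δ ≤ ε / 2 := by
    rw [hδ, mul_div_assoc', div_le_div_iff₀ (by positivity) two_pos]
    nlinarith
  -- The defect of commutation vanishes on the finite rank `B`, so only `A - B` contributes; its two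
  -- terms are small in operator norm because they are small in `S^p`.
  have e1 : T (V ∘L A ∘L W) - V ∘L T A ∘L W =
      T (V ∘L (A - B) ∘L W) - V ∘L T (A - B) ∘L W := by
    have : V ∘L (A - B) ∘L W = V ∘L A ∘L W - V ∘L B ∘L W := by ext; simp
    rw [this, hT.map_sub hp (hA.conj hp V W) (hBm.conj hp V W), hfin B hB,
      hT.map_sub hp hA hBm]
    ext; simp
  have hconj : ∀ {D : H →L[ℂ] H}, ‖V ∘L D ∘L W‖ ≤ ‖D‖ := fun {D} =>
    calc _ ≤ ‖V‖ * (‖D‖ * ‖W‖) := (ContinuousLinearMap.opNorm_comp_le _ _).trans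
          (by gcongr; exact ContinuousLinearMap.opNorm_comp_le _ _)
      _ ≤ 1 * (‖D‖ * 1) := by gcongr
      _ = ‖D‖ := by ring
  have b1 : ‖T (V ∘L (A - B) ∘L W)‖ ≤ ε / 2 := by
    refine ((hT.mapsTo _ (hDm.conj hp V W)).norm_le hp).trans ?_
    refine (hT.schattenReal_le hp (hDm.conj hp V W)).trans (le_trans ?_ hCδ)
    gcongr
    have := schattenReal_conj_le_of_le hp hDm hV hW
    linarith
  have b2 : ‖V ∘L T (A - B) ∘L W‖ ≤ ε / 2 := by
    refine hconj.trans (((hT.mapsTo _ hDm).norm_le hp).trans ?_)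
    refine (hT.schattenReal_le hp hDm).trans (le_trans ?_ hCδ)
    gcongr
  rw [e1, zero_add]
  refine (norm_sub_le _ _).trans ?_
  linarith

end Bounded

/-! ### Block decompositions and the operator `V` built from signs. -/

section Blocks

variable {H : Type*} [NormedAddCommGroup H] [InnerProductSpace ℂ H] [CompleteSpace H]
  {L : Type*} [NormedAddCommGroup L] [InnerProductSpace ℂ L] [CompleteSpace L]
  {p : ℝ≥0∞} {C : ℝ≥0} {T : (H →L[ℂ] H) → (H →L[ℂ] H)} {I : Type*}

/-- The `ι i` are isometries with pairwise orthogonal ranges. -/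
def OrthogonalCopies (ι : I → H →L[ℂ] L) : Prop :=
  (∀ i x, (adjoint (ι i)) (ι i x) = x) ∧ ∀ i j, i ≠ j → ∀ x, (adjoint (ι i)) (ι j x) = 0

/-- The projection onto the sum of the copies indexed by `F`. -/
def copiesProj (ι : I → H →L[ℂ] L) (F : Finset I) : L →L[ℂ] L :=
  ∑ i ∈ F, ι i ∘L (adjoint (ι i))

/-- The map `T` applied to each block of an operator with respect to the copies indexed by `F`. -/
def blockMap (T : (H →L[ℂ] H) → (H →L[ℂ] H)) (ι : I → H →L[ℂ] L) (F : Finset I)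
    (Z : L →L[ℂ] L) : L →L[ℂ] L :=
  ∑ i ∈ F, ∑ j ∈ F, ι i ∘L T ((adjoint (ι i)) ∘L Z ∘L ι j) ∘L (adjoint (ι j))

variable {ι : I → H →L[ℂ] L}

lemma copiesProj_apply (F : Finset I) (x : L) : copiesProj ι F x = ∑ i ∈ F, ι i ((adjoint (ι i)) x) := by
  simp [copiesProj, sum_apply]

lemma isSelfAdjoint_copiesProj (F : Finset I) : IsSelfAdjoint (copiesProj ι F) := by
  rw [ContinuousLinearMap.isSelfAdjoint_iff_isSymmetric]
  intro x y
  change inner ℂ (copiesProj ι F x) y = inner ℂ x (copiesProj ι F y)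
  simp only [copiesProj_apply, sum_inner, inner_sum]
  refine Finset.sum_congr rfl fun i _ => ?_
  rw [← ContinuousLinearMap.adjoint_inner_right, ContinuousLinearMap.adjoint_inner_left]

lemma OrthogonalCopies.norm_le_one (hι : OrthogonalCopies ι) (i : I) : ‖ι i‖ ≤ 1 := by
  refine ContinuousLinearMap.opNorm_le_bound _ zero_le_one fun x => ?_
  have h : ‖ι i x‖ ^ 2 = ‖x‖ ^ 2 := by
    rw [norm_sq_eq_re_inner (𝕜 := ℂ), norm_sq_eq_re_inner (𝕜 := ℂ),
      ← ContinuousLinearMap.adjoint_inner_right, hι.1]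
  rw [one_mul]
  exact ((pow_left_inj₀ (norm_nonneg _) (norm_nonneg _) two_ne_zero).mp h).le

lemma OrthogonalCopies.adjoint_copiesProj_of_mem (hι : OrthogonalCopies ι) {F : Finset I} {i : I}
    (hi : i ∈ F) (x : L) : (adjoint (ι i)) (copiesProj ι F x) = (adjoint (ι i)) x := by
  rw [copiesProj_apply, map_sum, Finset.sum_eq_single_of_mem i hi
    fun j _ hj => hι.2 i j hj.symm _, hι.1]

lemma OrthogonalCopies.adjoint_copiesProj_of_notMem (hι : OrthogonalCopies ι) {F : Finset I}
    {i : I} (hi : i ∉ F) (x : L) : (adjoint (ι i)) (copiesProj ι F x) = 0 := by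
  rw [copiesProj_apply, map_sum]
  exact Finset.sum_eq_zero fun j hj => hι.2 i j (fun h => hi (h ▸ hj)) _

lemma OrthogonalCopies.copiesProj_comp_of_mem (hι : OrthogonalCopies ι) {F : Finset I} {i : I}
    (hi : i ∈ F) (x : H) : copiesProj ι F (ι i x) = ι i x := by
  rw [copiesProj_apply, Finset.sum_eq_single_of_mem i hi
    fun j _ hj => by rw [hι.2 j i hj, map_zero], hι.1]

lemma OrthogonalCopies.copiesProj_comp_of_notMem (hι : OrthogonalCopies ι) {F : Finset I} {i : I}
    (hi : i ∉ F) (x : H) : copiesProj ι F (ι i x) = 0 := by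
  rw [copiesProj_apply]
  exact Finset.sum_eq_zero fun j hj => by rw [hι.2 j i fun h => hi (h ▸ hj), map_zero]

lemma OrthogonalCopies.copiesProj_idem (hι : OrthogonalCopies ι) (F : Finset I) (x : L) :
    copiesProj ι F (copiesProj ι F x) = copiesProj ι F x := by
  rw [copiesProj_apply F (copiesProj ι F x), copiesProj_apply F x]
  exact Finset.sum_congr rfl fun i hi => by
    rw [← copiesProj_apply F x, hι.adjoint_copiesProj_of_mem hi]

lemma OrthogonalCopies.norm_copiesProj_le (hι : OrthogonalCopies ι) (F : Finset I) :
    ‖copiesProj ι F‖ ≤ 1 := by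
  refine ContinuousLinearMap.opNorm_le_bound _ zero_le_one fun x => ?_
  rw [one_mul]
  have h : ‖copiesProj ι F x‖ ^ 2 ≤ ‖copiesProj ι F x‖ * ‖x‖ := by
    rw [norm_sq_eq_re_inner (𝕜 := ℂ), ← ContinuousLinearMap.adjoint_inner_left,
      ContinuousLinearMap.isSelfAdjoint_iff'.mp (isSelfAdjoint_copiesProj F),
      hι.copiesProj_idem]
    exact (RCLike.re_le_norm _).trans (norm_inner_le_norm _ _)
  by_contra! hlt
  nlinarith [norm_nonneg x]

lemma memSchatten_blockMap (hT : IsBoundedOnSchatten p C T) (hp : 1 ≤ p) (F : Finset I)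
    {Z : L →L[ℂ] L} (hZ : MemSchatten p Z) : MemSchatten p (blockMap T ι F Z) :=
  MemSchatten.sum hp _ fun _ _ => MemSchatten.sum hp _ fun _ _ =>
    (hT.mapsTo _ (hZ.conj hp _ _)).conj hp _ _

lemma blockMap_add (hT : IsBoundedOnSchatten p C T) (hp : 1 ≤ p) (F : Finset I)
    {Z W : L →L[ℂ] L} (hZ : MemSchatten p Z) (hW : MemSchatten p W) :
    blockMap T ι F (Z + W) = blockMap T ι F Z + blockMap T ι F W := by
  simp only [blockMap, ← Finset.sum_add_distrib]
  refine Finset.sum_congr rfl fun i _ => Finset.sum_congr rfl fun j _ => ?_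
  rw [ContinuousLinearMap.add_comp, ContinuousLinearMap.comp_add,
    hT.map_add _ _ (hZ.conj hp _ _) (hW.conj hp _ _),
    ContinuousLinearMap.add_comp, ContinuousLinearMap.comp_add]

lemma blockMap_smul (hT : IsBoundedOnSchatten p C T) (hp : 1 ≤ p) (F : Finset I) (c : ℂ)
    {Z : L →L[ℂ] L} (hZ : MemSchatten p Z) :
    blockMap T ι F (c • Z) = c • blockMap T ι F Z := by
  simp only [blockMap, Finset.smul_sum]
  refine Finset.sum_congr rfl fun i _ => Finset.sum_congr rfl fun j _ => ?_
  rw [ContinuousLinearMap.smul_comp, ContinuousLinearMap.comp_smul,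
    hT.map_smul _ _ (hZ.conj hp _ _),
    ContinuousLinearMap.smul_comp, ContinuousLinearMap.comp_smul]

/-- Compression leaves the blocks in `F` alone and makes the others zero. This makes the block maps
for different finite sets comparable. -/
lemma OrthogonalCopies.blockMap_compress (hι : OrthogonalCopies ι) (hT0 : T 0 = 0)
    {F G : Finset I} (hFG : F ⊆ G) (Z : L →L[ℂ] L) :
    blockMap T ι G (copiesProj ι F ∘L Z ∘L copiesProj ι F) = blockMap T ι F Z := by
  unfold blockMap
  refine (Finset.sum_subset hFG fun i _ hi => Finset.sum_eq_zero fun j _ => ?_).symm.trans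
    (Finset.sum_congr rfl fun i hi => ?_)
  · have : (adjoint (ι i)) ∘L (copiesProj ι F ∘L Z ∘L copiesProj ι F) ∘L ι j = 0 := by
      ext x
      exact hι.adjoint_copiesProj_of_notMem hi _
    rw [this, hT0]; simp
  · refine (Finset.sum_subset hFG fun j _ hj => ?_).symm.trans
      (Finset.sum_congr rfl fun j hj => ?_)
    · have : (adjoint (ι i)) ∘L (copiesProj ι F ∘L Z ∘L copiesProj ι F) ∘L ι j = 0 := by
        ext x
        simp [hι.copiesProj_comp_of_notMem hj]
      rw [this, hT0]; simp
    · congr 3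
      ext x
      simp only [ContinuousLinearMap.comp_apply]
      rw [hι.copiesProj_comp_of_mem hj, hι.adjoint_copiesProj_of_mem hi]

lemma OrthogonalCopies.copiesProj_blockMap (hι : OrthogonalCopies ι) (F : Finset I)
    (Z : L →L[ℂ] L) :
    copiesProj ι F ∘L blockMap T ι F Z ∘L copiesProj ι F = blockMap T ι F Z := by
  ext x
  simp only [blockMap, ContinuousLinearMap.comp_apply, sum_apply, map_sum]
  refine Finset.sum_congr rfl fun i hi => Finset.sum_congr rfl fun j hj => ?_
  rw [hι.adjoint_copiesProj_of_mem hj, hι.copiesProj_comp_of_mem hi]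

/-- The operator `∑ R i ∘ (adjoint (ι i))` from `L` to `H`. -/
def signedSum (ι : I → H →L[ℂ] L) (R : I → H →L[ℂ] H) (F : Finset I) : L →L[ℂ] H :=
  ∑ i ∈ F, R i ∘L (adjoint (ι i))

lemma signedSum_apply (R : I → H →L[ℂ] H) (F : Finset I) (x : L) :
    signedSum ι R F x = ∑ i ∈ F, R i ((adjoint (ι i)) x) := by
  simp [signedSum, sum_apply]

lemma adjoint_signedSum_apply {R : I → H →L[ℂ] H} (hR : ∀ i, IsSelfAdjoint (R i)) (F : Finset I)
    (x : H) : (adjoint (signedSum ι R F)) x = ∑ i ∈ F, ι i (R i x) := by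
  refine ext_inner_right ℂ fun y => ?_
  rw [ContinuousLinearMap.adjoint_inner_left, signedSum_apply, inner_sum, sum_inner]
  refine Finset.sum_congr rfl fun i _ => ?_
  rw [← ContinuousLinearMap.adjoint_inner_left, ContinuousLinearMap.isSelfAdjoint_iff'.mp (hR i),
    ContinuousLinearMap.adjoint_inner_right]

/-- A crude bound suffices: it only multiplies errors that tend to zero while `F` is fixed. -/
lemma OrthogonalCopies.norm_signedSum_le (hι : OrthogonalCopies ι) {R : I → H →L[ℂ] H}
    (hR : ∀ i, ‖R i‖ ≤ 1) (F : Finset I) : ‖signedSum ι R F‖ ≤ F.card := by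
  refine (norm_sum_le _ _).trans ?_
  refine (Finset.sum_le_sum (g := fun _ => (1 : ℝ)) fun i _ => ?_).trans (by simp)
  refine (ContinuousLinearMap.opNorm_comp_le _ _).trans ?_
  rw [LinearIsometryEquiv.norm_map]
  exact mul_le_one₀ (hR i) (norm_nonneg _) (hι.norm_le_one i)

/-- `T` commutes with conjugation by `V = signedSum ι R F`. -/
lemma OrthogonalCopies.map_signedSum_conj (hι : OrthogonalCopies ι)
    (hT : IsBoundedOnSchatten p C T) (hp : 1 ≤ p) {R : I → H →L[ℂ] H}
    (hR : ∀ i, IsSelfAdjoint (R i))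
    (hRT : ∀ i j A, MemSchatten p A → T (R i ∘L A ∘L R j) = R i ∘L T A ∘L R j) (F : Finset I)
    {Z : L →L[ℂ] L} (hZ : MemSchatten p Z) :
    T (signedSum ι R F ∘L Z ∘L (adjoint (signedSum ι R F))) =
      signedSum ι R F ∘L blockMap T ι F Z ∘L (adjoint (signedSum ι R F)) := by
  -- Each block of `Z` appears between `R i` and `R j`, through which `T` passes by `hRT`.
  have h1 : signedSum ι R F ∘L Z ∘L (adjoint (signedSum ι R F)) =
      ∑ i ∈ F, ∑ j ∈ F, R i ∘L ((adjoint (ι i)) ∘L Z ∘L ι j) ∘L R j := by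
    ext x
    simp only [ContinuousLinearMap.comp_apply, adjoint_signedSum_apply hR, signedSum_apply,
      sum_apply, map_sum]
    exact Finset.sum_comm
  have hm : ∀ i j, MemSchatten p (R i ∘L ((adjoint (ι i)) ∘L Z ∘L ι j) ∘L R j) := fun i j =>
    (hZ.conj hp _ _).conj hp _ _
  rw [h1, hT.map_sum hp _ fun i => MemSchatten.sum hp _ fun j _ => hm i j]
  simp_rw [hT.map_sum hp F fun j => hm _ j, hRT _ _ _ (hZ.conj hp _ _)]
  have hV : ∀ i ∈ F, ∀ x, signedSum ι R F (ι i x) = R i x := fun i hi x => by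
    rw [signedSum_apply, Finset.sum_eq_single_of_mem i hi
      fun j _ hj => by rw [hι.2 j i hj, map_zero], hι.1]
  have hV' : ∀ i ∈ F, ∀ x, (adjoint (ι i)) ((adjoint (signedSum ι R F)) x) = R i x := fun i hi x => by
    rw [adjoint_signedSum_apply hR, map_sum, Finset.sum_eq_single_of_mem i hi
      fun j _ hj => hι.2 i j hj.symm _, hι.1]
  ext x
  simp only [blockMap, ContinuousLinearMap.comp_apply, sum_apply, map_sum]
  refine Finset.sum_congr rfl fun i hi => Finset.sum_congr rfl fun j hj => ?_
  rw [hV i hi, hV' j hj]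

/-- `T` commutes with a supply of self-adjoint unitaries, finitely many of which can be chosen
nearly orthogonal to each other when tested on finitely many vectors. -/
def CommutesWithSigns (I : Type*) (p : ℝ≥0∞) (T : (H →L[ℂ] H) → (H →L[ℂ] H)) : Prop :=
  ∀ (F : Finset I) (S : Finset H) (ε : ℝ), 0 < ε → ∃ R : I → H →L[ℂ] H,
    (∀ i, ‖R i‖ ≤ 1) ∧ (∀ i, IsSelfAdjoint (R i)) ∧ (∀ i x, R i (R i x) = x) ∧
    (∀ i j A, MemSchatten p A → T (R i ∘L A ∘L R j) = R i ∘L T A ∘L R j) ∧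
    ∀ i ∈ F, ∀ j ∈ F, i ≠ j → ∀ f ∈ S, ∀ g ∈ S, ‖inner ℂ (R i f) (R j g)‖ < ε

/-- Since each `R i` is a self-adjoint involution, the diagonal terms add up exactly to `⟨x,
copiesProj ι F y⟩`; only the small off-diagonal terms remain. -/
lemma norm_inner_signedSum_sub_le {R : I → H →L[ℂ] H} (hR : ∀ i, IsSelfAdjoint (R i))
    (hRR : ∀ i x, R i (R i x) = x) (F : Finset I) {S : Finset H} {ε : ℝ}
    (hε : 0 < ε)
    (h : ∀ i ∈ F, ∀ j ∈ F, i ≠ j → ∀ f ∈ S, ∀ g ∈ S, ‖inner ℂ (R i f) (R j g)‖ < ε) {x y : L}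
    (hx : ∀ i ∈ F, (adjoint (ι i)) x ∈ S) (hy : ∀ i ∈ F, (adjoint (ι i)) y ∈ S) :
    ‖inner ℂ (signedSum ι R F x) (signedSum ι R F y) - inner ℂ x (copiesProj ι F y)‖ ≤
      F.card ^ 2 * ε := by
  classical
  have h1 : inner ℂ (signedSum ι R F x) (signedSum ι R F y) - inner ℂ x (copiesProj ι F y) =
      ∑ i ∈ F, ∑ j ∈ F, if i = j then 0 else inner ℂ (R i ((adjoint (ι i)) x)) (R j ((adjoint (ι j)) y)) := by
    rw [signedSum_apply, signedSum_apply, copiesProj_apply, sum_inner, inner_sum,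
      ← Finset.sum_sub_distrib]
    refine Finset.sum_congr rfl fun i hi => ?_
    rw [inner_sum, sub_eq_iff_eq_add, ← Finset.add_sum_erase F _ hi,
      ← Finset.add_sum_erase F (fun j => if i = j then 0 else _) hi, if_pos rfl, zero_add, add_comm]
    congr 1
    · refine Finset.sum_congr rfl fun j hj => ?_
      rw [if_neg (Finset.ne_of_mem_erase hj).symm]
    · rw [← ContinuousLinearMap.adjoint_inner_right,
        ContinuousLinearMap.isSelfAdjoint_iff'.mp (hR i), hRR,
        ContinuousLinearMap.adjoint_inner_left]
  rw [h1]
  have h2 : ∀ i ∈ F, ∀ j ∈ F,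
      ‖if i = j then (0 : ℂ) else inner ℂ (R i ((adjoint (ι i)) x)) (R j ((adjoint (ι j)) y))‖ ≤ ε := by
    intro i hi j hj
    split_ifs with hij
    · simpa using hε.le
    · exact (h i hi j hj hij _ (hx i hi) _ (hy j hj)).le
  calc _ ≤ ∑ i ∈ F, ∑ j ∈ F, ε := (norm_sum_le _ _).trans (Finset.sum_le_sum fun i hi =>
        (norm_sum_le _ _).trans (Finset.sum_le_sum fun j hj => h2 i hi j hj))
    _ = _ := by simp; ring

/-- For suitable signs, `V = signedSum ι R F` is nearly isometric on a given finite dimensional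
subspace. -/
lemma CommutesWithSigns.exists_nearly_isometric (hS : CommutesWithSigns I p T) (F : Finset I)
    (E : Submodule ℂ L) [FiniteDimensional ℂ E] (hE : ∀ x ∈ E, copiesProj ι F x = x) {δ : ℝ}
    (hδ : 0 < δ) : ∃ R : I → H →L[ℂ] H, (∀ i, ‖R i‖ ≤ 1) ∧ (∀ i, IsSelfAdjoint (R i)) ∧
      (∀ i j A, MemSchatten p A → T (R i ∘L A ∘L R j) = R i ∘L T A ∘L R j) ∧
      ‖E.starProjection ∘L ((adjoint (signedSum ι R F)) ∘L signedSum ι R F) ∘L E.starProjection -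
        E.starProjection‖ ≤ δ := by
  classical
  let u := stdOrthonormalBasis ℂ E
  set n := Module.finrank ℂ E
  -- The compression of `V* V - 1` to `E` has `n ^ 2` matrix entries, each at most `F.card ^ 2 * ε`.
  set K : ℝ := (n : ℝ) ^ 2 * (F.card : ℝ) ^ 2 with hK
  have hK0 : 0 ≤ K := by positivity
  set ε := δ / (K + 1) with hε
  have hε0 : 0 < ε := by positivity
  set S : Finset H := (Finset.univ ×ˢ F).image fun ai => (adjoint (ι ai.2)) (u ai.1 : L) with hSdef
  have hmem : ∀ a, ∀ i ∈ F, (adjoint (ι i)) (u a : L) ∈ S := fun a i hi =>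
    Finset.mem_image.mpr ⟨(a, i), by simp [hi], rfl⟩
  obtain ⟨R, hR1, hR2, hR3, hR4, hR5⟩ := hS F S ε hε0
  refine ⟨R, hR1, hR2, hR4, ?_⟩
  set V := signedSum ι R F
  set P := E.starProjection
  have hP : P = ∑ a, rankOne ℂ (u a : L) (u a : L) := u.starProjection_eq_sum_rankOne
  have hPP : P ∘L P = P := by
    ext x; exact Submodule.starProjection_eq_self_iff.mpr (Submodule.starProjection_apply_mem E x)
  have h1 : P ∘L ((adjoint V) ∘L V) ∘L P - P = P ∘L ((adjoint V) ∘L V - ContinuousLinearMap.id ℂ L) ∘L P := by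
    conv_lhs => rw [← hPP]
    ext x
    have hx : ∀ y, P (P y) = P y := fun y => congrArg (fun B : L →L[ℂ] L => B y) hPP
    simp [hx]
  have h2 : P ∘L ((adjoint V) ∘L V - ContinuousLinearMap.id ℂ L) ∘L P = ∑ a, ∑ b,
      inner ℂ (u a : L) (((adjoint V) ∘L V - ContinuousLinearMap.id ℂ L) (u b : L)) •
        rankOne ℂ (u a : L) (u b : L) := by
    have hPx : ∀ x, P x = ∑ a, inner ℂ (u a : L) x • (u a : L) := fun x => by
      simp [hP, sum_apply, rankOne_apply]
    ext x
    rw [ContinuousLinearMap.comp_apply, ContinuousLinearMap.comp_apply, hPx, hPx x, sum_apply]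
    refine Finset.sum_congr rfl fun a _ => ?_
    rw [sum_apply, map_sum, inner_sum, Finset.sum_smul]
    refine Finset.sum_congr rfl fun b _ => ?_
    rw [map_smul, inner_smul_right, smul_apply, rankOne_apply, smul_smul, mul_comm]
  have h3 : ∀ a b, ‖inner ℂ (u a : L) (((adjoint V) ∘L V - ContinuousLinearMap.id ℂ L) (u b : L)) •
        rankOne ℂ (u a : L) (u b : L)‖ ≤ F.card ^ 2 * ε := by
    intro a b
    have hn : ∀ a, ‖(u a : L)‖ = 1 := fun a => u.orthonormal.1 a
    rw [norm_smul, norm_rankOne, hn, hn, mul_one, mul_one, sub_apply, inner_sub_right,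
      ContinuousLinearMap.comp_apply, ContinuousLinearMap.adjoint_inner_right]
    have := norm_inner_signedSum_sub_le hR2 hR3 F hε0 hR5 (hmem a) (hmem b)
    rwa [hE _ (u b).2] at this
  rw [h1, h2]
  calc _ ≤ ∑ _a : Fin n, ∑ _b : Fin n, (F.card : ℝ) ^ 2 * ε := (norm_sum_le _ _).trans
        (Finset.sum_le_sum fun a _ => (norm_sum_le _ _).trans
          (Finset.sum_le_sum fun b _ => h3 a b))
    _ = K * ε := by simp [hK]; ring
    _ ≤ δ := by rw [hε, mul_div_assoc', div_le_iff₀ (by positivity)]; nlinarith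

end Blocks

/-! ### The norm bound for finitely many blocks. -/

section FiniteBlocks

variable {H : Type*} [NormedAddCommGroup H] [InnerProductSpace ℂ H] [CompleteSpace H]
  {L : Type*} [NormedAddCommGroup L] [InnerProductSpace ℂ L] [CompleteSpace L]
  {p : ℝ≥0∞} {C : ℝ≥0} {T : (H →L[ℂ] H) → (H →L[ℂ] H)} {I : Type*} {ι : I → H →L[ℂ] L}

/-- An operator which lives on the range of a projection `Q` is approximated in `S^p` by its
compressions to finite dimensional subspaces of the range of `Q`. -/
lemma exists_finiteDimensional_compression (hp : 1 ≤ p) {Q : L →L[ℂ] L} (hQ : IsSelfAdjoint Q)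
    (hQ1 : ‖Q‖ ≤ 1) (hQQ : ∀ x, Q (Q x) = Q x) {Z Y : L →L[ℂ] L} (hZ : MemSchatten p Z)
    (hY : MemSchatten p Y) (hZQ : Q ∘L Z ∘L Q = Z) (hYQ : Q ∘L Y ∘L Q = Y) {ε : ℝ}
    (hε : 0 < ε) : ∃ E : Submodule ℂ L, ∃ _ : FiniteDimensional ℂ E, (∀ x ∈ E, Q x = x) ∧
      schattenReal p (E.starProjection ∘L Z ∘L E.starProjection - Z) ≤ ε ∧
      schattenReal p (E.starProjection ∘L Y ∘L E.starProjection - Y) ≤ ε := by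
  classical
  let E : Finset L → Submodule ℂ L := fun s => Submodule.span ℂ (Q '' s)
  have hfin : ∀ s, FiniteDimensional ℂ (E s) := fun s =>
    FiniteDimensional.span_of_finite ℂ (s.finite_toSet.image _)
  have hEQ : ∀ s, ∀ x ∈ E s, Q x = x := fun s x hx => by
    induction hx using Submodule.span_induction with
    | mem x hx => obtain ⟨y, -, rfl⟩ := hx; exact hQQ y
    | zero => simp
    | add x y _ _ h1 h2 => rw [map_add, h1, h2]
    | smul c x _ h => rw [map_smul, h]
  have hlim : ∀ x, Tendsto (fun s => (E s).starProjection x) atTop (𝓝 (Q x)) := fun x => by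
    refine tendsto_const_nhds.congr' ?_
    filter_upwards [eventually_ge_atTop {x}] with s hs
    refine (Submodule.eq_starProjection_of_mem_of_inner_eq_zero
      (Submodule.subset_span
        (Set.mem_image_of_mem Q (Finset.mem_coe.mpr (hs (Finset.mem_singleton_self x))))) fun y hy => ?_).symm
    rw [inner_sub_left, ← hEQ s y hy, ← ContinuousLinearMap.adjoint_inner_left,
      ← ContinuousLinearMap.adjoint_inner_left, ContinuousLinearMap.isSelfAdjoint_iff'.mp hQ,
      hQQ, sub_self]
  have key : ∀ {W : L →L[ℂ] L}, MemSchatten p W → Q ∘L W ∘L Q = W → ∀ᶠ s in atTop,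
      schattenReal p ((E s).starProjection ∘L W ∘L (E s).starProjection - W) < ε :=
    fun {W} hW hWQ => by
      have := hW.tendsto_schattenReal_conj_sub hp (fun s => isSelfAdjoint_starProjection (E s))
        hQ (fun s => (E s).starProjection_norm_le) hQ1 hlim
      rw [hWQ] at this
      exact this.eventually_lt_const hε
  obtain ⟨s, h1, h2⟩ := ((key hZ hZQ).and (key hY hYQ)).exists
  exact ⟨E s, hfin s, hEQ s, h1.le, h2.le⟩

/-- The C*-identity gives `‖V P‖ ^ 2 = ‖P V* V P‖ ≤ 1 + δ`. -/
lemma norm_comp_projection_le {V : L →L[ℂ] H} {P : L →L[ℂ] L} (hP : IsSelfAdjoint P)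
    (hP1 : ‖P‖ ≤ 1) {δ : ℝ} (hδ : 0 ≤ δ) (h : ‖P ∘L (adjoint V ∘L V) ∘L P - P‖ ≤ δ) :
    ‖V ∘L P‖ ≤ 1 + δ := by
  have h1 : ‖V ∘L P‖ * ‖V ∘L P‖ ≤ 1 + δ := by
    rw [← ContinuousLinearMap.norm_adjoint_comp_self, ContinuousLinearMap.adjoint_comp,
      ContinuousLinearMap.isSelfAdjoint_iff'.mp hP]
    calc ‖(P ∘L adjoint V) ∘L (V ∘L P)‖ = ‖(P ∘L (adjoint V ∘L V) ∘L P - P) + P‖ := by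
          rw [sub_add_cancel]; rfl
      _ ≤ _ := (norm_add_le _ _).trans (by linarith)
  nlinarith [norm_nonneg (V ∘L P)]

/-- With `G = P V* V P` close to `P`, the operator `G Y G` is `V (P Y P) V*` conjugated by `V P`;
replacing `P Y P` by `G Y G` costs `(δ + (1 + δ) * δ) ‖Y‖_p`. -/
lemma schattenReal_le_of_nearly_isometric (hp : 1 ≤ p) {V : L →L[ℂ] H} {P : L →L[ℂ] L}
    (hP : IsSelfAdjoint P) (hP1 : ‖P‖ ≤ 1) {δ : ℝ} (hδ : 0 ≤ δ)
    (h : ‖P ∘L (adjoint V ∘L V) ∘L P - P‖ ≤ δ) {Y : L →L[ℂ] L} (hY : MemSchatten p Y) :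
    schattenReal p (P ∘L Y ∘L P) ≤ (1 + δ) ^ 2 *
      schattenReal p (V ∘L (P ∘L Y ∘L P) ∘L adjoint V) + (2 * δ + δ ^ 2) * schattenReal p Y := by
  set G := P ∘L (adjoint V ∘L V) ∘L P with hG
  have hVP := norm_comp_projection_le hP hP1 hδ h
  have hG1 : ‖G‖ ≤ 1 + δ := by
    have : G = (G - P) + P := by abel
    rw [this]; exact (norm_add_le _ _).trans (by linarith)
  have hPG : ‖P - G‖ ≤ δ := by rwa [norm_sub_rev]
  have e1 : P ∘L Y ∘L P = G ∘L Y ∘L G + ((P - G) ∘L Y ∘L P + G ∘L Y ∘L (P - G)) := by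
    ext x; simp
  have e2 : G ∘L Y ∘L G =
      adjoint (V ∘L P) ∘L (V ∘L (P ∘L Y ∘L P) ∘L adjoint V) ∘L (V ∘L P) := by
    rw [ContinuousLinearMap.adjoint_comp, ContinuousLinearMap.isSelfAdjoint_iff'.mp hP]
    rfl
  have hm : MemSchatten p (V ∘L (P ∘L Y ∘L P) ∘L adjoint V) := (hY.conj hp _ _).conj hp _ _
  have h1 : schattenReal p (G ∘L Y ∘L G) ≤
      (1 + δ) * schattenReal p (V ∘L (P ∘L Y ∘L P) ∘L adjoint V) * (1 + δ) := by
    rw [e2]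
    exact schattenReal_conj_le_of_le hp hm (by rwa [LinearIsometryEquiv.norm_map]) hVP
  have h2 := schattenReal_conj_le_of_le hp hY hPG hP1
  have h3 := schattenReal_conj_le_of_le hp hY hG1 hPG
  have h4 := schattenReal_add_le hp (hY.conj hp G G)
    ((hY.conj hp (P - G) P).add hp (hY.conj hp G (P - G)))
  have h5 := schattenReal_add_le hp (hY.conj hp (P - G) P) (hY.conj hp G (P - G))
  rw [← e1] at h4
  nlinarith

lemma schattenReal_conj_signedSum_le (hι : OrthogonalCopies ι) (hp : 1 ≤ p)
    {R : I → H →L[ℂ] H} (hR : ∀ i, ‖R i‖ ≤ 1) (F : Finset I) {W : L →L[ℂ] L}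
    (hW : MemSchatten p W) {ε : ℝ} (h : schattenReal p W ≤ ε) :
    schattenReal p (signedSum ι R F ∘L W ∘L adjoint (signedSum ι R F)) ≤ F.card ^ 2 * ε := by
  have h1 := hι.norm_signedSum_le hR F
  have h1' : ‖adjoint (signedSum ι R F)‖ ≤ F.card := by rwa [LinearIsometryEquiv.norm_map]
  have h2 := schattenReal_conj_le_of_le hp hW h1 h1'
  nlinarith [mul_le_mul_of_nonneg_left h (sq_nonneg (F.card : ℝ))]

/-- Applying `T` to finitely many blocks does not increase the norm on `S^p`. -/
lemma OrthogonalCopies.schattenReal_blockMap_le (hι : OrthogonalCopies ι)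
    (hT : IsBoundedOnSchatten p C T) (hp : 1 ≤ p) (hS : CommutesWithSigns I p T) (F : Finset I)
    {Z : L →L[ℂ] L} (hZ : MemSchatten p Z) :
    schattenReal p (blockMap T ι F Z) ≤ C * schattenReal p Z := by
  set Q := copiesProj ι F with hQdef
  have hQ1 := hι.norm_copiesProj_le F
  -- The block map sees only the compression by `Q`, which does not increase the norm.
  suffices h : ∀ Z, MemSchatten p Z → Q ∘L Z ∘L Q = Z →
      schattenReal p (blockMap T ι F Z) ≤ C * schattenReal p Z by
    have h1 := h (Q ∘L Z ∘L Q) (hZ.conj hp _ _) (by ext x; simp [hQdef, hι.copiesProj_idem])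
    rw [hι.blockMap_compress (hT.map_zero hp) subset_rfl] at h1
    have h2 := schattenReal_conj_le_of_le hp hZ hQ1 hQ1
    rw [one_mul, mul_one] at h2
    exact h1.trans (mul_le_mul_of_nonneg_left h2 C.2)
  intro Z hZ hZQ
  set Y := blockMap T ι F Z with hYdef
  have hY : MemSchatten p Y := memSchatten_blockMap hT hp F hZ
  set y := schattenReal p Y
  set z := schattenReal p Z
  set m : ℝ := (F.card : ℝ)
  -- The chain compares `Y` with `P Y P`, then with `V Y V* = T (V Z V*)`, then `V Z V*` with `Z`.
  -- The terms `m ^ 2 * ε` come from conjugating the compression errors by `V`, of norm at most `m`.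
  have key : ∀ ε > 0, y ≤ ε + ((1 + ε) ^ 2 * (C * ((1 + ε) ^ 2 * z + m ^ 2 * ε) + m ^ 2 * ε) +
      (2 * ε + ε ^ 2) * y) := by
    intro ε hε
    obtain ⟨E, hE, hEQ, hZE, hYE⟩ := exists_finiteDimensional_compression hp
      (isSelfAdjoint_copiesProj F) hQ1 (hι.copiesProj_idem F) hZ hY hZQ
      (hι.copiesProj_blockMap F Z) hε
    obtain ⟨R, hR1, hR2, hR3, hV⟩ := hS.exists_nearly_isometric F E hEQ hε
    set P := E.starProjection
    set V := signedSum ι R F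
    have hP : IsSelfAdjoint P := isSelfAdjoint_starProjection E
    have hP1 : ‖P‖ ≤ 1 := E.starProjection_norm_le
    have hPYP := hY.conj hp P P
    have hPZP := hZ.conj hp P P
    have h1 := schattenReal_le_of_nearly_isometric hp hP hP1 hε.le hV hY
    have h2 : y ≤ schattenReal p (P ∘L Y ∘L P) + ε := by
      have := schattenReal_sub_le hp hPYP (hPYP.sub hp hY)
      rw [sub_sub_cancel] at this
      linarith
    have h3 : schattenReal p (V ∘L (P ∘L Y ∘L P) ∘L adjoint V) ≤
        schattenReal p (V ∘L Y ∘L adjoint V) + m ^ 2 * ε := by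
      have h3' := schattenReal_add_le hp (hY.conj hp V (adjoint V))
        ((hPYP.sub hp hY).conj hp V (adjoint V))
      have e : V ∘L Y ∘L adjoint V + V ∘L (P ∘L Y ∘L P - Y) ∘L adjoint V =
          V ∘L (P ∘L Y ∘L P) ∘L adjoint V := by ext x; simp
      rw [e] at h3'
      linarith [schattenReal_conj_signedSum_le hι hp hR1 F (hPYP.sub hp hY) hYE]
    have h4 : schattenReal p (V ∘L Y ∘L adjoint V) ≤ C * schattenReal p (V ∘L Z ∘L adjoint V) := by
      rw [← hι.map_signedSum_conj hT hp hR2 hR3 F hZ]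
      exact hT.schattenReal_le hp (hZ.conj hp _ _)
    have h5 : schattenReal p (V ∘L Z ∘L adjoint V) ≤ (1 + ε) ^ 2 * z + m ^ 2 * ε := by
      have h5' := schattenReal_sub_le hp (hPZP.conj hp V (adjoint V))
        ((hPZP.sub hp hZ).conj hp V (adjoint V))
      have e : V ∘L (P ∘L Z ∘L P) ∘L adjoint V - V ∘L (P ∘L Z ∘L P - Z) ∘L adjoint V =
          V ∘L Z ∘L adjoint V := by ext x; simp
      have e' : V ∘L (P ∘L Z ∘L P) ∘L adjoint V = (V ∘L P) ∘L Z ∘L adjoint (V ∘L P) := by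
        rw [ContinuousLinearMap.adjoint_comp, ContinuousLinearMap.isSelfAdjoint_iff'.mp hP]
        rfl
      have hVP := norm_comp_projection_le hP hP1 hε.le hV
      have hVP' : ‖adjoint (V ∘L P)‖ ≤ 1 + ε := by rwa [LinearIsometryEquiv.norm_map]
      have h6 := schattenReal_conj_le_of_le hp hZ hVP hVP'
      rw [e, e'] at h5'
      linarith [schattenReal_conj_signedSum_le hι hp hR1 F (hPZP.sub hp hZ) hZE]
    have h6 := mul_le_mul_of_nonneg_left h5 C.2
    have h7 := mul_le_mul_of_nonneg_left (h3.trans (add_le_add_left (h4.trans h6) _))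
      (sq_nonneg (1 + ε))
    simp only [NNReal.val_eq_coe] at h7
    linarith
  have hlim : Tendsto (fun ε : ℝ => ε + ((1 + ε) ^ 2 *
      (C * ((1 + ε) ^ 2 * z + m ^ 2 * ε) + m ^ 2 * ε) + (2 * ε + ε ^ 2) * y)) (𝓝[>] 0)
      (𝓝 (C * z)) := by
    have hc : Continuous (fun ε : ℝ => ε + ((1 + ε) ^ 2 *
      (C * ((1 + ε) ^ 2 * z + m ^ 2 * ε) + m ^ 2 * ε) + (2 * ε + ε ^ 2) * y)) := by fun_prop
    have := hc.tendsto 0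
    simp only [add_zero, mul_zero, one_pow, one_mul, zero_add, zero_pow two_ne_zero,
      zero_mul] at this
    exact this.mono_left nhdsWithin_le_nhds
  exact ge_of_tendsto hlim (eventually_mem_nhdsWithin.mono fun ε hε => key ε hε)

end FiniteBlocks

/-! ### Passage to infinitely many blocks. -/

section InfiniteBlocks

variable {H : Type*} [NormedAddCommGroup H] [InnerProductSpace ℂ H] [CompleteSpace H]
  {L : Type*} [NormedAddCommGroup L] [InnerProductSpace ℂ L] [CompleteSpace L]
  {p : ℝ≥0∞} {C : ℝ≥0} {T : (H →L[ℂ] H) → (H →L[ℂ] H)} {I : Type*} {ι : I → H →L[ℂ] L}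

/-- The operator whose blocks are the images under `T` of the blocks of `Z`, as a strong limit
(and `0` if there is no such limit). -/
def amplification (T : (H →L[ℂ] H) → (H →L[ℂ] H)) (ι : I → H →L[ℂ] L) (Z : L →L[ℂ] L) :
    L →L[ℂ] L :=
  open Classical in
  if h : ∃ W : L →L[ℂ] L, ∀ x, Tendsto (fun F => blockMap T ι F Z x) atTop (𝓝 (W x)) then h.choose
  else 0

lemma amplification_eq {Z W : L →L[ℂ] L}
    (h : ∀ x, Tendsto (fun F => blockMap T ι F Z x) atTop (𝓝 (W x))) :
    amplification T ι Z = W := by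
  classical
  have h' : ∃ W : L →L[ℂ] L, ∀ x, Tendsto (fun F => blockMap T ι F Z x) atTop (𝓝 (W x)) := ⟨W, h⟩
  rw [amplification, dif_pos h']
  ext x
  exact tendsto_nhds_unique (h'.choose_spec x) (h x)

lemma amplification_eq_of_tendsto {Z W : L →L[ℂ] L}
    (h : Tendsto (fun F => blockMap T ι F Z) atTop (𝓝 W)) : amplification T ι Z = W :=
  amplification_eq fun x => ((ContinuousLinearMap.apply ℂ L x).continuous.tendsto W).comp h

lemma OrthogonalCopies.tendsto_blockMap (hι : OrthogonalCopies ι)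
    (hι1 : ∀ x, Tendsto (fun F => copiesProj ι F x) atTop (𝓝 x))
    (hT : IsBoundedOnSchatten p C T) (hp : 1 ≤ p) (hS : CommutesWithSigns I p T)
    {Z : L →L[ℂ] L} (hZ : MemSchatten p Z) :
    Tendsto (fun F => blockMap T ι F Z) atTop (𝓝 (amplification T ι Z)) := by
  classical
  suffices h : CauchySeq fun F => blockMap T ι F Z by
    obtain ⟨W, hW⟩ := cauchySeq_tendsto_of_complete h
    rwa [amplification_eq_of_tendsto hW]
  refine Metric.cauchySeq_iff'.mpr fun ε hε => ?_
  have hlim : Tendsto (fun F => C * schattenReal p (copiesProj ι F ∘L Z ∘L copiesProj ι F - Z))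
      atTop (𝓝 0) := by
    have := (hZ.tendsto_schattenReal_conj_sub hp isSelfAdjoint_copiesProj
      (Q := ContinuousLinearMap.id ℂ L) (IsSelfAdjoint.one _) hι.norm_copiesProj_le
      norm_id_le_one hι1).const_mul (C : ℝ)
    simpa using this
  obtain ⟨G, hG⟩ := (hlim.eventually_lt_const hε).exists
  refine ⟨G, fun F hF => ?_⟩
  have hGm := hZ.conj hp (copiesProj ι G) (copiesProj ι G)
  -- For `F ⊇ G` the difference of the two block maps at `Z` is the block map for `F` at the
  -- compression error of `G`, which is uniformly small in `F`.
  have e := blockMap_add hT hp F (ι := ι) (hGm.sub hp hZ) hZ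
  rw [sub_add_cancel, hι.blockMap_compress (hT.map_zero hp) hF] at e
  rw [dist_comm, dist_eq_norm, e, add_sub_cancel_right]
  exact ((memSchatten_blockMap hT hp F (hGm.sub hp hZ)).norm_le hp).trans_lt
    ((hι.schattenReal_blockMap_le hT hp hS F (hGm.sub hp hZ)).trans_lt hG)

lemma OrthogonalCopies.isBoundedOnSchatten_amplification (hι : OrthogonalCopies ι)
    (hι1 : ∀ x, Tendsto (fun F => copiesProj ι F x) atTop (𝓝 x))
    (hT : IsBoundedOnSchatten p C T) (hp : 1 ≤ p) (hS : CommutesWithSigns I p T) :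
    IsBoundedOnSchatten p C (amplification T ι) := by
  have hlim := fun {Z : L →L[ℂ] L} (hZ : MemSchatten p Z) => hι.tendsto_blockMap hι1 hT hp hS hZ
  have hmem : ∀ Z, MemSchatten p Z → MemSchatten p (amplification T ι Z) ∧
      schattenReal p (amplification T ι Z) ≤ C * schattenReal p Z := fun Z hZ =>
    MemSchatten.of_tendsto hp (mul_nonneg C.2 (schattenReal_nonneg _))
      (Eventually.of_forall fun F => ⟨memSchatten_blockMap hT hp F hZ,
        hι.schattenReal_blockMap_le hT hp hS F hZ⟩) (hlim hZ)
  refine isBoundedOnSchatten_of_schattenReal hp (fun Z hZ => (hmem Z hZ).1)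
    (fun Z W hZ hW => amplification_eq_of_tendsto ?_)
    (fun c Z hZ => amplification_eq_of_tendsto ?_) fun Z hZ => (hmem Z hZ).2
  · simp_rw [blockMap_add hT hp _ hZ hW]
    exact (hlim hZ).add (hlim hW)
  · simp_rw [blockMap_smul hT hp _ c hZ]
    exact (hlim hZ).const_smul c

end InfiniteBlocks

/-! ### Hilbert space tensor products and amplifications. -/

section Tensor

variable {H : Type*} [NormedAddCommGroup H] [InnerProductSpace ℂ H]
  {K : Type*} [NormedAddCommGroup K] [InnerProductSpace ℂ K]
  {p : ℝ≥0∞} {C : ℝ≥0} {T : (H →L[ℂ] H) → (H →L[ℂ] H)} {I : Type*}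

/-- The map `x ↦ x ⊗ v` into the Hilbert space tensor product. -/
def tmulRight (H : Type*) [NormedAddCommGroup H] [InnerProductSpace ℂ H] (v : K) :
    H →L[ℂ] HilbertTensor H K :=
  Completion.toComplL ∘L (TensorProduct.mkL ℂ H K).flip v

lemma tmulRight_apply (v : K) (x : H) :
    tmulRight H v x = ((x ⊗ₜ[ℂ] v : H ⊗[ℂ] K) : HilbertTensor H K) := rfl

lemma hilbertTensor_ext {M N : HilbertTensor H K →L[ℂ] HilbertTensor H K}
    (h : ∀ v x, M (tmulRight H v x) = N (tmulRight H v x)) : M = N := by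
  ext z
  induction z using Completion.induction_on with
  | hp => exact isClosed_eq M.continuous N.continuous
  | ih z =>
    induction z using TensorProduct.induction_on with
    | zero => rw [Completion.coe_zero, map_zero, map_zero]
    | tmul x v => exact h v x
    | add z w hz hw => rw [Completion.coe_add, map_add, map_add, hz, hw]

lemma tendsto_of_tendsto_tmulRight {α : Type*} {l : Filter α}
    {P : α → HilbertTensor H K →L[ℂ] HilbertTensor H K} (hP : ∀ k, ‖P k‖ ≤ 1)
    (h : ∀ v x, Tendsto (fun k => P k (tmulRight H v x)) l (𝓝 (tmulRight H v x)))
    (z : HilbertTensor H K) : Tendsto (fun k => P k z) l (𝓝 z) := by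
  have h' : ∀ z : H ⊗[ℂ] K, Tendsto (fun k => P k z) l (𝓝 (z : HilbertTensor H K)) := by
    intro z
    induction z using TensorProduct.induction_on with
    | zero => simp only [Completion.coe_zero, map_zero]; exact tendsto_const_nhds
    | tmul x v => exact h v x
    | add z w hz hw => simpa only [Completion.coe_add, map_add] using hz.add hw
  rw [Metric.tendsto_nhds]
  intro ε hε
  obtain ⟨y, hy⟩ := (Completion.denseRange_coe (α := H ⊗[ℂ] K)).exists_dist_lt z
    (show 0 < ε / 3 by positivity)
  filter_upwards [(Metric.tendsto_nhds.mp (h' y)) (ε / 3) (by positivity)] with k hk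
  have h1 : dist (P k z) (P k y) ≤ dist z y := by
    rw [dist_eq_norm, dist_eq_norm, ← map_sub]
    simpa using (P k).le_of_opNorm_le (hP k) (z - y)
  have h2 := dist_triangle4 (P k z) (P k y) y z
  rw [dist_comm (y : HilbertTensor H K) z] at h2
  linarith

variable [CompleteSpace H]

lemma adjoint_tmulRight_apply (v w : K) (x : H) :
    adjoint (tmulRight H v) (tmulRight H w x) = (inner ℂ v w : ℂ) • x := by
  refine ext_inner_left ℂ fun y => ?_
  rw [ContinuousLinearMap.adjoint_inner_right, tmulRight_apply, tmulRight_apply,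
    Completion.inner_coe, TensorProduct.inner_tmul, inner_smul_right, mul_comm]

omit [CompleteSpace H] in
lemma tensorOp_tmulRight (A : H →L[ℂ] H) (B : K →L[ℂ] K) (v : K) (x : H) :
    tensorOp A B (tmulRight H v x) = tmulRight H (B v) (A x) := by
  rw [tensorOp, tmulRight_apply, ContinuousLinearMap.completion_apply_coe,
    TensorProduct.mapL_tmul, tmulRight_apply]

lemma orthogonalCopies_tmulRight (e : HilbertBasis I ℂ K) :
    OrthogonalCopies fun i => tmulRight H (e i) := by
  classical
  have h := orthonormal_iff_ite.mp e.orthonormal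
  refine ⟨fun i x => ?_, fun i j hij x => ?_⟩
  · rw [adjoint_tmulRight_apply, h, if_pos rfl, one_smul]
  · rw [adjoint_tmulRight_apply, h, if_neg hij, zero_smul]

lemma tendsto_copiesProj_tmulRight (e : HilbertBasis I ℂ K) (z : HilbertTensor H K) :
    Tendsto (fun F => copiesProj (fun i => tmulRight H (e i)) F z) atTop (𝓝 z) := by
  refine tendsto_of_tendsto_tmulRight (orthogonalCopies_tmulRight e).norm_copiesProj_le
    (fun v x => ?_) z
  let J : K →L[ℂ] HilbertTensor H K := Completion.toComplL ∘L TensorProduct.mkL ℂ H K x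
  have h1 : HasSum (fun i => J (inner ℂ (e i) v • e i)) (J v) := by
    simpa only [HilbertBasis.repr_apply_apply] using J.hasSum (e.hasSum_repr v)
  have h2 : Tendsto (fun F : Finset I => ∑ i ∈ F, J (inner ℂ (e i) v • e i)) atTop (𝓝 (J v)) := by
    simpa [HasSum] using h1
  refine h2.congr fun F => ?_
  rw [copiesProj_apply]
  refine Finset.sum_congr rfl fun i _ => ?_
  rw [adjoint_tmulRight_apply, map_smul, map_smul]
  rfl

/-- The blocks of `A ⊗ B` are scalar multiples of `A`, with the matrix entries of `B` as scalars, so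
homogeneity of `T` suffices. -/
lemma blockMap_tensorOp (hT : IsBoundedOnSchatten p C T) (e : HilbertBasis I ℂ K) (F : Finset I)
    {A : H →L[ℂ] H} (hA : MemSchatten p A) (B : K →L[ℂ] K) :
    blockMap T (fun i => tmulRight H (e i)) F (tensorOp A B) =
      copiesProj (fun i => tmulRight H (e i)) F ∘L tensorOp (T A) B ∘L
        copiesProj (fun i => tmulRight H (e i)) F := by
  have h : ∀ (A : H →L[ℂ] H) (i j : I),
      adjoint (tmulRight H (e i)) ∘L tensorOp A B ∘L tmulRight H (e j) =
        (inner ℂ (e i) (B (e j)) : ℂ) • A := fun A i j => by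
    ext x
    simp only [ContinuousLinearMap.comp_apply, tensorOp_tmulRight, adjoint_tmulRight_apply,
      smul_apply]
  ext z
  simp only [blockMap, h, hT.map_smul _ A hA]
  simp only [← h, sum_apply, ContinuousLinearMap.comp_apply, copiesProj_apply, map_sum]
  exact Finset.sum_comm

lemma tensorOp_rankOne_self (A : H →L[ℂ] H) (v : K) :
    tensorOp A (rankOne ℂ v v) = tmulRight H v ∘L A ∘L adjoint (tmulRight H v) := by
  refine hilbertTensor_ext fun w x => ?_
  rw [tensorOp_tmulRight, ContinuousLinearMap.comp_apply, ContinuousLinearMap.comp_apply,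
    adjoint_tmulRight_apply, rankOne_apply, tmulRight_apply, TensorProduct.tmul_smul, map_smul,
    map_smul, tmulRight_apply, Completion.coe_smul]

omit [CompleteSpace H] in
lemma norm_tmulRight_le {v : K} (hv : ‖v‖ ≤ 1) : ‖tmulRight H v‖ ≤ 1 := by
  refine ContinuousLinearMap.opNorm_le_bound _ zero_le_one fun x => ?_
  rw [tmulRight_apply, Completion.norm_coe, TensorProduct.norm_tmul, mul_comm]
  exact mul_le_mul_of_nonneg_right hv (norm_nonneg x)

variable [CompleteSpace K]

/-- A bounded map on `S^p(H)` which commutes with sufficiently many self-adjoint unitaries has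
amplifications of the same norm. -/
lemma CommutesWithSigns.amplificationBounded (hT : IsBoundedOnSchatten p C T) (hp : 1 ≤ p)
    (hS : CommutesWithSigns (stdBasisIndex K) p T) : AmplificationBounded p C T K := by
  let ι : stdBasisIndex K → H →L[ℂ] HilbertTensor H K := fun i => tmulRight H (stdBasis K i)
  have hι : OrthogonalCopies ι := orthogonalCopies_tmulRight (stdBasis K)
  have hι1 : ∀ z, Tendsto (fun F => copiesProj ι F z) atTop (𝓝 z) :=
    tendsto_copiesProj_tmulRight (stdBasis K)
  refine ⟨amplification T ι, hι.isBoundedOnSchatten_amplification hι1 hT hp hS,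
    fun A B hA _ => amplification_eq fun z => ?_⟩
  simp_rw [ι, blockMap_tensorOp hT (stdBasis K) _ hA B]
  change Tendsto (fun F => copiesProj ι F (tensorOp (T A) B (copiesProj ι F z))) atTop _
  have h1 : Tendsto (fun F => copiesProj ι F (tensorOp (T A) B (copiesProj ι F z - z)))
      atTop (𝓝 0) := by
    have h0 : Tendsto (fun F => tensorOp (T A) B (copiesProj ι F z - z)) atTop (𝓝 0) := by
      have := ((tensorOp (T A) B).continuous.tendsto _).comp ((hι1 z).sub_const z)
      rwa [sub_self, map_zero] at this
    refine squeeze_zero_norm (fun F => ?_) (tendsto_zero_iff_norm_tendsto_zero.mp h0)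
    simpa using (copiesProj ι F).le_of_opNorm_le (hι.norm_copiesProj_le F)
      (tensorOp (T A) B (copiesProj ι F z - z))
  have h2 := h1.add (hι1 (tensorOp (T A) B z))
  simpa [map_sub] using h2

/-- A map on `S^p(H)` is bounded by the norm of any of its nontrivial amplifications. -/
lemma AmplificationBounded.schattenReal_le (h : AmplificationBounded p C T K) (hp : 1 ≤ p) {v : K}
    (hv : ‖v‖ = 1) {A : H →L[ℂ] H} (hA : MemSchatten p A) :
    schattenReal p (T A) ≤ C * schattenReal p A := by
  obtain ⟨S, hS, hST⟩ := h
  set J := tmulRight H v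
  have hJ : ‖J‖ ≤ 1 := norm_tmulRight_le hv.le
  have hJ' : ‖adjoint J‖ ≤ 1 := by rwa [LinearIsometryEquiv.norm_map]
  have hm : MemSchatten p (tensorOp A (rankOne ℂ v v)) := by
    rw [tensorOp_rankOne_self]; exact hA.conj hp _ _
  have h1 := hS.schattenReal_le hp hm
  have hm' := hS.mapsTo _ hm
  rw [hST A _ hA (memSchatten_rankOne hp v v)] at h1 hm'
  have e : adjoint J ∘L tensorOp (T A) (rankOne ℂ v v) ∘L J = T A := by
    ext x
    have hvv : (inner ℂ v v : ℂ) = 1 := by rw [inner_self_eq_norm_sq_to_K, hv]; simp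
    rw [ContinuousLinearMap.comp_apply, ContinuousLinearMap.comp_apply, tensorOp_tmulRight,
      rankOne_apply, hvv, one_smul, adjoint_tmulRight_apply, hvv, one_smul]
  have h2 := schattenReal_conj_le_of_le hp hm' hJ' hJ
  rw [e, one_mul, mul_one] at h2
  have h3 := schattenReal_conj_le_of_le hp hA hJ hJ'
  rw [← tensorOp_rankOne_self, one_mul, mul_one] at h3
  exact h2.trans (h1.trans (mul_le_mul_of_nonneg_left h3 C.2))

end Tensor

/-! ### Schur multipliers on atomless spaces, and the conclusion. -/

section Multiplier

variable {X : Type u} [MeasurableSpace X] {μ : Measure X} [SigmaFinite μ] {p : ℝ≥0∞} {C : ℝ≥0}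
  {φ : X × X → ℂ} {T : (Lp ℂ 2 μ →L[ℂ] Lp ℂ 2 μ) → (Lp ℂ 2 μ →L[ℂ] Lp ℂ 2 μ)}

lemma ExtendsSchur.commutesWithSigns (hE : ExtendsSchur μ p φ T) (hμ : Atomless μ)
    (hφ : MemLp φ ∞ (μ.prod μ)) (hT : IsBoundedOnSchatten p C T) (hp : 1 ≤ p) (I : Type*) :
    CommutesWithSigns I p T := by
  intro F S ε hε
  obtain ⟨D, hD, h⟩ := hμ.exists_signMul_family F S hε
  exact ⟨fun i => signMul μ (hD i), fun i => norm_signMul_le _, fun i => isSelfAdjoint_signMul _,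
    fun i x => signMul_signMul _ x, fun i j A hA => hT.map_conj_of_rankOne hp (norm_signMul_le _)
      (norm_signMul_le _) (fun f g => hE.map_signMul_rankOne hp hφ _ _ f g) hA, h⟩

end Multiplier

end SchurMultiplier

end

theorem theorem1p18 {X : Type u} [MeasurableSpace X] (μ : Measure X) [SigmaFinite μ]
    (hμ : SchurMultiplier.Atomless μ) (φ : X × X → ℂ) (hφ : MemLp φ ∞ (μ.prod μ))
    (p : ℝ≥0∞) (hp : 1 ≤ p) :
    SchurMultiplier.schurNorm μ p φ = SchurMultiplier.schurCbNorm.{u, v} μ p φ := by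
  unfold SchurMultiplier.schurNorm SchurMultiplier.schurCbNorm
  refine iInf_congr fun C => iInf_congr_Prop (exists_congr fun T => ?_) fun _ => rfl
  refine and_congr_right fun hE => ⟨fun hT => ⟨⟨C, hT⟩, fun K _ _ _ =>
    SchurMultiplier.CommutesWithSigns.amplificationBounded hT hp
      (hE.commutesWithSigns hμ hφ hT hp _)⟩, fun ⟨⟨C', hT⟩, hK⟩ => ?_⟩
  -- A one-dimensional `K` in the required universe recovers the bound for `T` itself with the
  -- constant `C` instead of `C'`.
  have hv : ‖EuclideanSpace.single (PUnit.unit : PUnit.{v + 1}) (1 : ℂ)‖ = 1 := by simp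
  exact SchurMultiplier.isBoundedOnSchatten_of_schattenReal hp hT.mapsTo hT.map_add hT.map_smul
    fun A hA => (hK (EuclideanSpace ℂ PUnit.{v + 1})).schattenReal_le hp hv hA
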